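/- Let $\Theta\subseteq(0,\infty)$ have non-empty interior and let $\lambda:\Theta\times[0,1]\to(0,\infty)$ be such that $\lambda(\vartheta,\cdot)$ is integrable for every $\vartheta\in\Theta$, $\vartheta\mapsto\lambda(\vartheta,t)$ is continuously differentiable on $\Theta$ for almost all $t\in[0,1]$, and $\sup_{\vartheta\in\Theta,t\in[0,1]}\lambda(\vartheta,t)<\infty$. For $T>0$ and $\vartheta\in\Theta$ let $(N_t)_{t\in[0,T]}$ be a Poisson process with cumulative intensity $\Lambda_T(t,\vartheta)=\int_0^t\lambda(\vartheta,s/T)\,ds$, let $\varepsilon_1,\varepsilon_2,\dots$ be i.i.d. with $\mathbb P(\varepsilon_i=1)=\mathbb P(\varepsilon_i=-1)=\tfrac12$, independent of $N$, and put $X_t=\sum_{i=1}^{N_t}\varepsilon_i$. Let $0<\Delta_T\le T$ and let $\mathbb P_\vartheta^{T,\Delta_T}$ be the law of $(X_{\Delta_T},X_{2\Delta_T},\dots,X_{\lfloor T/\Delta_T\rfloor\Delta_T})$. Say that the experiments $\{\mathbb P_\theta^{T,\Delta_T},\theta\in\Theta\}$ have the LAN property at $\vartheta\in\Theta$, as $T\to\infty$,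 with normalisation $J_T$ if $J_T>0$ for large $T$ and there are $\xi_T$ with $\xi_T\to\mathcal N(0,1)$ in distribution under $\mathbb P_\vartheta^{T,\Delta_T}$ such that, for every $v\in\mathbb R$ and whenever $\vartheta+vJ_T^{-1/2}\in\Theta$, $$\frac{d\mathbb P^{T,\Delta_T}_{\vartheta+vJ_T^{-1/2}}}{d\mathbb P^{T,\Delta_T}_{\vartheta}}=\exp\big(v\,\xi_T-\tfrac12v^2+r_T\big),\qquad r_T=r_T(v)\to0\ \text{ in probability under }\mathbb P_\vartheta^{T,\Delta_T},$$ and that they are regular at $\vartheta$ with information $I_T$ if LAN holds at $\vartheta$ with every normalisation $J_T\sim I_T$ (in particular with $I_T$ itself), where $J_T\sim I_T$ means $J_T/I_T\to1$. Let $\vartheta\in\Theta$ be such that $\partial_\vartheta\log\lambda(\vartheta,\cdot)$ is not almost everywhere zero on $[0,1]$ and $\log\lambda$ is Lipschitz at $\vartheta$ uniformly in time: there is $K$ such that for all $\theta\in\Theta$ close enough to $\vartheta$, $|\log\lambda(\theta,t)-\log\lambda(\vartheta,t)|\le K|\theta-\vartheta|$ for almost all $t\in[0,1]$. Then the following hold.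 1. (Microscopic regime.) If $\Delta_T\to0$ as $T\to\infty$, the experiments are regular at $\vartheta$ with information $$I_{T,0}(\vartheta)=T\int_0^1\big(\partial_\vartheta\log\lambda(\vartheta,s)\big)^2\lambda(\vartheta,s)\,ds .$$ Moreover $I_{T,0}(\vartheta)=\lim_{\Delta\to0}I_{T,\Delta}(\vartheta)$ for every $T>0$, with $I_{T,\Delta}$ as in 2. 2. (Intermediate regime.) If $\Delta_T\to\Delta_\infty\in(0,\infty)$, the experiments are regular at $\vartheta$ with information $I_{T,\Delta_\infty}(\vartheta)$, where for $\Delta>0$ $$I_{T,\Delta}(\vartheta)=T\Delta\int_0^1\big(\partial_\vartheta\log\lambda(\vartheta,s)\big)^2\lambda(\vartheta,s)^2\,H_\Delta(\vartheta,s)\,ds,$$ $$H_\Delta(\vartheta,s)=\mathbb E\Big[\Big(\frac{\mathcal I_{|Y|+1}(\lambda(\vartheta,s)\Delta)}{\mathcal I_{|Y|}(\lambda(\vartheta,s)\Delta)}+\frac{|Y|}{\lambda(\vartheta,s)\Delta}-1\Big)^2\Big].$$ Here $Y=\sum_{i=1}^{M}\varepsilon_i$, with $M$ a Poisson variable of mean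 $\lambda(\vartheta,s)\Delta$ independent of the $\varepsilon_i$, and $\mathcal I_\nu(x)=\sum_{m\ge0}\frac{(x/2)^{2m+\nu}}{m!\,(\nu+m)!}$ is the modified Bessel function of the first kind. 3. (Macroscopic regime.) If $\Delta_T\to\infty$, $T/\Delta_T\to\infty$ and $T/\Delta_T^{1+1/4}=o\big((\log(T/\Delta_T))^{-1/4}\big)$, the experiments are regular at $\vartheta$ with information $$I_{T,\infty}(\vartheta)=\frac{T\Delta_T^{-1}}{2}\int_0^1\big(\partial_\vartheta\log\lambda(\vartheta,s)\big)^2\,ds .$$ -/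

import Mathlib

open MeasureTheory ProbabilityTheory Filter Topology Asymptotics
open scoped ENNReal NNReal

noncomputable section

namespace TimeScales

/-- Modified Bessel function of the first kind of order `ν ∈ ℕ`. -/
def besselI (ν : ℕ) (x : ℝ) : ℝ :=
  ∑' m : ℕ, (x / 2) ^ (2 * m + ν) / ((m.factorial : ℝ) * ((ν + m).factorial : ℝ))

/-- The symmetric law on `{-1, 1}`. -/
def signLaw : Measure ℤ :=
  (2⁻¹ : ℝ≥0∞) • Measure.dirac (-1) + (2⁻¹ : ℝ≥0∞) • Measure.dirac 1

/-- The law on `ℤ` of `ε₁ + ⋯ + ε_N`, where `N` is Poisson with mean `x` and the `εᵢ` are i.i.d.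
symmetric signs independent of `N`.  With `x = ℓ Δ` this is the law of `X_Δ` for the compound
Poisson process with constant intensity `ℓ`. -/
def compoundLaw (x : ℝ) : Measure ℤ :=
  (poissonMeasure x.toNNReal).bind fun m =>
    (Measure.pi fun _ : Fin m => signLaw).map fun e => ∑ i, e i

/-- `N` is (on the time interval `[0, T]`) a Poisson process with cumulative intensity `Λ`:
a counting process with nondecreasing right-continuous paths, started at `0`, with independent
increments, whose increment over `(s, t]` is Poisson with mean `Λ t - Λ s`. -/
structure IsPoissonProcess {Ω : Type*} [MeasurableSpace Ω] (μ : Measure Ω) (T : ℝ) (Λ : ℝ → ℝ)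
    (N : ℝ → Ω → ℕ) : Prop where
  measurable : ∀ t ∈ Set.Icc 0 T, Measurable (N t)
  zero : ∀ ω, N 0 ω = 0
  monotone : ∀ ω, MonotoneOn (fun t => N t ω) (Set.Icc 0 T)
  rightCont : ∀ ω, ∀ t ∈ Set.Icc 0 T, ContinuousWithinAt (fun u => N u ω) (Set.Icc t T) t
  indep : HasIndepIncrements (fun (t : Set.Icc (0 : ℝ) T) ω => N t ω) μ
  law : ∀ s ∈ Set.Icc 0 T, ∀ t ∈ Set.Icc 0 T, s ≤ t →
    μ.map (fun ω => N t ω - N s ω) = poissonMeasure (Λ t - Λ s).toNNReal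

/-- Driving data of the compound Poisson process on `[0, T]`: a probability measure, a Poisson
process `N` with cumulative intensity `Λ`, and i.i.d. symmetric signs independent of `N`. -/
structure IsCompoundPoissonModel {Ω : Type*} [MeasurableSpace Ω] (μ : Measure Ω) (T : ℝ)
    (Λ : ℝ → ℝ) (N : ℝ → Ω → ℕ) (ε : ℕ → Ω → ℤ) : Prop where
  isProbabilityMeasure : IsProbabilityMeasure μ
  poisson : IsPoissonProcess μ T Λ N
  sign_measurable : ∀ i, Measurable (ε i)
  sign_law : ∀ i, μ.map (ε i) = signLaw
  sign_indep : iIndepFun ε μ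
  indep : IndepFun (fun ω i => ε i ω) (fun ω (t : Set.Icc (0 : ℝ) T) => N t ω) μ

/-- `X_t = ∑_{i = 1}^{N_t} ε_i` (the signs are indexed from `0`). -/
def compoundProcess {Ω : Type*} (N : ℝ → Ω → ℕ) (ε : ℕ → Ω → ℤ) (t : ℝ) (ω : Ω) : ℤ :=
  ∑ i ∈ Finset.range (N t ω), ε i ω

/-- The law on `ℤ^⌊T/Δ⌋` of the observation `(X_Δ, X_{2Δ}, …, X_{⌊T/Δ⌋Δ})`. -/
def observationLaw {Ω : Type*} [MeasurableSpace Ω] (μ : Measure Ω) (N : ℝ → Ω → ℕ)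
    (ε : ℕ → Ω → ℤ) (T Δ : ℝ) : Measure (Fin ⌊T / Δ⌋₊ → ℤ) :=
  μ.map fun ω i => compoundProcess N ε (((i : ℕ) + 1 : ℝ) * Δ) ω

/-- Cumulative intensity `Λ_T(t, ϑ) = ∫₀ᵗ lam(ϑ, s / T) ds`. -/
def cumIntensity (lam : ℝ → ℝ → ℝ) (T ϑ t : ℝ) : ℝ :=
  ∫ s in (0 : ℝ)..t, lam ϑ (s / T)

/-- Local asymptotic normality, as `T → ∞`, of the experiments `{P T θ, θ ∈ Θ}` on `S T`, at the
point `ϑ`, with normalisation `J T > 0`: the likelihood ratio between `ϑ + v / √(J T)` and `ϑ` is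
`exp (v ξ_T - v² / 2 + r_T)` whenever `ϑ + v / √(J T) ∈ Θ`, where under `P T ϑ` the variable `ξ_T`
(not depending on `v`) tends to `𝒩(0, 1)` in distribution and `r_T` to `0` in probability. -/
def IsLAN {S : ℝ → Type*} [∀ T, MeasurableSpace (S T)] (Θ : Set ℝ)
    (P : ∀ T : ℝ, ℝ → Measure (S T)) (J : ℝ → ℝ) (ϑ : ℝ) : Prop :=
  (∀ᶠ T in atTop, 0 < J T) ∧
  ∃ ξ : ∀ T, S T → ℝ,
    (∀ T, Measurable (ξ T)) ∧
    (∀ f : BoundedContinuousFunction ℝ ℝ,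
      Tendsto (fun T => ∫ x, f (ξ T x) ∂(P T ϑ)) atTop (𝓝 (∫ y, f y ∂(gaussianReal 0 1)))) ∧
    ∀ v : ℝ, ∃ r : ∀ T, S T → ℝ,
      (∀ T, Measurable (r T)) ∧
      (∀ T > 0, ϑ + v / √(J T) ∈ Θ →
        P T (ϑ + v / √(J T)) ≪ P T ϑ ∧
        ∀ᵐ x ∂(P T ϑ), ((P T (ϑ + v / √(J T))).rnDeriv (P T ϑ) x).toReal =
          Real.exp (v * ξ T x - v ^ 2 / 2 + r T x)) ∧
      ∀ δ > 0, Tendsto (fun T => P T ϑ {x | δ ≤ |r T x|})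
        (atTop ⊓ 𝓟 {T | ϑ + v / √(J T) ∈ Θ}) (𝓝 0)

/-- Regularity with information `I`: the LAN property holds at `ϑ` with normalisation `I`, and with
any normalisation asymptotically equivalent to `I`. -/
def IsRegularWithInformation {S : ℝ → Type*} [∀ T, MeasurableSpace (S T)] (Θ : Set ℝ)
    (P : ∀ T : ℝ, ℝ → Measure (S T)) (I : ℝ → ℝ) (ϑ : ℝ) : Prop :=
  ∀ J : ℝ → ℝ, IsEquivalent atTop J I → IsLAN Θ P J ϑ

/-- The score `∂_ϑ log lam(ϑ, s)` of the intensity (derivative within the parameter set). -/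
def score (Θ : Set ℝ) (lam : ℝ → ℝ → ℝ) (ϑ s : ℝ) : ℝ :=
  derivWithin (fun θ => Real.log (lam θ s)) Θ ϑ

/-- Microscopic information. -/
def infoMicro (Θ : Set ℝ) (lam : ℝ → ℝ → ℝ) (T ϑ : ℝ) : ℝ :=
  T * ∫ s in (0 : ℝ)..1, score Θ lam ϑ s ^ 2 * lam ϑ s

/-- The Bessel ratio `I_{|k|+1}(x) / I_{|k|}(x)`. -/
def besselRatio (x : ℝ) (k : ℤ) : ℝ :=
  besselI (k.natAbs + 1) x / besselI k.natAbs x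

/-- `H = E[(h(X) + x⁻¹ |X| - 1)²]`, `X` compound Poisson with Poisson mean `x`. -/
def besselInfo (x : ℝ) : ℝ :=
  ∫ k : ℤ, (besselRatio x k + x⁻¹ * |(k : ℝ)| - 1) ^ 2 ∂(compoundLaw x)

/-- Intermediate information at sampling step `Δ`. -/
def infoInter (Θ : Set ℝ) (lam : ℝ → ℝ → ℝ) (Δ T ϑ : ℝ) : ℝ :=
  T * Δ * ∫ s in (0 : ℝ)..1, score Θ lam ϑ s ^ 2 * lam ϑ s ^ 2 * besselInfo (lam ϑ s * Δ)

/-- Macroscopic information at sampling step `Δ`. -/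
def infoMacro (Θ : Set ℝ) (lam : ℝ → ℝ → ℝ) (Δ T ϑ : ℝ) : ℝ :=
  T * Δ⁻¹ / 2 * ∫ s in (0 : ℝ)..1, score Θ lam ϑ s ^ 2

end TimeScales

end

open MeasureTheory ProbabilityTheory Filter Topology Asymptotics
open scoped ENNReal NNReal

noncomputable section

namespace TimeScales

/-! The increments of the observation over the sampling grid are independent, and each is compound
Poisson with mean number of jumps `x`, the integral of the intensity over the cell; its mass at `k`
is `e^{-x} I_|k|(x)` (`map_increments_observationLaw`, `compoundLaw_singleton`). An observation and
its increments determine each other, so the likelihood ratio is a product of explicit weights. These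
are studied in the parameter `log x`, in which one set of estimates serves all three regimes.

In that parameter the score is `s = w - x` with `w = x I_ν' / I_ν` and `ν = |k|`. The Riccati
equation `x w' = x² + ν² - w²` expresses every derivative of `s` through `s` itself, and comparison
arguments bound `s` and its first two derivatives by polynomials in `min 1 x` and `k² / max 1 x`,
uniformly in `x > 0`. Exponential moments then make all required moments at most of order `min 1 x`
(`exists_score_moment_bound`). Stein identities, which are the Bessel recurrences summed against the
law, give that `s` is centred, that its derivative has mean `-G` where `G = E s²` is the Fisher
information, and that `2 x G(x) = x + O(1)` for large `x`. Hence `G(x) → 1/2` at infinity, while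
`G(x) ~ x` at zero; these two limits are the macroscopic and microscopic informations, and the
intermediate one is `G` itself.

For the LAN expansion put `δ_i = log (x_i(θ) / x_i(ϑ))`. A Taylor expansion with cubic remainder
splits the error into two sums of independent centred terms, an `L¹`-small sum and a deterministic
term (`lanRemainder_eq`). A Lyapunov central limit theorem treats the linear statistic
(`tendsto_integral_centralSequence`).

In rescaled time `x_i` is `Δ_T` times the average of the intensity over a block of length `Δ_T / T`.
Lebesgue differentiation and dominated convergence turn sums over blocks into integrals
(`tendsto_sum_blocks`), and the Lipschitz hypothesis provides the domination needed to linearise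
`δ_i` in `θ - ϑ` (`exists_sum_sq_log_ratio_le`). All this is assembled in
`isRegularWithInformation_of_regime` for a scale `c_T` and a profile `φ` with `G(Δ_T y) / c_T →
φ(y)`. The three regimes are `c_T = Δ_T`, `Δ_T / Δ_∞`, `1` with `φ(y) = y`, `G(y Δ_∞)`, `1/2`. Only
the limit of `J_T / I_T` is used, so equivalent normalisations come at no cost. -/

/-! ### The modified Bessel functions -/

/-- The entire function `∑ yᵐ / (m! (ν + m)!)`, so that `I_ν x = (x / 2) ^ ν * F_ν (x² / 4)`. -/
def besselAux (ν : ℕ) (y : ℝ) : ℝ :=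
  ∑' m : ℕ, y ^ m / ((m.factorial : ℝ) * ((ν + m).factorial : ℝ))

lemma norm_besselAux_term_le (ν m : ℕ) {y R : ℝ} (h : |y| ≤ R) :
    ‖y ^ m / ((m.factorial : ℝ) * ((ν + m).factorial : ℝ))‖ ≤ R ^ m / m.factorial := by
  have h1 : (1 : ℝ) ≤ ((ν + m).factorial : ℝ) := by
    exact_mod_cast Nat.one_le_iff_ne_zero.2 (Nat.factorial_ne_zero _)
  have h2 : (0 : ℝ) < (m.factorial : ℝ) := by positivity
  rw [norm_div, norm_pow, Real.norm_eq_abs, Real.norm_of_nonneg (by positivity)]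
  have hR : 0 ≤ R := (abs_nonneg y).trans h
  gcongr
  nlinarith

lemma summable_besselAux (ν : ℕ) (y : ℝ) :
    Summable fun m : ℕ => y ^ m / ((m.factorial : ℝ) * ((ν + m).factorial : ℝ)) :=
  Summable.of_norm_bounded (Real.summable_pow_div_factorial |y|)
    fun m => norm_besselAux_term_le ν m le_rfl

/-- Termwise differentiation: cancelling `m` against `m!` shifts the index and raises the order by
one. -/
lemma hasDerivAt_besselAux (ν : ℕ) (y : ℝ) :
    HasDerivAt (besselAux ν) (besselAux (ν + 1) y) y := by
  set R : ℝ := |y| + 1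
  have hy : y ∈ Metric.ball (0 : ℝ) R := by simp [R]
  let g' : ℕ → ℝ → ℝ := fun m z =>
    m * z ^ (m - 1) / ((m.factorial : ℝ) * ((ν + m).factorial : ℝ))
  have hg'succ : ∀ (m : ℕ) (z : ℝ), g' (m + 1) z =
      z ^ m / ((m.factorial : ℝ) * ((ν + 1 + m).factorial : ℝ)) := by
    intro m z
    have h2 : (m.factorial : ℝ) ≠ 0 := by positivity
    have h4 : ((m : ℝ) + 1) ≠ 0 := by positivity
    have h5 : ν + (m + 1) = ν + 1 + m := by ring
    have h3 : ((ν + 1 + m).factorial : ℝ) ≠ 0 := by positivity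
    simp only [g', Nat.factorial_succ, Nat.add_sub_cancel, h5]
    push_cast
    field_simp
  -- The derivative of the constant term vanishes, so the majorant on the ball is the exponential
  -- series of `R` shifted by one, with `0` in front.
  have hsum : Summable fun m : ℕ => (if m = 0 then 0 else R ^ (m - 1) / (m - 1).factorial) := by
    rw [← summable_nat_add_iff 1]
    simpa using Real.summable_pow_div_factorial R
  have key := hasDerivAt_tsum_of_isPreconnected (𝕜 := ℝ)
    (g := fun (m : ℕ) (z : ℝ) => z ^ m / ((m.factorial : ℝ) * ((ν + m).factorial : ℝ)))
    (g' := g') hsum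
    Metric.isOpen_ball (convex_ball (0 : ℝ) R).isPreconnected
    (fun m z _ => (hasDerivAt_pow m z).div_const _) (fun m z hz => by
      rcases m with _ | m
      · simp [g']
      · rw [hg'succ]
        simpa using norm_besselAux_term_le (ν + 1) m (le_of_lt (by simpa using hz))) hy
    (summable_besselAux ν y) hy
  have hs : Summable fun m => g' m y := by
    rw [← summable_nat_add_iff 1]
    simpa only [hg'succ] using summable_besselAux (ν + 1) y
  have e : ∑' m, g' m y = besselAux (ν + 1) y := by
    rw [hs.tsum_eq_zero_add]
    simp only [hg'succ, besselAux]
    simp [g']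
  rw [← e]
  exact key

lemma besselI_eq (ν : ℕ) (x : ℝ) : besselI ν x = (x / 2) ^ ν * besselAux ν (x ^ 2 / 4) := by
  rw [besselI, besselAux, ← tsum_mul_left]
  congr 1 with m
  have : (x ^ 2 / 4) ^ m = (x / 2) ^ (2 * m) := by
    rw [pow_mul]; congr 1; ring
  rw [this, pow_add]
  ring

lemma summable_besselI (ν : ℕ) (x : ℝ) : Summable fun m : ℕ =>
    (x / 2) ^ (2 * m + ν) / ((m.factorial : ℝ) * ((ν + m).factorial : ℝ)) := by
  refine ((summable_besselAux ν (x ^ 2 / 4)).mul_left ((x / 2) ^ ν)).congr fun m => ?_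
  have : (x ^ 2 / 4) ^ m = (x / 2) ^ (2 * m) := by
    rw [pow_mul]; congr 1; ring
  rw [this, pow_add]
  ring

lemma besselI_pos (ν : ℕ) {x : ℝ} (hx : 0 < x) : 0 < besselI ν x :=
  (summable_besselI ν x).tsum_pos (fun m => by positivity) 0 (by positivity)

/-- Write `1 / (ν + m)! = ((ν + 1) + m) / (ν + 1 + m)!`; the summand `m` cancels a factor of `m!`
and shifts the index. -/
lemma besselAux_rec (ν : ℕ) (y : ℝ) :
    besselAux ν y = (ν + 1) * besselAux (ν + 1) y + y * besselAux (ν + 2) y := by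
  have h1 := (summable_besselAux (ν + 1) y).mul_left ((ν : ℝ) + 1)
  have h2 := (summable_besselAux (ν + 2) y).mul_left y
  have key : ∀ m : ℕ, y ^ (m + 1) / (((m + 1).factorial : ℝ) * ((ν + (m + 1)).factorial : ℝ)) =
      ((ν : ℝ) + 1) * (y ^ (m + 1) / (((m + 1).factorial : ℝ) * ((ν + 1 + (m + 1)).factorial : ℝ)))
      + y * (y ^ m / ((m.factorial : ℝ) * ((ν + 2 + m).factorial : ℝ))) := by
    intro m
    have e1 : ν + 1 + (m + 1) = (ν + (m + 1)) + 1 := by ring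
    have e2 : ν + 2 + m = (ν + (m + 1)) + 1 := by ring
    rw [e1, e2, Nat.factorial_succ (ν + (m + 1)), Nat.factorial_succ m]
    have h2 : (m.factorial : ℝ) ≠ 0 := by positivity
    have h3 : ((ν + (m + 1)).factorial : ℝ) ≠ 0 := by positivity
    have h4 : ((m : ℝ) + 1) ≠ 0 := by positivity
    have h5 : ((ν : ℝ) + (m + 1) + 1) ≠ 0 := by positivity
    push_cast
    field_simp
    ring
  rw [besselAux, besselAux, besselAux, (summable_besselAux ν y).tsum_eq_zero_add,
    ← tsum_mul_left, ← tsum_mul_left, h1.tsum_eq_zero_add, add_assoc,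
    ← ((summable_nat_add_iff 1).2 h1).tsum_add h2]
  congr 1
  · have : (((ν + 1).factorial : ℕ) : ℝ) = (ν + 1) * (ν.factorial : ℝ) := by
      rw [Nat.factorial_succ]; push_cast; ring
    have h3 : (ν.factorial : ℝ) ≠ 0 := by positivity
    have h4 : ((ν : ℝ) + 1) ≠ 0 := by positivity
    simp only [pow_zero, Nat.factorial_zero, add_zero, this]
    field_simp
  · exact tsum_congr key

lemma besselI_rec (ν : ℕ) (x : ℝ) :
    x * besselI ν x = 2 * (ν + 1) * besselI (ν + 1) x + x * besselI (ν + 2) x := by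
  rw [besselI_eq, besselI_eq, besselI_eq, besselAux_rec]
  ring

/-- The form that raises the order is used because orders are natural numbers and both terms are
nonnegative for `x > 0`. -/
lemma hasDerivAt_besselI (ν : ℕ) {x : ℝ} (hx : x ≠ 0) :
    HasDerivAt (besselI ν) (ν / x * besselI ν x + besselI (ν + 1) x) x := by
  have h1 : HasDerivAt (fun x : ℝ => (x / 2) ^ ν * besselAux ν (x ^ 2 / 4))
      (ν * (x / 2) ^ (ν - 1) * (1 / 2) * besselAux ν (x ^ 2 / 4)
        + (x / 2) ^ ν * (besselAux (ν + 1) (x ^ 2 / 4) * (2 * x / 4))) x := by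
    refine HasDerivAt.mul (((hasDerivAt_id x).div_const 2).pow ν) ?_
    refine HasDerivAt.comp (h := fun x : ℝ => x ^ 2 / 4) x (hasDerivAt_besselAux ν (x ^ 2 / 4)) ?_
    simpa using (hasDerivAt_pow 2 x).div_const 4
  rw [show besselI ν = fun x : ℝ => (x / 2) ^ ν * besselAux ν (x ^ 2 / 4) from
    funext (besselI_eq ν)]
  convert h1 using 1
  rw [besselI_eq]
  rcases ν with _ | n
  · simp; ring
  · simp only [Nat.add_sub_cancel]
    field_simp
    ring

lemma continuous_besselI (ν : ℕ) : Continuous (besselI ν) := by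
  rw [show besselI ν = fun x : ℝ => (x / 2) ^ ν * besselAux ν (x ^ 2 / 4) from
    funext (besselI_eq ν)]
  have : Continuous (besselAux ν) :=
    continuous_iff_continuousAt.2 fun y => (hasDerivAt_besselAux ν y).continuousAt
  fun_prop

/-! ### The logarithmic derivative `w = x I_ν' / I_ν` -/

/-- `x I_ν'(x) / I_ν(x) = ν + x I_{ν+1}(x) / I_ν(x)`. -/
def besselLogDer (ν : ℕ) (x : ℝ) : ℝ := ν + x * besselI (ν + 1) x / besselI ν x

lemma hasDerivAt_log_besselI (ν : ℕ) {x : ℝ} (hx : 0 < x) :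
    HasDerivAt (fun x => Real.log (besselI ν x)) (besselLogDer ν x / x) x := by
  have hI := (besselI_pos ν hx).ne'
  convert (hasDerivAt_besselI ν hx.ne').log hI using 1
  rw [besselLogDer]
  field_simp

/-- This is the Bessel equation in Riccati form; the three-term recurrence eliminates `I_{ν+2}`. It
is the source of every later derivative. -/
lemma hasDerivAt_besselLogDer (ν : ℕ) {x : ℝ} (hx : 0 < x) :
    HasDerivAt (besselLogDer ν) ((x ^ 2 + ν ^ 2 - besselLogDer ν x ^ 2) / x) x := by
  have hI := (besselI_pos ν hx).ne'
  have h := (((hasDerivAt_id x).mul (hasDerivAt_besselI (ν + 1) hx.ne')).div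
    (hasDerivAt_besselI ν hx.ne') hI).const_add (ν : ℝ)
  refine h.congr_deriv ?_
  have hrec := besselI_rec ν x
  have h2 : besselI (ν + 1 + 1) x =
      besselI ν x - 2 * (ν + 1) / x * besselI (ν + 1) x := by
    field_simp
    linarith
  simp only [Pi.mul_apply, id, besselLogDer]
  rw [h2]
  push_cast
  field_simp
  ring

lemma le_besselLogDer (ν : ℕ) {x : ℝ} (hx : 0 < x) : (ν : ℝ) ≤ besselLogDer ν x := by
  have := besselI_pos ν hx
  have := besselI_pos (ν + 1) hx
  rw [besselLogDer]
  have : 0 ≤ x * besselI (ν + 1) x / besselI ν x := by positivity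
  linarith

lemma besselLogDer_nonneg (ν : ℕ) {x : ℝ} (hx : 0 < x) : 0 ≤ besselLogDer ν x :=
  (Nat.cast_nonneg ν).trans (le_besselLogDer ν hx)

/-- The function `(y² + ν²) I_ν² - (y I_ν')²` vanishes at `0` and, by the Bessel equation, has
derivative `2 y I_ν² ≥ 0`. -/
lemma besselLogDer_sq_le (ν : ℕ) {x : ℝ} (hx : 0 < x) :
    besselLogDer ν x ^ 2 ≤ x ^ 2 + ν ^ 2 := by
  let g : ℝ → ℝ := fun y => (y ^ 2 + ν ^ 2) * besselI ν y ^ 2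
    - (ν * besselI ν y + y * besselI (ν + 1) y) ^ 2
  have hmono : MonotoneOn g (Set.Ici 0) := by
    refine monotoneOn_of_hasDerivWithinAt_nonneg (f' := fun y => 2 * y * besselI ν y ^ 2)
      (convex_Ici 0) ?_ ?_ ?_
    · have := continuous_besselI ν
      have := continuous_besselI (ν + 1)
      exact Continuous.continuousOn (by fun_prop)
    · intro y hy
      rw [interior_Ici] at hy
      have hy : 0 < y := hy
      apply HasDerivAt.hasDerivWithinAt
      have h0 := hasDerivAt_besselI ν hy.ne'
      have h1 := hasDerivAt_besselI (ν + 1) hy.ne'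
      have h2 := (((hasDerivAt_pow 2 y).add_const ((ν : ℝ) ^ 2)).mul (h0.pow 2)).sub
        (((h0.const_mul (ν : ℝ)).add ((hasDerivAt_id y).mul h1)).pow 2)
      refine h2.congr_deriv ?_
      have hrec := besselI_rec ν y
      have h2 : besselI (ν + 1 + 1) y =
          besselI ν y - 2 * (ν + 1) / y * besselI (ν + 1) y := by
        field_simp
        linarith
      simp only [Pi.mul_apply, id, Pi.pow_apply, Pi.add_apply]
      rw [h2]
      push_cast
      field_simp
      ring
    · intro y hy
      rw [interior_Ici] at hy
      have hy : 0 < y := hy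
      positivity
  have h0 : g 0 = 0 := by simp [g]; ring
  have h1 : g 0 ≤ g x := hmono (by simp) hx.le hx.le
  rw [h0] at h1
  have hI := besselI_pos ν hx
  have hw : besselLogDer ν x * besselI ν x = ν * besselI ν x + x * besselI (ν + 1) x := by
    rw [besselLogDer]; field_simp
  simp only [g] at h1
  rw [← hw, mul_pow, ← sub_mul] at h1
  have := nonneg_of_mul_nonneg_left h1 (by positivity)
  linarith

/-- The recurrence reads `(w_ν - ν)(w_{ν+1} + ν + 1) = x²`. Inserting the upper bound `R = √(x² +
(ν+1)²)` for `w_{ν+1}` and factoring `x² = (R - (ν+1))(R + ν + 1)` gives the lower bound for `w_ν`.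
-/
lemma besselLogDer_ge (ν : ℕ) {x : ℝ} (hx : 0 < x) :
    √(x ^ 2 + (ν + 1) ^ 2) - 1 ≤ besselLogDer ν x := by
  have h0 := besselI_pos ν hx
  have h1 := besselI_pos (ν + 1) hx
  have h2 := besselI_pos (ν + 2) hx
  have hrec := besselI_rec ν x
  have hw : besselLogDer (ν + 1) x ≤ √(x ^ 2 + (ν + 1) ^ 2) := by
    apply Real.le_sqrt_of_sq_le
    have := besselLogDer_sq_le (ν + 1) hx
    push_cast at this
    exact this
  have hR : 0 < √(x ^ 2 + (ν + 1) ^ 2) := by positivity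
  have hR2 : √(x ^ 2 + (ν + 1) ^ 2) ^ 2 = x ^ 2 + (ν + 1) ^ 2 := Real.sq_sqrt (by positivity)
  set R := √(x ^ 2 + (ν + 1) ^ 2)
  have e : (besselLogDer ν x - ν) * (besselLogDer (ν + 1) x + ν + 1) = x ^ 2 := by
    rw [besselLogDer, besselLogDer]
    push_cast
    field_simp
    linear_combination (-x) * besselI (ν + 1) x * hrec
  have hpos : 0 < R + ν + 1 := by positivity
  have hle : 0 ≤ besselLogDer ν x - ν := sub_nonneg.2 (le_besselLogDer ν hx)
  have h3 : x ^ 2 ≤ (besselLogDer ν x - ν) * (R + ν + 1) := by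
    rw [← e]
    gcongr
  have h4 : x ^ 2 = (R - (ν + 1)) * (R + ν + 1) := by linarith [hR2, show (R - (ν + 1)) * (R + ν + 1) = R ^ 2 - (ν + 1) ^ 2 by ring]
  rw [h4] at h3
  have := le_of_mul_le_mul_right h3 hpos
  linarith

/-! ### The score in the logarithmic parameter and its derivatives -/

/-- The score `∂_u log (e^{-x} I_ν(x))` at `x = eᵘ`. -/
def logScore (ν : ℕ) (x : ℝ) : ℝ := besselLogDer ν x - x

/-- The derivative of `logScore` in the variable `log x`. -/
def logScoreDer (ν : ℕ) (x : ℝ) : ℝ :=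
  ν ^ 2 - x - 2 * x * logScore ν x - logScore ν x ^ 2

/-- The second derivative of `logScore` in the variable `log x`. -/
def logScoreDer₂ (ν : ℕ) (x : ℝ) : ℝ :=
  -2 * besselLogDer ν x * logScoreDer ν x - x * (1 + 2 * logScore ν x)

lemma hasDerivAt_logScore (ν : ℕ) {x : ℝ} (hx : 0 < x) :
    HasDerivAt (logScore ν) (logScoreDer ν x / x) x := by
  refine ((hasDerivAt_besselLogDer ν hx).sub (hasDerivAt_id x)).congr_deriv ?_
  rw [logScoreDer, logScore]
  field_simp
  ring

lemma hasDerivAt_logScoreDer (ν : ℕ) {x : ℝ} (hx : 0 < x) :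
    HasDerivAt (logScoreDer ν) (logScoreDer₂ ν x / x) x := by
  have hs := hasDerivAt_logScore ν hx
  have h := (((hasDerivAt_id x).const_sub ((ν : ℝ) ^ 2)).sub
    (((hasDerivAt_id x).const_mul 2).mul hs)).sub (hs.pow 2)
  refine h.congr_deriv ?_
  simp only [id]
  rw [logScoreDer₂, show besselLogDer ν x = logScore ν x + x by rw [logScore]; ring]
  field_simp
  ring

lemma hasDerivAt_logScoreDer₂ (ν : ℕ) {x : ℝ} (hx : 0 < x) :
    HasDerivAt (logScoreDer₂ ν) ((-2 * besselLogDer ν x * logScoreDer₂ ν x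
      - 2 * logScoreDer ν x ^ 2 - 4 * x * logScoreDer ν x - x * (1 + 2 * logScore ν x)) / x) x := by
  have hs := hasDerivAt_logScore ν hx
  have h := (((hasDerivAt_besselLogDer ν hx).const_mul (-2)).mul
    (hasDerivAt_logScoreDer ν hx)).sub ((hasDerivAt_id x).mul ((hs.const_mul 2).const_add 1))
  refine h.congr_deriv ?_
  simp only [id]
  have e : (x ^ 2 + (ν : ℝ) ^ 2 - besselLogDer ν x ^ 2) = logScoreDer ν x + x := by
    rw [logScoreDer, logScore]; ring
  rw [e]
  field_simp
  ring

lemma neg_one_le_logScore (ν : ℕ) {x : ℝ} (hx : 0 < x) : -1 ≤ logScore ν x := by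
  have h := besselLogDer_ge ν hx
  have : x ≤ √(x ^ 2 + (ν + 1) ^ 2) := Real.le_sqrt_of_sq_le (by nlinarith)
  rw [logScore]; linarith

lemma neg_le_logScore (ν : ℕ) {x : ℝ} (hx : 0 < x) : -x ≤ logScore ν x := by
  have := besselLogDer_nonneg ν hx
  rw [logScore]; linarith

lemma logScore_le (ν : ℕ) {x : ℝ} (hx : 0 < x) : logScore ν x ≤ ν := by
  have h := besselLogDer_sq_le ν hx
  have hn : (0 : ℝ) ≤ ν := Nat.cast_nonneg ν
  rw [logScore]
  nlinarith [besselLogDer_nonneg ν hx]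

/-- By the inequality of means, `2 x w ≤ x² + w² ≤ 2 x² + ν²`. -/
lemma logScore_le_div (ν : ℕ) {x : ℝ} (hx : 0 < x) : logScore ν x ≤ ν ^ 2 / (2 * x) := by
  have h := besselLogDer_sq_le ν hx
  rw [logScore, le_div_iff₀ (by positivity)]
  nlinarith [sq_nonneg (besselLogDer ν x - x)]

/-- The control variable for the score and its first derivative. -/
def scoreBound (ν : ℕ) (x : ℝ) : ℝ := min 1 x + ν ^ 2 / max 1 x

lemma natCast_le_sq (ν : ℕ) : (ν : ℝ) ≤ (ν : ℝ) ^ 2 := by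
  exact_mod_cast Nat.le_self_pow two_ne_zero ν

/-- For `x ≥ 1` the relevant pair is `-1 ≤ s ≤ ν² / (2x)`, for `x ≤ 1` it is `-x ≤ s ≤ ν ≤ ν²`.
Since `k²` has mean `x`, the resulting control variable has mean `2 min 1 x`. -/
lemma abs_logScore_le (ν : ℕ) {x : ℝ} (hx : 0 < x) : |logScore ν x| ≤ scoreBound ν x := by
  have h1 := neg_one_le_logScore ν hx
  have h2 := neg_le_logScore ν hx
  have h3 := logScore_le ν hx
  have h4 := logScore_le_div ν hx
  have h5 := natCast_le_sq ν
  rw [scoreBound]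
  rcases le_total 1 x with h | h
  · rw [min_eq_left h, max_eq_right h, abs_le]
    have : (ν : ℝ) ^ 2 / (2 * x) ≤ ν ^ 2 / x := by gcongr; linarith
    have : 0 ≤ (ν : ℝ) ^ 2 / x := by positivity
    constructor <;> linarith
  · rw [min_eq_right h, max_eq_left h, div_one, abs_le]
    constructor <;> nlinarith

/-- The quantity equals `x² + ν² - w² - x`. The upper bound on `w` gives `≥ -x`; the lower bound `w
≥ R - 1` gives `≤ 2 (R - ν - 1) - x ≤ x`, because `R ≤ x + ν + 1`. -/
lemma abs_logScoreDer_le_self (ν : ℕ) {x : ℝ} (hx : 0 < x) : |logScoreDer ν x| ≤ x := by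
  have h1 := besselLogDer_sq_le ν hx
  have h2 := besselLogDer_ge ν hx
  have hR2 : √(x ^ 2 + (ν + 1) ^ 2) ^ 2 = x ^ 2 + (ν + 1) ^ 2 := Real.sq_sqrt (by positivity)
  have hR1 : (ν : ℝ) + 1 ≤ √(x ^ 2 + (ν + 1) ^ 2) := Real.le_sqrt_of_sq_le (by nlinarith)
  have hRx : √(x ^ 2 + (ν + 1) ^ 2) ≤ x + (ν + 1) :=
    Real.sqrt_le_iff.2 ⟨by positivity, by nlinarith [mul_nonneg hx.le (Nat.cast_nonneg (α := ℝ) ν)]⟩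
  have hn : (0 : ℝ) ≤ ν := Nat.cast_nonneg ν
  have e : logScoreDer ν x = x ^ 2 + (ν : ℝ) ^ 2 - besselLogDer ν x ^ 2 - x := by
    rw [logScoreDer, logScore]; ring
  set R := √(x ^ 2 + (ν + 1) ^ 2)
  have h3 : (R - 1) ^ 2 ≤ besselLogDer ν x ^ 2 := pow_le_pow_left₀ (by linarith) h2 2
  rw [e, abs_le]
  constructor <;> nlinarith

/-- A barrier argument for `y' = -(2 w / x) y + r`, written with the integrating factor `I_ν²`. -/
lemma abs_le_of_besselBarrier (ν : ℕ) {a : ℝ} (ha : 0 < a) {f f' B B' : ℝ → ℝ}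
    (hf : ∀ x, a ≤ x → HasDerivAt f (f' x) x) (hB : ∀ x, a ≤ x → HasDerivAt B (B' x) x)
    (h : ∀ x, a ≤ x → |f' x + 2 * besselLogDer ν x / x * f x|
      ≤ B' x + 2 * besselLogDer ν x / x * B x)
    (h0 : |f a| ≤ B a) {x : ℝ} (hx : a ≤ x) : |f x| ≤ B x := by
  have key : ∀ σ : ℝ, (σ = 1 ∨ σ = -1) → 0 ≤ B x + σ * f x := by
    intro σ hσ
    -- Since `(I_ν²)' = (2 w / y) I_ν²`, the derivative of this product is `I_ν²` times the
    -- combination controlled by `h`, hence nonnegative. The sign `σ` treats both sides of the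
    -- absolute value at once.
    let g : ℝ → ℝ := fun y => (B y + σ * f y) * besselI ν y ^ 2
    have hg : ∀ y, a ≤ y → HasDerivAt g ((B' y + σ * f' y) * besselI ν y ^ 2
        + (B y + σ * f y) * (2 * besselI ν y ^ (2 - 1)
          * (ν / y * besselI ν y + besselI (ν + 1) y))) y := by
      intro y hy
      exact ((hB y hy).add ((hf y hy).const_mul σ)).mul
        ((hasDerivAt_besselI ν (ha.trans_le hy).ne').pow 2)
    have hmono : MonotoneOn g (Set.Ici a) := by
      refine monotoneOn_of_hasDerivWithinAt_nonneg (convex_Ici a)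
        (fun y hy => (hg y hy).continuousAt.continuousWithinAt)
        (fun y hy => (hg y (interior_subset hy)).hasDerivWithinAt) ?_
      intro y hy
      have hy : a ≤ y := interior_subset hy
      have hy0 := ha.trans_le hy
      have hI := besselI_pos ν hy0
      have e : ν / y * besselI ν y + besselI (ν + 1) y = besselLogDer ν y / y * besselI ν y := by
        rw [besselLogDer]; field_simp
      rw [e]
      have h1 := abs_le.1 (h y hy)
      have : (B' y + σ * f' y) * besselI ν y ^ 2
        + (B y + σ * f y) * (2 * besselI ν y ^ (2 - 1) * (besselLogDer ν y / y * besselI ν y))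
        = (B' y + 2 * besselLogDer ν y / y * B y
          + σ * (f' y + 2 * besselLogDer ν y / y * f y)) * besselI ν y ^ 2 := by
        simp only [Nat.add_one_sub_one, pow_one]; ring
      rw [this]
      refine mul_nonneg ?_ (sq_nonneg _)
      rcases hσ with rfl | rfl <;> linarith [h1.1, h1.2]
    have h1 : g a ≤ g x := hmono (by simp) hx hx
    have h2 : 0 ≤ g a := by
      refine mul_nonneg ?_ (sq_nonneg _)
      have := abs_le.1 h0
      rcases hσ with rfl | rfl <;> linarith [this.1, this.2]
    exact nonneg_of_mul_nonneg_left (h2.trans h1) (pow_pos (besselI_pos ν (ha.trans_le hx)) 2)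
  rw [abs_le]
  have h1 := key 1 (Or.inl rfl)
  have h2 := key (-1) (Or.inr rfl)
  constructor <;> linarith

lemma sub_one_le_besselLogDer (ν : ℕ) {x : ℝ} (hx : 0 < x) : x - 1 ≤ besselLogDer ν x := by
  have := neg_one_le_logScore ν hx
  rw [logScore] at this
  linarith

/-- The derivative `D` of the score solves `D' + (2w/x) D = -(1 + 2s)`, whose right side is at most
`1 + ν²/x` in absolute value. From `x = 2` on, `w ≥ x - 1` makes the damping `2w/x` at least `1`, so
the barrier absorbs the forcing; the initial value comes from `|D| ≤ x`. -/
lemma abs_logScoreDer_le_of_two_le (ν : ℕ) {x : ℝ} (hx : 2 ≤ x) :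
    |logScoreDer ν x| ≤ 3 + 2 * (ν ^ 2 / x) := by
  refine abs_le_of_besselBarrier ν two_pos (f := logScoreDer ν)
    (f' := fun x => logScoreDer₂ ν x / x)
    (B := fun x => 3 + 2 * (ν ^ 2 / x)) (B' := fun x => -(2 * ν ^ 2 / x ^ 2))
    (fun y hy => hasDerivAt_logScoreDer ν (two_pos.trans_le hy)) (fun y hy => ?_)
    (fun y hy => ?_) ?_ hx
  · have hy0 : y ≠ 0 := (two_pos.trans_le hy).ne'
    refine ((((hasDerivAt_inv hy0).const_mul ((ν : ℝ) ^ 2)).const_mul 2).const_add 3).congr_deriv ?_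
    field_simp
  · have hy0 : 0 < y := two_pos.trans_le hy
    have hw := sub_one_le_besselLogDer ν hy0
    have hs := abs_logScore_le ν hy0
    rw [scoreBound, min_eq_left (by linarith), max_eq_right (by linarith)] at hs
    have e : logScoreDer₂ ν y / y + 2 * besselLogDer ν y / y * logScoreDer ν y
        = -(1 + 2 * logScore ν y) := by
      rw [logScoreDer₂]; field_simp; ring
    have hq : (0 : ℝ) ≤ ν ^ 2 / y := by positivity
    have hwy : 1 ≤ 2 * besselLogDer ν y / y := by
      rw [le_div_iff₀ hy0]; linarith
    have hs1 := neg_one_le_logScore ν hy0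
    have hs2 := logScore_le_div ν hy0
    have hs3 : (ν : ℝ) ^ 2 / (2 * y) = ν ^ 2 / y / 2 := by field_simp
    rw [e, abs_neg]
    have h1 : |1 + 2 * logScore ν y| ≤ 1 + ν ^ 2 / y := by
      rw [abs_le]; constructor <;> linarith
    have h2 : 2 * (ν : ℝ) ^ 2 / y ^ 2 ≤ ν ^ 2 / y := by
      rw [div_le_div_iff₀ (by positivity) hy0]
      nlinarith [mul_nonneg (mul_nonneg (sq_nonneg (ν : ℝ)) hy0.le) (sub_nonneg.2 hy)]
    nlinarith
  · have := abs_logScoreDer_le_self ν two_pos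
    have : (0 : ℝ) ≤ 2 * (ν ^ 2 / 2) := by positivity
    linarith

lemma abs_logScoreDer_le (ν : ℕ) {x : ℝ} (hx : 0 < x) :
    |logScoreDer ν x| ≤ 3 * scoreBound ν x := by
  have h1 := abs_logScoreDer_le_self ν hx
  rw [scoreBound]
  rcases le_total 2 x with h | h
  · have h2 := abs_logScoreDer_le_of_two_le ν h
    rw [min_eq_left (by linarith), max_eq_right (by linarith)]
    have hq : (0 : ℝ) ≤ ν ^ 2 / x := by positivity
    linarith
  · have hq : (0 : ℝ) ≤ ν ^ 2 / max 1 x := by positivity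
    rcases le_total 1 x with h' | h'
    · rw [min_eq_left h']; linarith
    · rw [min_eq_right h']; linarith

/-- The control variable for the second derivative of the score. -/
def scoreBound₂ (ν : ℕ) (x : ℝ) : ℝ :=
  min 1 x + ν ^ 2 / max 1 x + (ν ^ 2 / max 1 x) ^ 2

/-- Same barrier one order higher. With `q = ν²/x` the forcing is at most `20 (1+q)²`. For `x ≥ 4`
the damping is at least `3/2`, producing `60 (1+q)²` from the barrier, of which its own decay
consumes at most `20 (1+q)²`. -/
lemma abs_logScoreDer₂_le_of_four_le (ν : ℕ) {x : ℝ} (hx : 4 ≤ x) :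
    |logScoreDer₂ ν x| ≤ 40 * (1 + ν ^ 2 / x) ^ 2 := by
  have hfour : (0 : ℝ) < 4 := by norm_num
  refine abs_le_of_besselBarrier ν hfour (f := logScoreDer₂ ν)
    (f' := fun x => (-2 * besselLogDer ν x * logScoreDer₂ ν x
      - 2 * logScoreDer ν x ^ 2 - 4 * x * logScoreDer ν x - x * (1 + 2 * logScore ν x)) / x)
    (B := fun x => 40 * (1 + ν ^ 2 / x) ^ 2)
    (B' := fun x => -(80 * (1 + ν ^ 2 / x) * (ν ^ 2 / x) / x))
    (fun y hy => hasDerivAt_logScoreDer₂ ν (hfour.trans_le hy)) (fun y hy => ?_)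
    (fun y hy => ?_) ?_ hx
  · have hy0 : y ≠ 0 := (hfour.trans_le hy).ne'
    refine (((((hasDerivAt_inv hy0).const_mul ((ν : ℝ) ^ 2)).const_add 1).pow 2).const_mul
      40).congr_deriv ?_
    push_cast
    field_simp
    ring
  · have hy0 : 0 < y := hfour.trans_le hy
    have hw := sub_one_le_besselLogDer ν hy0
    have hs := abs_logScore_le ν hy0
    have hD := abs_logScoreDer_le_of_two_le ν (x := y) (by linarith)
    rw [scoreBound, min_eq_left (by linarith), max_eq_right (by linarith)] at hs
    have hq : (0 : ℝ) ≤ ν ^ 2 / y := by positivity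
    set q : ℝ := ν ^ 2 / y
    have e : (-2 * besselLogDer ν y * logScoreDer₂ ν y
      - 2 * logScoreDer ν y ^ 2 - 4 * y * logScoreDer ν y - y * (1 + 2 * logScore ν y)) / y
        + 2 * besselLogDer ν y / y * logScoreDer₂ ν y
        = -((2 * logScoreDer ν y ^ 2) / y + 4 * logScoreDer ν y + (1 + 2 * logScore ν y)) := by
      field_simp; ring
    rw [e, abs_neg]
    have hD' : |logScoreDer ν y| ≤ 3 * (1 + q) := by linarith
    have hD2 : (2 * logScoreDer ν y ^ 2) / y ≤ 9 / 2 * (1 + q) ^ 2 := by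
      rw [div_le_iff₀ hy0]
      have : logScoreDer ν y ^ 2 ≤ (3 * (1 + q)) ^ 2 := sq_le_sq' (by linarith [(abs_le.1 hD').1])
        (abs_le.1 hD').2
      nlinarith [sq_nonneg (1 + q)]
    have hD20 : 0 ≤ (2 * logScoreDer ν y ^ 2) / y := by positivity
    have hQ : 1 + q ≤ (1 + q) ^ 2 := by nlinarith
    have hlhs : |(2 * logScoreDer ν y ^ 2) / y + 4 * logScoreDer ν y + (1 + 2 * logScore ν y)|
        ≤ 20 * (1 + q) ^ 2 := by
      have := abs_le.1 hD'
      have := abs_le.1 hs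
      rw [abs_le]
      constructor <;> nlinarith
    have hwy : 2 - 2 / y ≤ 2 * besselLogDer ν y / y := by
      rw [le_div_iff₀ hy0, sub_mul, div_mul_cancel₀ _ hy0.ne']; linarith
    have hy4 : 1 / y ≤ 1 / 4 := one_div_le_one_div_of_le hfour hy
    have hy4' : 2 / y = 2 * (1 / y) := by ring
    have h3 : 80 * (1 + q) * q / y ≤ 20 * (1 + q) ^ 2 := by
      have : 80 * (1 + q) * q / y = 80 * (1 + q) * q * (1 / y) := by ring
      rw [this]
      have : 80 * (1 + q) * q * (1 / y) ≤ 80 * (1 + q) * q * (1 / 4) := by gcongr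
      nlinarith
    have h4 : (3 / 2) * (40 * (1 + q) ^ 2) ≤ 2 * besselLogDer ν y / y * (40 * (1 + q) ^ 2) :=
      mul_le_mul_of_nonneg_right (by linarith) (by positivity)
    linarith [sq_nonneg (1 + q)]
  · have hq : (0 : ℝ) ≤ (ν : ℝ) ^ 2 / 4 := by positivity
    have hs := abs_logScore_le ν hfour
    have hD := abs_logScoreDer_le_of_two_le ν (x := 4) (by norm_num)
    rw [scoreBound, min_eq_left (by norm_num), max_eq_right (by norm_num)] at hs
    have hw0 := besselLogDer_nonneg ν hfour
    have hw : besselLogDer ν 4 ≤ 4 * (1 + (ν : ℝ) ^ 2 / 4) := by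
      have := logScore_le_div ν hfour
      rw [logScore] at this
      have : (ν : ℝ) ^ 2 / (2 * 4) = ν ^ 2 / 4 / 2 := by ring
      linarith
    set q : ℝ := ν ^ 2 / 4
    have hD' : |logScoreDer ν 4| ≤ 3 * (1 + q) := by linarith
    have h1 : |besselLogDer ν 4 * logScoreDer ν 4| ≤ 12 * (1 + q) ^ 2 := by
      rw [abs_mul, abs_of_nonneg hw0]
      calc _ ≤ (4 * (1 + q)) * (3 * (1 + q)) := by gcongr
        _ = _ := by ring
    have hQ : 1 + q ≤ (1 + q) ^ 2 := by nlinarith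
    have h1 := abs_le.1 h1
    have h2 := abs_le.1 hs
    rw [logScoreDer₂, abs_le]
    constructor <;> nlinarith

/-- Beyond `4` the barrier bound applies. Below `4` one has `x ≤ 4 min 1 x`, and the defining
formula is estimated by products of the first-order bounds. -/
lemma abs_logScoreDer₂_le (ν : ℕ) {x : ℝ} (hx : 0 < x) :
    |logScoreDer₂ ν x| ≤ 80 * scoreBound₂ ν x := by
  have hs := abs_logScore_le ν hx
  have hD := abs_logScoreDer_le ν hx
  rw [scoreBound] at hs hD
  rw [scoreBound₂]
  have hm0 : 0 < min 1 x := lt_min one_pos hx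
  have hm1 : min 1 x ≤ 1 := min_le_left _ _
  rcases le_total 4 x with h | h
  · have := abs_logScoreDer₂_le_of_four_le ν h
    rw [min_eq_left (by linarith), max_eq_right (by linarith)]
    have hq : (0 : ℝ) ≤ ν ^ 2 / x := by positivity
    nlinarith [sq_nonneg (1 - (ν : ℝ) ^ 2 / x)]
  · have hx4 : x ≤ 4 * min 1 x := by
      rcases le_total 1 x with h' | h'
      · rw [min_eq_left h']; linarith
      · rw [min_eq_right h']; linarith
    have hq : (0 : ℝ) ≤ ν ^ 2 / max 1 x := by positivity
    set q : ℝ := ν ^ 2 / max 1 x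
    set m := min 1 x
    have hw : |besselLogDer ν x| ≤ 5 * (m + q) := by
      have h1 := abs_le.1 hs
      rw [logScore] at h1
      rw [abs_le]; constructor <;> linarith
    have h1 : |besselLogDer ν x * logScoreDer ν x| ≤ 15 * (m + q) ^ 2 := by
      rw [abs_mul]
      calc _ ≤ (5 * (m + q)) * (3 * (m + q)) := by gcongr
        _ = _ := by ring
    have h2 : |x * (1 + 2 * logScore ν x)| ≤ 4 * m + 8 * (m + q) := by
      rw [abs_mul, abs_of_pos hx]
      have h3 : |1 + 2 * logScore ν x| ≤ 1 + 2 * |logScore ν x| := by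
        refine (abs_add_le _ _).trans ?_
        simp [abs_mul]
      calc x * |1 + 2 * logScore ν x| ≤ x * (1 + 2 * (m + q)) := by gcongr; linarith
        _ = x + x * (2 * (m + q)) := by ring
        _ ≤ 4 * m + 4 * (2 * (m + q)) := by gcongr
        _ = _ := by ring
    have h1 := abs_le.1 h1
    have h2 := abs_le.1 h2
    have h3 : (m + q) ^ 2 ≤ 2 * m + 2 * q ^ 2 := by nlinarith [sq_nonneg (m - q)]
    rw [logScoreDer₂, abs_le]
    constructor <;> nlinarith

/-! ### Third-order expansion of the log-likelihood -/

/-- Three applications of the mean value inequality, each after subtracting the Taylor polynomial;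
the constant `1` replaces the sharp `1/6`. -/
lemma abs_sub_taylor_two_le {f f₁ f₂ f₃ : ℝ → ℝ} {δ B : ℝ}
    (h₁ : ∀ t ∈ Set.uIcc 0 δ, HasDerivAt f (f₁ t) t)
    (h₂ : ∀ t ∈ Set.uIcc 0 δ, HasDerivAt f₁ (f₂ t) t)
    (h₃ : ∀ t ∈ Set.uIcc 0 δ, HasDerivAt f₂ (f₃ t) t)
    (hB : ∀ t ∈ Set.uIcc 0 δ, |f₃ t| ≤ B) :
    |f δ - f 0 - f₁ 0 * δ - f₂ 0 * δ ^ 2 / 2| ≤ B * |δ| ^ 3 := by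
  have hB0 : 0 ≤ B := (abs_nonneg _).trans (hB 0 Set.left_mem_uIcc)
  have habs : ∀ t ∈ Set.uIcc 0 δ, |t| ≤ |δ| := fun t ht => by
    simpa using Set.abs_sub_left_of_mem_uIcc ht
  have hconv := convex_uIcc (𝕜 := ℝ) (0 : ℝ) δ
  have h0 : (0 : ℝ) ∈ Set.uIcc 0 δ := Set.left_mem_uIcc
  have b2 : ∀ t ∈ Set.uIcc 0 δ, |f₂ t - f₂ 0| ≤ B * |δ| := by
    intro t ht
    have := hconv.norm_image_sub_le_of_norm_hasDerivWithin_le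
      (fun x hx => (h₃ x hx).hasDerivWithinAt) hB h0 ht
    simp only [Real.norm_eq_abs, sub_zero] at this
    exact this.trans (mul_le_mul_of_nonneg_left (habs t ht) hB0)
  have b1 : ∀ t ∈ Set.uIcc 0 δ, |f₁ t - f₁ 0 - f₂ 0 * t| ≤ B * |δ| ^ 2 := by
    intro t ht
    have := hconv.norm_image_sub_le_of_norm_hasDerivWithin_le
      (f := fun t => f₁ t - f₁ 0 - f₂ 0 * t) (f' := fun t => f₂ t - f₂ 0)
      (fun x hx => (((h₂ x hx).sub_const (f₁ 0)).sub
          ((hasDerivAt_id x).const_mul (f₂ 0))).hasDerivWithinAt.congr_deriv (by simp)) b2 h0 ht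
    simp only [Real.norm_eq_abs, sub_zero, sub_self, mul_zero] at this
    refine this.trans ((mul_le_mul_of_nonneg_left (habs t ht) (by positivity)).trans_eq (by ring))
  have := hconv.norm_image_sub_le_of_norm_hasDerivWithin_le
      (f := fun t => f t - f 0 - f₁ 0 * t - f₂ 0 * t ^ 2 / 2)
      (f' := fun t => f₁ t - f₁ 0 - f₂ 0 * t)
      (fun x hx => by
        refine ((((h₁ x hx).sub_const (f 0)).sub ((hasDerivAt_id x).const_mul (f₁ 0))).sub
          (((hasDerivAt_pow 2 x).const_mul (f₂ 0)).div_const 2)).hasDerivWithinAt.congr_deriv ?_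
        simp; ring) b1 h0 (Set.right_mem_uIcc (a := 0) (b := δ))
  simp only [Real.norm_eq_abs, sub_zero, sub_self, mul_zero] at this
  simp only [ne_eq, OfNat.ofNat_ne_zero, not_false_eq_true, zero_pow, mul_zero, zero_div,
    sub_zero] at this
  refine this.trans_eq (by ring)

/-- For `|t| ≤ 1` the factor `e^t` lies in `[1/3, 3]`, and the square in the control variable turns
`3` into `9`. -/
lemma scoreBound₂_mul_exp_le (ν : ℕ) {x t : ℝ} (hx : 0 < x) (ht : |t| ≤ 1) :
    scoreBound₂ ν (x * Real.exp t) ≤ 9 * scoreBound₂ ν x := by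
  have he : Real.exp 1 ≤ 3 := by have := Real.exp_one_lt_d9; linarith
  have ht := abs_le.1 ht
  have h1 : Real.exp t ≤ 3 := (Real.exp_le_exp.2 ht.2).trans he
  have h2 : 1 / 3 ≤ Real.exp t := by
    have h3 : Real.exp (-1) ≤ Real.exp t := Real.exp_le_exp.2 ht.1
    rw [Real.exp_neg] at h3
    refine le_trans ?_ h3
    rw [one_div]
    exact inv_anti₀ (Real.exp_pos 1) he
  have hm : min 1 (x * Real.exp t) ≤ 3 * min 1 x := by
    rw [min_def, min_def]
    split_ifs <;> nlinarith
  have hM : max 1 x / 3 ≤ max 1 (x * Real.exp t) := by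
    rcases le_total 1 x with h | h
    · rw [max_eq_right h]
      refine le_trans ?_ (le_max_right _ _)
      nlinarith
    · rw [max_eq_left h]
      exact le_trans (by norm_num) (le_max_left _ _)
  have hM0 : 0 < max 1 x := lt_max_of_lt_left one_pos
  have hm0 : 0 < min 1 x := lt_min one_pos hx
  have hq : (ν : ℝ) ^ 2 / max 1 (x * Real.exp t) ≤ 3 * (ν ^ 2 / max 1 x) := by
    calc (ν : ℝ) ^ 2 / max 1 (x * Real.exp t) ≤ ν ^ 2 / (max 1 x / 3) := by gcongr
      _ = _ := by field_simp
  have hq0 : (0 : ℝ) ≤ ν ^ 2 / max 1 x := by positivity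
  have hq1 : (0 : ℝ) ≤ ν ^ 2 / max 1 (x * Real.exp t) := by positivity
  have hq2 : ((ν : ℝ) ^ 2 / max 1 (x * Real.exp t)) ^ 2 ≤ (3 * (ν ^ 2 / max 1 x)) ^ 2 := by gcongr
  rw [scoreBound₂, scoreBound₂]
  nlinarith

/-- The logarithm of `e^{-x} I_ν(x)`. -/
def logWeight (ν : ℕ) (x : ℝ) : ℝ := Real.log (besselI ν x) - x

lemma hasDerivAt_logWeight (ν : ℕ) {x : ℝ} (hx : 0 < x) :
    HasDerivAt (logWeight ν) (logScore ν x / x) x := by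
  refine ((hasDerivAt_log_besselI ν hx).sub (hasDerivAt_id x)).congr_deriv ?_
  rw [logScore]
  field_simp

/-- Along `t ↦ x e^t` the operator `x d/dx` becomes `d/dt`, so the successive derivatives are the
score and its two derivatives. The constant is `80 · 9`. -/
lemma abs_logWeight_sub_taylor_le (ν : ℕ) {x δ : ℝ} (hx : 0 < x) (hδ : |δ| ≤ 1) :
    |logWeight ν (x * Real.exp δ) - logWeight ν x - logScore ν x * δ
      - logScoreDer ν x * δ ^ 2 / 2| ≤ 720 * scoreBound₂ ν x * |δ| ^ 3 := by
  have hexp : ∀ (f f' : ℝ → ℝ), (∀ {x : ℝ}, 0 < x → HasDerivAt f (f' x / x) x) →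
      ∀ t, HasDerivAt (fun t => f (x * Real.exp t)) (f' (x * Real.exp t)) t := by
    intro f f' h t
    have hp : 0 < x * Real.exp t := by positivity
    refine (HasDerivAt.comp (h := fun t => x * Real.exp t) t (h hp)
      ((Real.hasDerivAt_exp t).const_mul x)).congr_deriv ?_
    field_simp
  have := abs_sub_taylor_two_le (δ := δ) (B := 720 * scoreBound₂ ν x)
    (fun t _ => hexp _ _ (fun h => hasDerivAt_logWeight ν h) t)
    (fun t _ => hexp _ _ (fun h => hasDerivAt_logScore ν h) t)
    (fun t _ => hexp _ _ (fun h => hasDerivAt_logScoreDer ν h) t)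
    (fun t ht => by
      have h1 : |t| ≤ 1 := le_trans (by simpa using Set.abs_sub_left_of_mem_uIcc ht) hδ
      have h2 := abs_logScoreDer₂_le ν (x := x * Real.exp t) (by positivity)
      have h3 := scoreBound₂_mul_exp_le ν hx h1
      linarith)
  simpa using this

/-! ### The compound Poisson law -/

/-- The law of the sum of `m` independent symmetric signs. -/
def signSumLaw (m : ℕ) : Measure ℤ :=
  (Measure.pi fun _ : Fin m => signLaw).map fun e => ∑ i, e i

instance : IsProbabilityMeasure signLaw := by
  constructor
  simp [signLaw, ENNReal.inv_two_add_inv_two]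

instance (m : ℕ) : IsProbabilityMeasure (signSumLaw m) :=
  Measure.isProbabilityMeasure_map (Measurable.aemeasurable (by fun_prop))

lemma lintegral_signLaw (f : ℤ → ℝ≥0∞) : ∫⁻ k, f k ∂signLaw = 2⁻¹ * f (-1) + 2⁻¹ * f 1 := by
  simp [signLaw, lintegral_add_measure, lintegral_smul_measure]

/-- Induction on the number of signs: the first coordinate is split off the product measure, and
Pascal's rule recombines the two shifted sums. -/
lemma lintegral_signSumLaw (m : ℕ) (f : ℤ → ℝ≥0∞) : ∫⁻ k, f k ∂(signSumLaw m) =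
    2⁻¹ ^ m * ∑ ij ∈ Finset.HasAntidiagonal.antidiagonal m, m.choose ij.1 • f ((ij.1 : ℤ) - ij.2) := by
  induction m generalizing f with
  | zero =>
    rw [signSumLaw, lintegral_map .of_discrete (by fun_prop)]
    simp
  | succ m ih =>
    have hstep : ∫⁻ k, f k ∂(signSumLaw (m + 1)) =
        ∫⁻ y, ∫⁻ k, f (y + k) ∂(signSumLaw m) ∂signLaw := by
      rw [signSumLaw, lintegral_map .of_discrete (by fun_prop)]
      have h := measurePreserving_piFinSuccAbove (fun _ : Fin (m + 1) => signLaw) 0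
      rw [← h.symm.lintegral_comp (by exact .of_discrete),
        lintegral_prod _ (by exact Measurable.aemeasurable .of_discrete)]
      refine lintegral_congr fun y => ?_
      rw [signSumLaw, lintegral_map .of_discrete (by fun_prop)]
      refine lintegral_congr fun e => ?_
      simp [MeasurableEquiv.piFinSuccAbove, Fin.sum_univ_succ]
    rw [hstep, lintegral_signLaw, ih, ih, Finset.sum_antidiagonal_choose_succ_nsmul
      (fun i j => f ((i : ℤ) - j)), pow_succ]
    have e1 : ∀ ij ∈ Finset.HasAntidiagonal.antidiagonal m,
        m.choose ij.2 • f (((ij.1 + 1 : ℕ) : ℤ) - (ij.2 : ℕ)) =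
          m.choose ij.1 • f (1 + ((ij.1 : ℤ) - ij.2)) := by
      intro ij hij
      rw [Nat.choose_symm_of_eq_add (Finset.HasAntidiagonal.mem_antidiagonal.1 hij).symm]
      congr 2
      push_cast; ring
    have e2 : ∀ ij ∈ Finset.HasAntidiagonal.antidiagonal m,
        m.choose ij.1 • f ((ij.1 : ℤ) - ((ij.2 + 1 : ℕ) : ℤ)) =
          m.choose ij.1 • f (-1 + ((ij.1 : ℤ) - ij.2)) := by
      intro ij hij
      congr 2
      push_cast; ring
    rw [Finset.sum_congr rfl e1, Finset.sum_congr rfl e2]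
    ring

lemma compoundLaw_eq (x : ℝ) :
    compoundLaw x = (poissonMeasure x.toNNReal).bind signSumLaw := rfl

instance (x : ℝ) : IsProbabilityMeasure (compoundLaw x) := by
  constructor
  rw [compoundLaw_eq, Measure.bind_apply .univ (Measurable.aemeasurable .of_discrete)]
  simp

/-- Poisson thinning: the numbers of positive and of negative jumps are independent Poisson
variables of mean `x / 2`. The sum over `m` and over the antidiagonal of `m` is the sum over all
pairs. -/
lemma lintegral_compoundLaw {x : ℝ} (hx : 0 ≤ x) (f : ℤ → ℝ≥0∞) :
    ∫⁻ k, f k ∂(compoundLaw x) = ∑' ab : ℕ × ℕ, ENNReal.ofReal (Real.exp (-x) *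
      ((x / 2) ^ ab.1 / ab.1.factorial) * ((x / 2) ^ ab.2 / ab.2.factorial)) *
        f ((ab.1 : ℤ) - ab.2) := by
  rw [compoundLaw_eq, Measure.lintegral_bind (Measurable.aemeasurable .of_discrete)
    (Measurable.aemeasurable .of_discrete), lintegral_countable',
    ← Finset.HasAntidiagonal.sigmaAntidiagonalEquivProd.tsum_eq, ENNReal.tsum_sigma']
  refine tsum_congr fun m => ?_
  rw [poissonMeasure_singleton, lintegral_signSumLaw, Real.coe_toNNReal _ hx, tsum_fintype,
    Finset.mul_sum, Finset.sum_mul]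
  refine Eq.trans ?_ (Finset.sum_coe_sort (Finset.HasAntidiagonal.antidiagonal m)
    (fun ab : ℕ × ℕ => ENNReal.ofReal (Real.exp (-x) *
      ((x / 2) ^ ab.1 / ab.1.factorial) * ((x / 2) ^ ab.2 / ab.2.factorial)) *
        f ((ab.1 : ℤ) - ab.2))).symm
  refine Finset.sum_congr rfl fun ij hij => ?_
  have hij : ij.1 + ij.2 = m := Finset.HasAntidiagonal.mem_antidiagonal.1 hij
  have h2 : (2⁻¹ : ℝ≥0∞) ^ m = ENNReal.ofReal (2⁻¹ ^ m) := by
    rw [ENNReal.ofReal_pow (by norm_num), ENNReal.ofReal_inv_of_pos two_pos]; simp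
  have key : Real.exp (-x) * ((x / 2) ^ ij.1 / ij.1.factorial) * ((x / 2) ^ ij.2 / ij.2.factorial)
      = 2⁻¹ ^ m * (m.choose ij.1 : ℝ) * (Real.exp (-x) * x ^ m / m.factorial) := by
    subst hij
    rw [Nat.choose_symm_add, Nat.add_choose, Nat.cast_div (Nat.factorial_mul_factorial_dvd_factorial_add _ _)
      (by positivity)]
    have h1 : ((ij.1 + ij.2).factorial : ℝ) ≠ 0 := by positivity
    have h2 : (ij.1.factorial : ℝ) ≠ 0 := by positivity
    have h3 : (ij.2.factorial : ℝ) ≠ 0 := by positivity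
    push_cast
    rw [div_pow, div_pow, inv_pow, pow_add, pow_add]
    field_simp
  rw [key, h2, nsmul_eq_mul, ENNReal.ofReal_mul (by positivity), ENNReal.ofReal_mul (by positivity),
    ENNReal.ofReal_natCast]
  ring

/-- The probability `e^{-x} I_|k|(x)` of `{k}` under the compound Poisson law. -/
def skellam (x : ℝ) (k : ℤ) : ℝ := Real.exp (-x) * besselI k.natAbs x

lemma skellam_pos {x : ℝ} (hx : 0 < x) (k : ℤ) : 0 < skellam x k :=
  mul_pos (Real.exp_pos _) (besselI_pos _ hx)

/-- For `k ≥ 0` the pairs with difference `k` are `(k + m, m)`; negative `k` is reduced to this by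
exchanging the coordinates. -/
lemma tsum_indicator_sub_eq (k : ℤ) (g : ℕ → ℕ → ℝ≥0∞) (hg : ∀ a b, g a b = g b a) :
    ∑' ab : ℕ × ℕ, g ab.1 ab.2 * ({k} : Set ℤ).indicator 1 ((ab.1 : ℤ) - ab.2) =
      ∑' m : ℕ, g (k.natAbs + m) m := by
  wlog hk : 0 ≤ k generalizing k
  · have := this (-k) (by omega)
    rw [Int.natAbs_neg] at this
    rw [← this, ← (Equiv.prodComm ℕ ℕ).tsum_eq]
    refine tsum_congr fun ab => ?_
    simp only [Equiv.prodComm_apply, Prod.fst_swap, Prod.snd_swap]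
    rw [hg]
    congr 1
    by_cases h : ((ab.2 : ℤ) - ab.1) = k
    · have h' : ((ab.1 : ℤ) - ab.2) = -k := by omega
      simp [h, h']
    · have h' : ((ab.1 : ℤ) - ab.2) ≠ -k := by omega
      simp [h, h']
  · let e : ℕ → ℕ × ℕ := fun m => (k.natAbs + m, m)
    have he : Function.Injective e := fun a b hab => congrArg Prod.snd hab
    rw [← he.tsum_eq (f := fun ab : ℕ × ℕ =>
      g ab.1 ab.2 * ({k} : Set ℤ).indicator 1 ((ab.1 : ℤ) - ab.2))]
    · refine tsum_congr fun m => ?_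
      have : ((e m).1 : ℤ) - (e m).2 = k := by simp only [e]; push_cast [Int.natAbs_of_nonneg hk]; omega
      rw [this]
      simp [e]
    · intro ab hab
      have : ((ab.1 : ℤ) - ab.2) = k := by
        by_contra h
        simp [h] at hab
      exact ⟨ab.2, Prod.ext (by simp only [e]; omega) rfl⟩

lemma compoundLaw_singleton {x : ℝ} (hx : 0 ≤ x) (k : ℤ) :
    compoundLaw x {k} = ENNReal.ofReal (skellam x k) := by
  rw [← lintegral_indicator_one (measurableSet_singleton k), lintegral_compoundLaw hx,
    tsum_indicator_sub_eq k (fun a b => ENNReal.ofReal (Real.exp (-x) *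
      ((x / 2) ^ a / a.factorial) * ((x / 2) ^ b / b.factorial))) (fun a b => by congr 1; ring),
    skellam, besselI, ← tsum_mul_left, ENNReal.ofReal_tsum_of_nonneg (fun m => by positivity)
    ((summable_besselI _ _).mul_left _)]
  refine tsum_congr fun m => ?_
  congr 1
  rw [pow_add, pow_add, two_mul, pow_add]
  have h2 : (m.factorial : ℝ) ≠ 0 := by positivity
  have h3 : ((k.natAbs + m).factorial : ℝ) ≠ 0 := by positivity
  field_simp

lemma compoundLaw_real_singleton {x : ℝ} (hx : 0 < x) (k : ℤ) :
    (compoundLaw x).real {k} = skellam x k := by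
  rw [measureReal_def, compoundLaw_singleton hx.le, ENNReal.toReal_ofReal (skellam_pos hx k).le]

lemma integral_compoundLaw {x : ℝ} (hx : 0 < x) {f : ℤ → ℝ} (hf : Integrable f (compoundLaw x)) :
    ∫ k, f k ∂(compoundLaw x) = ∑' k, skellam x k * f k := by
  rw [integral_countable hf]
  simp [compoundLaw_real_singleton hx]

lemma integrable_compoundLaw_iff {x : ℝ} (hx : 0 < x) {f : ℤ → ℝ} :
    Integrable f (compoundLaw x) ↔ Summable fun k => skellam x k * f k := by
  rw [← Measure.sum_smul_dirac (compoundLaw x), integrable_sum_dirac_iff (by simp),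
    ← summable_norm_iff (f := fun k => skellam x k * f k)]
  refine summable_congr fun k => ?_
  rw [← measureReal_def, compoundLaw_real_singleton hx, norm_mul,
    Real.norm_of_nonneg (skellam_pos hx k).le]

/-! ### Exponential moments and Stein identities -/

/-- After thinning, the double sum is the product of two exponential series, at `x e^t / 2` and `x
e^{-t} / 2`. -/
lemma lintegral_exp_compoundLaw {x : ℝ} (hx : 0 ≤ x) (t : ℝ) :
    ∫⁻ k : ℤ, ENNReal.ofReal (Real.exp (t * k)) ∂(compoundLaw x) =
      ENNReal.ofReal (Real.exp (x * (Real.cosh t - 1))) := by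
  have hs : ∀ y : ℝ, 0 ≤ y → ∑' a : ℕ, ENNReal.ofReal (y ^ a / a.factorial) =
      ENNReal.ofReal (Real.exp y) := by
    intro y hy
    rw [Real.exp_eq_exp_ℝ, NormedSpace.exp_eq_tsum_div,
      ENNReal.ofReal_tsum_of_nonneg (fun a => by positivity) (Real.summable_pow_div_factorial y)]
  have e : ∀ ab : ℕ × ℕ, ENNReal.ofReal (Real.exp (-x) *
      ((x / 2) ^ ab.1 / ab.1.factorial) * ((x / 2) ^ ab.2 / ab.2.factorial)) *
        ENNReal.ofReal (Real.exp (t * ((ab.1 : ℤ) - ab.2 : ℤ))) =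
      ENNReal.ofReal (Real.exp (-x)) *
        (ENNReal.ofReal ((x / 2 * Real.exp t) ^ ab.1 / ab.1.factorial) *
          ENNReal.ofReal ((x / 2 * Real.exp (-t)) ^ ab.2 / ab.2.factorial)) := by
    intro ab
    rw [← ENNReal.ofReal_mul (by positivity), ← ENNReal.ofReal_mul (by positivity),
      ← ENNReal.ofReal_mul (by positivity)]
    congr 1
    have : Real.exp (t * ((ab.1 : ℤ) - ab.2 : ℤ)) = Real.exp t ^ ab.1 * Real.exp (-t) ^ ab.2 := by
      rw [← Real.exp_nat_mul, ← Real.exp_nat_mul, ← Real.exp_add]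
      congr 1
      push_cast; ring
    rw [this, mul_pow, mul_pow]
    ring
  rw [lintegral_compoundLaw hx, tsum_congr e, ENNReal.tsum_mul_left,
    ENNReal.tsum_prod (f := fun a b : ℕ => ENNReal.ofReal ((x / 2 * Real.exp t) ^ a / a.factorial) *
          ENNReal.ofReal ((x / 2 * Real.exp (-t)) ^ b / b.factorial))]
  simp_rw [ENNReal.tsum_mul_left, ENNReal.tsum_mul_right]
  rw [hs _ (by positivity), hs _ (by positivity), ← ENNReal.ofReal_mul (by positivity),
    ← ENNReal.ofReal_mul (by positivity), ← Real.exp_add, ← Real.exp_add, Real.cosh_eq]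
  congr 2
  ring

lemma integrable_exp_compoundLaw {x : ℝ} (hx : 0 ≤ x) (t : ℝ) :
    Integrable (fun k : ℤ => Real.exp (t * k)) (compoundLaw x) := by
  refine ⟨.of_discrete, ?_⟩
  rw [hasFiniteIntegral_iff_ofReal (ae_of_all _ fun k => (Real.exp_pos _).le),
    lintegral_exp_compoundLaw hx]
  exact ENNReal.ofReal_lt_top

lemma integral_exp_compoundLaw {x : ℝ} (hx : 0 ≤ x) (t : ℝ) :
    ∫ k : ℤ, Real.exp (t * k) ∂(compoundLaw x) = Real.exp (x * (Real.cosh t - 1)) := by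
  rw [integral_eq_lintegral_of_nonneg_ae (ae_of_all _ fun k => (Real.exp_pos _).le) .of_discrete,
    lintegral_exp_compoundLaw hx, ENNReal.toReal_ofReal (Real.exp_pos _).le]

lemma integrable_cosh_compoundLaw {x : ℝ} (hx : 0 ≤ x) (t : ℝ) :
    Integrable (fun k : ℤ => Real.cosh (t * k)) (compoundLaw x) := by
  simp_rw [Real.cosh_eq]
  refine ((integrable_exp_compoundLaw hx t).add ?_).div_const 2
  simpa using integrable_exp_compoundLaw hx (-t)

lemma integral_cosh_compoundLaw {x : ℝ} (hx : 0 ≤ x) (t : ℝ) :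
    ∫ k : ℤ, Real.cosh (t * k) ∂(compoundLaw x) = Real.exp (x * (Real.cosh t - 1)) := by
  simp_rw [Real.cosh_eq]
  have h2 : Integrable (fun k : ℤ => Real.exp (-(t * k))) (compoundLaw x) := by
    simpa using integrable_exp_compoundLaw hx (-t)
  have h3 : ∫ k : ℤ, Real.exp (-(t * k)) ∂(compoundLaw x) = Real.exp (x * (Real.cosh t - 1)) := by
    simpa using integral_exp_compoundLaw hx (-t)
  rw [integral_div, integral_add (integrable_exp_compoundLaw hx t) h2,
    integral_exp_compoundLaw hx, h3, Real.cosh_eq]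
  ring

lemma pow_div_factorial_le_cosh_sub_one {j : ℕ} (hj : j ≠ 0) (z : ℝ) :
    z ^ (2 * j) / (2 * j).factorial ≤ Real.cosh z - 1 := by
  have h := Real.hasSum_cosh z
  have h2 := sum_le_hasSum {0, j} (fun n _ => by rw [pow_mul]; positivity) h
  rw [Finset.sum_pair hj.symm] at h2
  simp only [mul_zero, pow_zero, Nat.factorial_zero, Nat.cast_one, div_one] at h2
  linarith

/-- A function of at most polynomial growth is integrable. -/
lemma integrable_compoundLaw_of_le {x : ℝ} (hx : 0 ≤ x) {f : ℤ → ℝ} (C : ℝ) (j : ℕ)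
    (hf : ∀ k, |f k| ≤ C * (1 + (k : ℝ) ^ 2) ^ j) : Integrable f (compoundLaw x) := by
  have hC : 0 ≤ C := by
    have := (abs_nonneg _).trans (hf 0)
    simpa using this
  refine ((integrable_cosh_compoundLaw hx 1).const_mul (C * (2 ^ j * (1 + (2 * j).factorial)))).mono'
    .of_discrete (ae_of_all _ fun k => (hf k).trans ?_)
  rw [mul_assoc]
  refine mul_le_mul_of_nonneg_left ?_ hC
  have hc := Real.one_le_cosh (1 * (k : ℝ))
  have h1 : (1 + (k : ℝ) ^ 2) ^ j ≤ 2 ^ j * (1 + (k : ℝ) ^ (2 * j)) := by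
    rcases le_total ((k : ℝ) ^ 2) 1 with h | h
    · have : (0 : ℝ) ≤ (k : ℝ) ^ (2 * j) := by rw [pow_mul]; positivity
      calc (1 + (k : ℝ) ^ 2) ^ j ≤ 2 ^ j := by gcongr; linarith
        _ ≤ _ := le_mul_of_one_le_right (by positivity) (by linarith)
    · calc (1 + (k : ℝ) ^ 2) ^ j ≤ (2 * (k : ℝ) ^ 2) ^ j := by gcongr; linarith
        _ = 2 ^ j * (k : ℝ) ^ (2 * j) := by rw [mul_pow, pow_mul]
        _ ≤ _ := by gcongr; linarith
  refine h1.trans ?_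
  rw [mul_assoc]
  gcongr
  rcases Nat.eq_zero_or_pos j with rfl | hj
  · simp
  · have h2 := pow_div_factorial_le_cosh_sub_one hj.ne' (1 * (k : ℝ))
    rw [div_le_iff₀ (by positivity), one_mul] at h2
    rw [one_mul] at hc ⊢
    have : (0 : ℝ) ≤ (2 * j).factorial := by positivity
    nlinarith

/-- Moments of `X² / max 1 x` are at most of the order of `min 1 x`. -/
lemma integral_sq_div_pow_le {x : ℝ} (hx : 0 < x) {j : ℕ} (hj : j ≠ 0) :
    ∫ k : ℤ, ((k : ℝ) ^ 2 / max 1 x) ^ j ∂(compoundLaw x) ≤ 2 * (2 * j).factorial * min 1 x := by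
  have hM1 : 1 ≤ max 1 x := le_max_left _ _
  have hM : 0 < max 1 x := by linarith
  have hmM : min 1 x * max 1 x = x := by rw [min_mul_max, one_mul]
  set M := max 1 x
  set m := min 1 x
  have hm1 : m ≤ 1 := min_le_left _ _
  have hm0 : 0 < m := lt_min one_pos hx
  -- At this scale `(k²/M)^j` is `(tk)^{2j}`, bounded by `(2j)! (cosh (tk) - 1)`. Its mean is
  -- governed by `e^{x (cosh t - 1)} - 1`, where `x (cosh t - 1) ≤ x / M = m ≤ 1`.
  set t : ℝ := (√M)⁻¹
  have ht2 : t ^ 2 = M⁻¹ := by rw [inv_pow, Real.sq_sqrt hM.le]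
  have hpt : ∀ k : ℤ, ((k : ℝ) ^ 2 / M) ^ j ≤ (2 * j).factorial * (Real.cosh (t * k) - 1) := by
    intro k
    have h := pow_div_factorial_le_cosh_sub_one hj (t * k)
    rw [div_le_iff₀ (by positivity)] at h
    calc ((k : ℝ) ^ 2 / M) ^ j = (t * k) ^ (2 * j) := by
          rw [pow_mul, mul_pow, ht2]; congr 1; field_simp
      _ ≤ _ := by linarith
  have hint := integrable_cosh_compoundLaw hx.le t
  have h1 : ∫ k : ℤ, ((k : ℝ) ^ 2 / M) ^ j ∂(compoundLaw x) ≤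
      ∫ k : ℤ, (2 * j).factorial * (Real.cosh (t * k) - 1) ∂(compoundLaw x) :=
    integral_mono_of_nonneg (ae_of_all _ fun k => by positivity)
      ((hint.sub (integrable_const 1)).const_mul _) (ae_of_all _ hpt)
  refine h1.trans ?_
  rw [integral_const_mul, integral_sub hint (integrable_const 1), integral_cosh_compoundLaw hx.le]
  simp only [integral_const, probReal_univ, smul_eq_mul, mul_one]
  have hcosh : Real.cosh t - 1 ≤ M⁻¹ := by
    have h2 := Real.cosh_le_exp_half_sq t
    rw [ht2] at h2
    have h3 : |M⁻¹ / 2| ≤ 1 := by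
      rw [abs_of_pos (by positivity)]
      have := inv_le_one_of_one_le₀ hM1
      linarith
    have h4 := Real.abs_exp_sub_one_le h3
    rw [abs_of_pos (show 0 < M⁻¹ / 2 by positivity)] at h4
    have := (abs_le.1 h4).2
    linarith
  have hxm : x * (Real.cosh t - 1) ≤ m := by
    calc x * (Real.cosh t - 1) ≤ x * M⁻¹ := by gcongr
      _ = m := by nth_rewrite 1 [← hmM]; field_simp
  have h5 : Real.exp (x * (Real.cosh t - 1)) - 1 ≤ 2 * m := by
    have h6 := Real.abs_exp_sub_one_le (show |m| ≤ 1 by rw [abs_of_pos hm0]; exact hm1)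
    rw [abs_of_pos hm0] at h6
    have := (abs_le.1 h6).2
    have := Real.exp_le_exp.2 hxm
    linarith
  calc _ ≤ ((2 * j).factorial : ℝ) * (2 * m) := by gcongr
    _ = _ := by ring

lemma natAbs_succ_or (k : ℤ) : (0 ≤ k ∧ (k + 1).natAbs = k.natAbs + 1) ∨
    (k < 0 ∧ (k - 1).natAbs = k.natAbs + 1) := by omega

/-- `2 k I_k = x (I_{k-1} - I_{k+1})`. -/
lemma two_mul_skellam (x : ℝ) (k : ℤ) :
    2 * k * skellam x k = x * (skellam x (k - 1) - skellam x (k + 1)) := by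
  rcases lt_trichotomy k 0 with h | rfl | h
  · obtain ⟨n, rfl⟩ : ∃ n : ℕ, k = -(n + 1 : ℕ) := ⟨(-k).toNat - 1, by omega⟩
    have h1 : (-((n + 1 : ℕ) : ℤ)).natAbs = n + 1 := by omega
    have h2 : (-((n + 1 : ℕ) : ℤ) - 1).natAbs = n + 2 := by omega
    have h3 : (-((n + 1 : ℕ) : ℤ) + 1).natAbs = n := by omega
    have := besselI_rec n x
    rw [skellam, skellam, skellam, h1, h2, h3]
    push_cast
    linear_combination Real.exp (-x) * this
  · simp [skellam]
  · obtain ⟨n, rfl⟩ : ∃ n : ℕ, k = (n + 1 : ℕ) := ⟨k.toNat - 1, by omega⟩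
    have h1 : (((n + 1 : ℕ) : ℤ)).natAbs = n + 1 := by omega
    have h2 : (((n + 1 : ℕ) : ℤ) - 1).natAbs = n := by omega
    have h3 : (((n + 1 : ℕ) : ℤ) + 1).natAbs = n + 2 := by omega
    have := besselI_rec n x
    rw [skellam, skellam, skellam, h1, h2, h3]
    push_cast
    linear_combination (-Real.exp (-x)) * this

/-- `x I_k' = x (I_{k-1} + I_{k+1}) / 2`. -/
lemma besselLogDer_mul_skellam {x : ℝ} (hx : 0 < x) (k : ℤ) :
    besselLogDer k.natAbs x * skellam x k =
      x / 2 * (skellam x (k - 1) + skellam x (k + 1)) := by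
  have hI := besselI_pos k.natAbs hx
  have h2 := two_mul_skellam x k
  have e : besselLogDer k.natAbs x * skellam x k = (k.natAbs : ℝ) * skellam x k
      + x * (Real.exp (-x) * besselI (k.natAbs + 1) x) := by
    rw [besselLogDer, skellam]; field_simp
  rcases natAbs_succ_or k with ⟨h, h'⟩ | ⟨h, h'⟩
  · have hk : ((k.natAbs : ℕ) : ℝ) = k := by
      rw [Nat.cast_natAbs, abs_of_nonneg h]
    rw [e, hk, ← h', ← skellam]
    linarith
  · have hk : ((k.natAbs : ℕ) : ℝ) = -k := by
      rw [Nat.cast_natAbs, abs_of_neg h]; push_cast; rfl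
    rw [e, hk, ← h', ← skellam]
    linarith

lemma integrable_comp_add_compoundLaw {x : ℝ} (hx : 0 ≤ x) {f : ℤ → ℝ} (C : ℝ) (j : ℕ)
    (hf : ∀ k, |f k| ≤ C * (1 + (k : ℝ) ^ 2) ^ j) (a : ℤ) :
    Integrable (fun k => f (k + a)) (compoundLaw x) := by
  have hC : 0 ≤ C := by
    have := (abs_nonneg _).trans (hf 0)
    simpa using this
  refine integrable_compoundLaw_of_le hx (C * (2 + 2 * (a : ℝ) ^ 2) ^ j) j fun k =>
    (hf _).trans ?_
  rw [mul_assoc, ← mul_pow]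
  push_cast
  gcongr
  nlinarith [sq_nonneg ((k : ℝ) - a), sq_nonneg ((k : ℝ) * a)]

/-- A Stein identity: the recurrence replaces `w` times the mass at `k` by the masses at `k ± 1`,
and shifting the summation index moves the shift onto `f`. -/
lemma integral_besselLogDer_mul {x : ℝ} (hx : 0 < x) {f : ℤ → ℝ} (C : ℝ) (j : ℕ)
    (hf : ∀ k, |f k| ≤ C * (1 + (k : ℝ) ^ 2) ^ j)
    (hint : Integrable (fun k => besselLogDer k.natAbs x * f k) (compoundLaw x)) :
    ∫ k, besselLogDer k.natAbs x * f k ∂(compoundLaw x) =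
      x / 2 * ∫ k, (f (k + 1) + f (k - 1)) ∂(compoundLaw x) := by
  have h1 := integrable_comp_add_compoundLaw hx.le C j hf 1
  have h2 := integrable_comp_add_compoundLaw hx.le C j hf (-1)
  rw [integral_compoundLaw hx hint, integral_add h1 (by exact h2), integral_compoundLaw hx h1,
    integral_compoundLaw hx (by exact h2)]
  have e : ∀ k : ℤ, skellam x k * (besselLogDer k.natAbs x * f k) =
      x / 2 * (skellam x (k - 1) * f k) + x / 2 * (skellam x (k + 1) * f k) := by
    intro k
    linear_combination f k * besselLogDer_mul_skellam hx k
  have s1 : Summable fun k : ℤ => skellam x (k - 1) * f k := by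
    rw [← (Equiv.addRight (1 : ℤ)).summable_iff]
    simpa [Function.comp_def] using (integrable_compoundLaw_iff hx).1 h1
  have s2 : Summable fun k : ℤ => skellam x (k + 1) * f k := by
    rw [← (Equiv.addRight (-1 : ℤ)).summable_iff]
    simpa [Function.comp_def] using (integrable_compoundLaw_iff hx).1 h2
  rw [tsum_congr e, (s1.mul_left _).tsum_add (s2.mul_left _), tsum_mul_left, tsum_mul_left,
    ← (Equiv.addRight (1 : ℤ)).tsum_eq (fun k => skellam x (k - 1) * f k),
    ← (Equiv.addRight (-1 : ℤ)).tsum_eq (fun k => skellam x (k + 1) * f k), ← mul_add]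
  simp [sub_eq_add_neg]

lemma integral_intCast_mul {x : ℝ} (hx : 0 < x) {f : ℤ → ℝ} (C : ℝ) (j : ℕ)
    (hf : ∀ k, |f k| ≤ C * (1 + (k : ℝ) ^ 2) ^ j)
    (hint : Integrable (fun k : ℤ => k * f k) (compoundLaw x)) :
    ∫ k : ℤ, k * f k ∂(compoundLaw x) =
      x / 2 * ∫ k, (f (k + 1) - f (k - 1)) ∂(compoundLaw x) := by
  have h1 := integrable_comp_add_compoundLaw hx.le C j hf 1
  have h2 := integrable_comp_add_compoundLaw hx.le C j hf (-1)
  rw [integral_compoundLaw hx hint, integral_sub h1 (by exact h2), integral_compoundLaw hx h1,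
    integral_compoundLaw hx (by exact h2)]
  have e : ∀ k : ℤ, skellam x k * (k * f k) =
      x / 2 * (skellam x (k - 1) * f k) - x / 2 * (skellam x (k + 1) * f k) := by
    intro k
    linear_combination f k / 2 * two_mul_skellam x k
  have s1 : Summable fun k : ℤ => skellam x (k - 1) * f k := by
    rw [← (Equiv.addRight (1 : ℤ)).summable_iff]
    simpa [Function.comp_def] using (integrable_compoundLaw_iff hx).1 h1
  have s2 : Summable fun k : ℤ => skellam x (k + 1) * f k := by
    rw [← (Equiv.addRight (-1 : ℤ)).summable_iff]
    simpa [Function.comp_def] using (integrable_compoundLaw_iff hx).1 h2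
  rw [tsum_congr e, (s1.mul_left _).tsum_sub (s2.mul_left _), tsum_mul_left, tsum_mul_left,
    ← (Equiv.addRight (1 : ℤ)).tsum_eq (fun k => skellam x (k - 1) * f k),
    ← (Equiv.addRight (-1 : ℤ)).tsum_eq (fun k => skellam x (k + 1) * f k), ← mul_sub]
  simp [sub_eq_add_neg]

/-! ### Moments of the score -/

lemma natAbs_cast_sq (k : ℤ) : ((k.natAbs : ℕ) : ℝ) ^ 2 = (k : ℝ) ^ 2 := by
  rw [Nat.cast_natAbs, Int.cast_abs, sq_abs]

lemma scoreBound_nonneg (ν : ℕ) {x : ℝ} (hx : 0 < x) : 0 ≤ scoreBound ν x := by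
  have : 0 < min 1 x := lt_min one_pos hx
  rw [scoreBound]; positivity

lemma scoreBound_natAbs_le (x : ℝ) (k : ℤ) :
    scoreBound k.natAbs x ≤ 1 + (k : ℝ) ^ 2 := by
  rw [scoreBound, natAbs_cast_sq]
  have h1 : min 1 x ≤ 1 := min_le_left _ _
  have h2 : (k : ℝ) ^ 2 / max 1 x ≤ (k : ℝ) ^ 2 := div_le_self (sq_nonneg _) (le_max_left _ _)
  linarith

lemma scoreBound₂_nonneg (ν : ℕ) {x : ℝ} (hx : 0 < x) : 0 ≤ scoreBound₂ ν x := by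
  have : 0 < min 1 x := lt_min one_pos hx
  rw [scoreBound₂]; positivity

lemma scoreBound₂_natAbs_le (x : ℝ) (k : ℤ) :
    scoreBound₂ k.natAbs x ≤ (1 + (k : ℝ) ^ 2) ^ 2 := by
  have h0 := scoreBound_natAbs_le x k
  rw [scoreBound] at h0
  rw [scoreBound₂]
  have h2 : ((k.natAbs : ℕ) : ℝ) ^ 2 / max 1 x ≤ (k : ℝ) ^ 2 := by
    rw [natAbs_cast_sq]; exact div_le_self (sq_nonneg _) (le_max_left _ _)
  have h3 : 0 ≤ ((k.natAbs : ℕ) : ℝ) ^ 2 / max 1 x := by positivity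
  nlinarith

lemma abs_logScore_natAbs_le {x : ℝ} (hx : 0 < x) (k : ℤ) :
    |logScore k.natAbs x| ≤ 1 + (k : ℝ) ^ 2 :=
  (abs_logScore_le _ hx).trans (scoreBound_natAbs_le x k)

lemma abs_logScoreDer_natAbs_le {x : ℝ} (hx : 0 < x) (k : ℤ) :
    |logScoreDer k.natAbs x| ≤ 3 * (1 + (k : ℝ) ^ 2) :=
  (abs_logScoreDer_le _ hx).trans (by have := scoreBound_natAbs_le x k; linarith)

lemma integrable_logScore_pow {x : ℝ} (hx : 0 < x) (j : ℕ) :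
    Integrable (fun k : ℤ => logScore k.natAbs x ^ j) (compoundLaw x) :=
  integrable_compoundLaw_of_le hx.le 1 j fun k => by
    rw [abs_pow, one_mul]
    exact pow_le_pow_left₀ (abs_nonneg _) (abs_logScore_natAbs_le hx k) j

lemma integrable_logScore {x : ℝ} (hx : 0 < x) :
    Integrable (fun k : ℤ => logScore k.natAbs x) (compoundLaw x) := by
  simpa using integrable_logScore_pow hx 1

lemma integrable_logScoreDer_pow {x : ℝ} (hx : 0 < x) (j : ℕ) :
    Integrable (fun k : ℤ => logScoreDer k.natAbs x ^ j) (compoundLaw x) :=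
  integrable_compoundLaw_of_le hx.le (3 ^ j) j fun k => by
    rw [abs_pow, ← mul_pow]
    exact pow_le_pow_left₀ (abs_nonneg _) (abs_logScoreDer_natAbs_le hx k) j

lemma integrable_logScoreDer {x : ℝ} (hx : 0 < x) :
    Integrable (fun k : ℤ => logScoreDer k.natAbs x) (compoundLaw x) := by
  simpa using integrable_logScoreDer_pow hx 1

lemma integrable_sq_mul_logScore {x : ℝ} (hx : 0 < x) :
    Integrable (fun k : ℤ => (k : ℝ) ^ 2 * logScore k.natAbs x) (compoundLaw x) :=
  integrable_compoundLaw_of_le hx.le 1 2 fun k => by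
    rw [abs_mul, abs_of_nonneg (sq_nonneg _)]
    have := abs_logScore_natAbs_le hx k
    have := abs_nonneg (logScore k.natAbs x)
    nlinarith [sq_nonneg (k : ℝ)]

lemma integrable_intCast_sq {x : ℝ} (hx : 0 < x) :
    Integrable (fun k : ℤ => (k : ℝ) ^ 2) (compoundLaw x) :=
  integrable_compoundLaw_of_le hx.le 1 1 fun k => by
    rw [abs_of_nonneg (sq_nonneg _)]; linarith

lemma integrable_scoreBound₂ {x : ℝ} (hx : 0 < x) :
    Integrable (fun k : ℤ => scoreBound₂ k.natAbs x) (compoundLaw x) :=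
  integrable_compoundLaw_of_le hx.le 1 2 fun k => by
    rw [abs_of_nonneg (scoreBound₂_nonneg _ hx), one_mul]
    exact scoreBound₂_natAbs_le x k

/-- The Fisher information in the parameter `log x`. -/
def scoreInfo (x : ℝ) : ℝ := ∫ k : ℤ, logScore k.natAbs x ^ 2 ∂(compoundLaw x)

lemma scoreInfo_nonneg (x : ℝ) : 0 ≤ scoreInfo x := integral_nonneg fun _ => sq_nonneg _

lemma scoreInfo_eq {x : ℝ} (hx : 0 < x) : scoreInfo x = x ^ 2 * besselInfo x := by
  rw [scoreInfo, besselInfo, ← integral_const_mul]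
  congr 1 with k
  rw [logScore, besselLogDer, besselRatio, Nat.cast_natAbs, Int.cast_abs]
  field_simp
  ring

lemma integral_logScore {x : ℝ} (hx : 0 < x) :
    ∫ k : ℤ, logScore k.natAbs x ∂(compoundLaw x) = 0 := by
  have e : ∀ k : ℤ, besselLogDer k.natAbs x * 1 = logScore k.natAbs x + x := fun k => by
    rw [logScore]; ring
  have h := integral_besselLogDer_mul hx (f := fun _ => 1) 1 0 (by simp) (by
    simp_rw [e]; exact (integrable_logScore hx).add (integrable_const _))
  simp_rw [e] at h
  rw [integral_add (integrable_logScore hx) (integrable_const _)] at h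
  simp at h
  linarith

lemma integral_intCast_sq {x : ℝ} (hx : 0 < x) :
    ∫ k : ℤ, (k : ℝ) ^ 2 ∂(compoundLaw x) = x := by
  have h := integral_intCast_mul hx (f := fun k => (k : ℝ)) 1 1
    (fun k => by rw [abs_le]; constructor <;> nlinarith)
    (by simpa [pow_two] using integrable_intCast_sq hx)
  simp_rw [← pow_two] at h
  rw [h]
  have : ∀ k : ℤ, (((k + 1 : ℤ) : ℝ) - ((k - 1 : ℤ) : ℝ)) = 2 := fun k => by push_cast; ring
  simp_rw [this]
  simp

lemma integral_sq_mul_logScore {x : ℝ} (hx : 0 < x) :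
    ∫ k : ℤ, (k : ℝ) ^ 2 * logScore k.natAbs x ∂(compoundLaw x) = x := by
  have e : ∀ k : ℤ, besselLogDer k.natAbs x * (k : ℝ) ^ 2 =
      (k : ℝ) ^ 2 * logScore k.natAbs x + x * (k : ℝ) ^ 2 := fun k => by
    rw [logScore]; ring
  have h := integral_besselLogDer_mul hx (f := fun k => (k : ℝ) ^ 2) 1 1
    (fun k => by rw [abs_of_nonneg (sq_nonneg _)]; linarith) (by
    simp_rw [e]; exact (integrable_sq_mul_logScore hx).add ((integrable_intCast_sq hx).const_mul _))
  simp_rw [e] at h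
  rw [integral_add (integrable_sq_mul_logScore hx) ((integrable_intCast_sq hx).const_mul _),
    integral_const_mul, integral_intCast_sq hx] at h
  have e2 : ∀ k : ℤ, (((k + 1 : ℤ) : ℝ) ^ 2 + ((k - 1 : ℤ) : ℝ) ^ 2) = 2 * (k : ℝ) ^ 2 + 2 :=
    fun k => by push_cast; ring
  simp_rw [e2] at h
  rw [integral_add ((integrable_intCast_sq hx).const_mul _) (integrable_const _),
    integral_const_mul, integral_intCast_sq hx] at h
  simp at h
  linarith

/-- The information identity. The derivative of the score is `k² - x - 2 x s - s²`, in which `k² -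
x` and `s` are centred. -/
lemma integral_logScoreDer {x : ℝ} (hx : 0 < x) :
    ∫ k : ℤ, logScoreDer k.natAbs x ∂(compoundLaw x) = -scoreInfo x := by
  have e : ∀ k : ℤ, logScoreDer k.natAbs x =
      (k : ℝ) ^ 2 - x - 2 * x * logScore k.natAbs x - logScore k.natAbs x ^ 2 := fun k => by
    rw [logScoreDer, natAbs_cast_sq]
  have i1 : Integrable (fun k : ℤ => (k : ℝ) ^ 2 - x) (compoundLaw x) :=
    (integrable_intCast_sq hx).sub (integrable_const _)
  have i2 := (integrable_logScore hx).const_mul (2 * x)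
  have i3 : Integrable (fun k : ℤ => (k : ℝ) ^ 2 - x - 2 * x * logScore k.natAbs x)
    (compoundLaw x) := i1.sub i2
  simp_rw [e]
  rw [integral_sub i3 (integrable_logScore_pow hx 2), integral_sub i1 i2,
    integral_sub (integrable_intCast_sq hx) (integrable_const _), integral_const_mul,
    integral_logScore hx, integral_intCast_sq hx, scoreInfo]
  simp

/-- Multiply the formula for the derivative of the score by `s` and integrate, using `E[k² s] = x`.
Only moments that stay bounded for large `x` remain beside `x`, which fixes the limit of the
information. -/
lemma two_mul_scoreInfo {x : ℝ} (hx : 0 < x) :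
    2 * x * scoreInfo x = x - ∫ k : ℤ, logScore k.natAbs x ^ 3 ∂(compoundLaw x)
      - ∫ k : ℤ, logScore k.natAbs x * logScoreDer k.natAbs x ∂(compoundLaw x) := by
  have e : ∀ k : ℤ, logScore k.natAbs x * logScoreDer k.natAbs x =
      (k : ℝ) ^ 2 * logScore k.natAbs x - x * logScore k.natAbs x
        - 2 * x * logScore k.natAbs x ^ 2 - logScore k.natAbs x ^ 3 := fun k => by
    rw [logScoreDer, natAbs_cast_sq]; ring
  simp_rw [e]
  have i1 := integrable_sq_mul_logScore hx
  have i2 := (integrable_logScore hx).const_mul x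
  have i3 := (integrable_logScore_pow hx 2).const_mul (2 * x)
  have i4 : Integrable (fun k : ℤ => (k : ℝ) ^ 2 * logScore k.natAbs x
    - x * logScore k.natAbs x) (compoundLaw x) := i1.sub i2
  have i5 : Integrable (fun k : ℤ => (k : ℝ) ^ 2 * logScore k.natAbs x
    - x * logScore k.natAbs x - 2 * x * logScore k.natAbs x ^ 2) (compoundLaw x) := i4.sub i3
  rw [integral_sub i5 (integrable_logScore_pow hx 3), integral_sub i4 i3, integral_sub i1 i2, integral_sq_mul_logScore hx,
    integral_const_mul, integral_const_mul, integral_logScore hx, scoreInfo]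
  ring

lemma integral_scoreBound_pow_le {x : ℝ} (hx : 0 < x) {j : ℕ} (hj : j ≠ 0) :
    ∫ k : ℤ, scoreBound k.natAbs x ^ j ∂(compoundLaw x) ≤
      2 ^ j * (1 + 2 * (2 * j).factorial) * min 1 x := by
  have hm0 : 0 < min 1 x := lt_min one_pos hx
  have hm1 : min 1 x ≤ 1 := min_le_left _ _
  have hM0 : 0 < max 1 x := lt_max_of_lt_left one_pos
  have hM : 1 ≤ max 1 x := le_max_left _ _
  have hint : Integrable (fun k : ℤ => ((k : ℝ) ^ 2 / max 1 x) ^ j) (compoundLaw x) := by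
    refine integrable_compoundLaw_of_le hx.le 1 j fun k => ?_
    rw [abs_of_nonneg (by positivity), one_mul]
    gcongr
    exact (div_le_self (sq_nonneg _) hM).trans (by linarith)
  have hpt : ∀ k : ℤ, scoreBound k.natAbs x ^ j ≤
      2 ^ j * (min 1 x + ((k : ℝ) ^ 2 / max 1 x) ^ j) := by
    intro k
    rw [scoreBound, natAbs_cast_sq]
    have hq : 0 ≤ (k : ℝ) ^ 2 / max 1 x := by positivity
    refine (add_pow_le hm0.le hq j).trans ?_
    have h1 : min 1 x ^ j ≤ min 1 x := pow_le_of_le_one hm0.le hm1 hj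
    have h2 : (2 : ℝ) ^ (j - 1) ≤ 2 ^ j := pow_le_pow_right₀ (by norm_num) (by omega)
    gcongr
  have i2 : Integrable (fun k : ℤ => 2 ^ j * (min 1 x + ((k : ℝ) ^ 2 / max 1 x) ^ j))
    (compoundLaw x) := ((integrable_const _).add hint).const_mul _
  refine (integral_mono_of_nonneg (ae_of_all _ fun k => pow_nonneg (scoreBound_nonneg _ hx) _)
    i2 (ae_of_all _ hpt)).trans ?_
  have h := integral_sq_div_pow_le hx hj
  rw [integral_const_mul, integral_add (integrable_const _) hint, integral_const, probReal_univ,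
    one_smul, mul_assoc]
  refine mul_le_mul_of_nonneg_left ?_ (by positivity)
  linarith

lemma integrable_scoreBound_pow {x : ℝ} (hx : 0 < x) (j : ℕ) :
    Integrable (fun k : ℤ => scoreBound k.natAbs x ^ j) (compoundLaw x) :=
  integrable_compoundLaw_of_le hx.le 1 j fun k => by
    rw [abs_of_nonneg (pow_nonneg (scoreBound_nonneg _ hx) _), one_mul]
    exact pow_le_pow_left₀ (scoreBound_nonneg _ hx) (scoreBound_natAbs_le x k) j

lemma scoreBound₂_le (ν : ℕ) {x : ℝ} (hx : 0 < x) :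
    scoreBound₂ ν x ≤ scoreBound ν x + scoreBound ν x ^ 2 := by
  have hm0 : 0 < min 1 x := lt_min one_pos hx
  have hq : 0 ≤ (ν : ℝ) ^ 2 / max 1 x := by positivity
  rw [scoreBound₂, scoreBound]
  nlinarith

/-- All moments used below are at most of the order of `min 1 x`. -/
lemma exists_score_moment_bound : ∃ C : ℝ, 0 < C ∧ ∀ x : ℝ, 0 < x →
    scoreInfo x ≤ C * min 1 x ∧
    ∫ k : ℤ, logScore k.natAbs x ^ 4 ∂(compoundLaw x) ≤ C * min 1 x ∧
    ∫ k : ℤ, logScoreDer k.natAbs x ^ 2 ∂(compoundLaw x) ≤ C * min 1 x ∧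
    ∫ k : ℤ, scoreBound₂ k.natAbs x ∂(compoundLaw x) ≤ C * min 1 x := by
  let c : ℕ → ℝ := fun j => 2 ^ j * (1 + 2 * (2 * j).factorial)
  have hc : ∀ j, 0 < c j := fun j => by positivity
  have c1 := hc 1
  have c2 := hc 2
  have c4 := hc 4
  refine ⟨c 1 + 9 * c 2 + c 4, by linarith, fun x hx => ?_⟩
  have hm0 : 0 < min 1 x := lt_min one_pos hx
  have h1 : ∫ k : ℤ, scoreBound k.natAbs x ^ 1 ∂(compoundLaw x) ≤ c 1 * min 1 x :=
    integral_scoreBound_pow_le hx one_ne_zero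
  have h2 : ∫ k : ℤ, scoreBound k.natAbs x ^ 2 ∂(compoundLaw x) ≤ c 2 * min 1 x :=
    integral_scoreBound_pow_le hx two_ne_zero
  have h4 : ∫ k : ℤ, scoreBound k.natAbs x ^ 4 ∂(compoundLaw x) ≤ c 4 * min 1 x :=
    integral_scoreBound_pow_le hx four_ne_zero
  have hle : ∀ a b : ℝ, a ≤ b * min 1 x → b ≤ c 1 + 9 * c 2 + c 4 →
      a ≤ (c 1 + 9 * c 2 + c 4) * min 1 x := fun a b hab hb =>
    hab.trans (mul_le_mul_of_nonneg_right hb hm0.le)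
  have hs : ∀ k : ℤ, |logScore k.natAbs x| ≤ scoreBound k.natAbs x := fun k => abs_logScore_le _ hx
  refine ⟨hle _ (c 2) ?_ (by linarith), hle _ (c 4) ?_ (by linarith),
    hle _ (9 * c 2) ?_ (by linarith), hle _ (c 1 + c 2) ?_ (by linarith)⟩
  · refine (integral_mono (integrable_logScore_pow hx 2) (integrable_scoreBound_pow hx 2)
      fun k => ?_).trans h2
    exact sq_le_sq' (by linarith [(abs_le.1 (hs k)).1]) (abs_le.1 (hs k)).2
  · refine (integral_mono (integrable_logScore_pow hx 4) (integrable_scoreBound_pow hx 4)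
      fun k => ?_).trans h4
    calc logScore k.natAbs x ^ 4 = |logScore k.natAbs x| ^ 4 := by
          rw [← abs_pow, abs_of_nonneg (Even.pow_nonneg (by decide) _)]
      _ ≤ _ := pow_le_pow_left₀ (abs_nonneg _) (hs k) 4
  · refine (integral_mono (integrable_logScoreDer_pow hx 2)
      ((integrable_scoreBound_pow hx 2).const_mul 9) fun k => ?_).trans ?_
    · have h := abs_logScoreDer_le k.natAbs hx
      have := sq_le_sq' (by linarith [(abs_le.1 h).1]) (abs_le.1 h).2
      simp only
      linarith
    · rw [integral_const_mul]; linarith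
  · refine (integral_mono (integrable_scoreBound₂ hx)
      ((integrable_scoreBound_pow hx 1).add (integrable_scoreBound_pow hx 2)) fun k => ?_).trans ?_
    · simpa using scoreBound₂_le k.natAbs hx
    · rw [integral_add' (integrable_scoreBound_pow hx 1) (integrable_scoreBound_pow hx 2)]; linarith

/-! ### Asymptotics, positivity and continuity of the Fisher information. -/

/-- In `2 x G = x - E[s³] - E[s D]` both expectations are bounded for `x ≥ 1`, by `|s|³ ≤ 1 + s⁴`
and `2 |s D| ≤ s² + D²`. -/
lemma tendsto_scoreInfo_atTop : Tendsto scoreInfo atTop (𝓝 (1 / 2)) := by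
  obtain ⟨C, hC, h⟩ := exists_score_moment_bound
  have hb : ∀ x : ℝ, 1 ≤ x → |scoreInfo x - 1 / 2| ≤ (1 + 4 * C) / (2 * x) := by
    intro x hx1
    have hx : 0 < x := by linarith
    obtain ⟨h2, h4, hD, -⟩ := h x hx
    rw [min_eq_left hx1, mul_one] at h2 h4 hD
    have i2 := integrable_logScore_pow hx 2
    have i4 := integrable_logScore_pow hx 4
    have iD := integrable_logScoreDer_pow hx 2
    have e := two_mul_scoreInfo hx
    have b1 : |∫ k : ℤ, logScore k.natAbs x ^ 3 ∂(compoundLaw x)| ≤ 1 + C := by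
      rw [← Real.norm_eq_abs]
      refine (norm_integral_le_of_norm_le ((integrable_const (1 : ℝ)).add i4)
        (ae_of_all _ fun k => ?_)).trans ?_
      · simp only [norm_pow, Real.norm_eq_abs, Pi.add_apply]
        have h0 := abs_nonneg (logScore k.natAbs x)
        have : logScore k.natAbs x ^ 4 = |logScore k.natAbs x| ^ 4 := by
          rw [← abs_pow, abs_of_nonneg (Even.pow_nonneg (by decide) _)]
        rw [this]
        set s := |logScore k.natAbs x|
        rcases le_total s 1 with hs | hs
        · have : s ^ 3 ≤ 1 := pow_le_one₀ h0 hs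
          have : 0 ≤ s ^ 4 := by positivity
          linarith
        · have : s ^ 3 ≤ s ^ 4 := pow_le_pow_right₀ hs (by norm_num)
          linarith
      · rw [integral_add' (integrable_const _) i4]; simp; linarith
    have b2 : |∫ k : ℤ, logScore k.natAbs x * logScoreDer k.natAbs x ∂(compoundLaw x)| ≤ 2 * C := by
      rw [← Real.norm_eq_abs]
      refine (norm_integral_le_of_norm_le (i2.add iD) (ae_of_all _ fun k => ?_)).trans ?_
      · simp only [Real.norm_eq_abs, Pi.add_apply]
        rw [abs_le]
        constructor <;> nlinarith [sq_nonneg (logScore k.natAbs x + logScoreDer k.natAbs x),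
          sq_nonneg (logScore k.natAbs x - logScoreDer k.natAbs x)]
      · rw [integral_add' i2 iD, ← scoreInfo]; linarith
    have b1 := abs_le.1 b1
    have b2 := abs_le.1 b2
    rw [le_div_iff₀ (by positivity), ← abs_of_pos (show 0 < 2 * x by positivity), ← abs_mul, abs_le]
    constructor <;> nlinarith
  rw [tendsto_iff_norm_sub_tendsto_zero]
  refine squeeze_zero' (Eventually.of_forall fun _ => norm_nonneg _)
    ((eventually_ge_atTop 1).mono fun x hx => hb x hx) ?_
  exact tendsto_const_nhds.div_atTop (tendsto_id.const_mul_atTop two_pos)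

/-- From `-x ≤ s ≤ |k|` follows `s² ≤ x² + k²`, and `k²` has mean `x`. -/
lemma scoreInfo_le {x : ℝ} (hx : 0 < x) : scoreInfo x ≤ x + x ^ 2 := by
  have i := (integrable_const (μ := compoundLaw x) (x ^ 2)).add (integrable_intCast_sq hx)
  refine (integral_mono (integrable_logScore_pow hx 2) i fun k => ?_).trans_eq ?_
  · have h1 := neg_le_logScore k.natAbs hx
    have h2 := logScore_le k.natAbs hx
    have h3 := natAbs_cast_sq k
    simp only [Pi.add_apply]
    rcases le_total 0 (logScore k.natAbs x) with h | h <;> nlinarith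
  · rw [integral_add' (integrable_const _) (integrable_intCast_sq hx), integral_intCast_sq hx]
    simp; ring

/-- Only `k = ±1` is kept: each has mass at least `e^{-x} x / 2`, and there `s ≥ 1 - x`. -/
lemma le_scoreInfo {x : ℝ} (hx : 0 < x) (hx1 : x ≤ 1) :
    x * (Real.exp (-x) * (1 - x) ^ 2) ≤ scoreInfo x := by
  have hI : x / 2 ≤ besselI 1 x := by
    have := (summable_besselI 1 x).le_tsum 0 (fun m _ => by positivity)
    simpa [besselI] using this
  have hs : 1 - x ≤ logScore 1 x := by
    have := le_besselLogDer 1 hx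
    rw [logScore]; push_cast at this; linarith
  have hs2 : (1 - x) ^ 2 ≤ logScore 1 x ^ 2 := pow_le_pow_left₀ (by linarith) hs 2
  have h := ((integrable_compoundLaw_iff hx).1 (integrable_logScore_pow hx 2)).sum_le_tsum
    {1, -1} (fun k _ => mul_nonneg (skellam_pos hx k).le (sq_nonneg _))
  rw [Finset.sum_pair (by decide), ← integral_compoundLaw hx (integrable_logScore_pow hx 2),
    ← scoreInfo] at h
  simp only [skellam, Int.natAbs_one, Int.natAbs_neg] at h
  have h1 : Real.exp (-x) * (x / 2) * (1 - x) ^ 2 ≤ Real.exp (-x) * besselI 1 x * logScore 1 x ^ 2 := by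
    have := besselI_pos 1 hx
    gcongr
  linarith

lemma tendsto_scoreInfo_div : Tendsto (fun x => scoreInfo x / x) (𝓝[>] 0) (𝓝 1) := by
  have h1 : Tendsto (fun x : ℝ => Real.exp (-x) * (1 - x) ^ 2) (𝓝[>] 0) (𝓝 1) := by
    have : Continuous fun x : ℝ => Real.exp (-x) * (1 - x) ^ 2 := by fun_prop
    simpa using (this.tendsto 0).mono_left nhdsWithin_le_nhds
  have h2 : Tendsto (fun x : ℝ => 1 + x) (𝓝[>] 0) (𝓝 1) := by
    have : Continuous fun x : ℝ => 1 + x := by fun_prop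
    simpa using (this.tendsto 0).mono_left nhdsWithin_le_nhds
  refine tendsto_of_tendsto_of_tendsto_of_le_of_le' h1 h2 ?_ ?_
  · filter_upwards [Ioo_mem_nhdsGT (show (0 : ℝ) < 1 by norm_num)] with x hx
    rw [le_div_iff₀ hx.1]
    linarith [le_scoreInfo hx.1 hx.2.le]
  · filter_upwards [self_mem_nhdsWithin] with x hx
    have hx : 0 < x := hx
    rw [div_le_iff₀ hx]
    linarith [scoreInfo_le hx]

/-- The score is positive at any integer `n > x` because `w ≥ n`, and every integer carries mass. -/
lemma scoreInfo_pos {x : ℝ} (hx : 0 < x) : 0 < scoreInfo x := by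
  rw [scoreInfo, integral_compoundLaw hx (integrable_logScore_pow hx 2)]
  obtain ⟨n, hn⟩ := exists_nat_gt x
  refine ((integrable_compoundLaw_iff hx).1 (integrable_logScore_pow hx 2)).tsum_pos
    (fun k => mul_nonneg (skellam_pos hx k).le (sq_nonneg _)) n ?_
  have : 0 < logScore n x := by
    have := le_besselLogDer n hx
    rw [logScore]; linarith
  have := skellam_pos hx n
  rw [Int.natAbs_natCast]
  positivity

lemma besselI_mono (ν : ℕ) {x y : ℝ} (hx : 0 ≤ x) (hxy : x ≤ y) : besselI ν x ≤ besselI ν y := by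
  refine (summable_besselI ν x).tsum_le_tsum (fun m => ?_) (summable_besselI ν y)
  gcongr

/-- Weierstrass test on `(0, 2x)`: Bessel functions increase, so the masses at `y` are dominated by
`e^{2x}` times those at `2x`, which integrate polynomials. -/
lemma continuousOn_scoreInfo : ContinuousOn scoreInfo (Set.Ioi 0) := by
  intro x hx
  have hx : 0 < x := hx
  refine ContinuousAt.continuousWithinAt ?_
  have hb : 0 < 2 * x := by positivity
  have key : ContinuousOn (fun y => ∑' k : ℤ, skellam y k * logScore k.natAbs y ^ 2)
      (Set.Ioo 0 (2 * x)) := by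
    have hi : Integrable (fun k : ℤ => (1 + (k : ℝ) ^ 2) ^ 2) (compoundLaw (2 * x)) :=
      integrable_compoundLaw_of_le hb.le 1 2 fun k => by
        rw [abs_of_nonneg (by positivity), one_mul]
    refine continuousOn_tsum (u := fun k : ℤ => Real.exp (2 * x) *
      (skellam (2 * x) k * (1 + (k : ℝ) ^ 2) ^ 2)) (fun k => ?_)
      (((integrable_compoundLaw_iff hb).1 hi).mul_left _) fun k y hy => ?_
    · have h1 := (continuous_besselI k.natAbs).continuousOn (s := Set.Ioo 0 (2 * x))
      have h2 : ContinuousOn (logScore k.natAbs) (Set.Ioo 0 (2 * x)) := fun y hy =>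
        (hasDerivAt_logScore _ hy.1).continuousAt.continuousWithinAt
      have h3 : ContinuousOn (fun y : ℝ => Real.exp (-y)) (Set.Ioo 0 (2 * x)) := by fun_prop
      exact (h3.mul h1).mul (h2.pow 2)
    · have hs := abs_logScore_natAbs_le hy.1 k
      rw [Real.norm_of_nonneg (mul_nonneg (skellam_pos hy.1 k).le (sq_nonneg _)), ← mul_assoc]
      have h1 : skellam y k ≤ Real.exp (2 * x) * skellam (2 * x) k := by
        rw [skellam, skellam, ← mul_assoc, ← Real.exp_add, add_neg_cancel, Real.exp_zero, one_mul]
        have h2 : Real.exp (-y) ≤ 1 := Real.exp_le_one_iff.2 (by linarith [hy.1])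
        have h3 := besselI_mono k.natAbs hy.1.le hy.2.le
        have h4 := besselI_pos k.natAbs hy.1
        nlinarith
      have h2 : logScore k.natAbs y ^ 2 ≤ (1 + (k : ℝ) ^ 2) ^ 2 :=
        sq_le_sq' (by linarith [(abs_le.1 hs).1]) (abs_le.1 hs).2
      exact mul_le_mul h1 h2 (sq_nonneg _) (mul_nonneg (Real.exp_pos _).le (skellam_pos hb k).le)
  have hmem : Set.Ioo 0 (2 * x) ∈ 𝓝 x := Ioo_mem_nhds hx (by linarith)
  refine (key.continuousAt hmem).congr ?_
  filter_upwards [hmem] with y hy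
  rw [scoreInfo, integral_compoundLaw hy.1 (integrable_logScore_pow hy.1 2)]

/-! ### Sums of independent variables on a product space -/

section Pi

variable {ι : Type*} [Fintype ι] {E : ι → Type*} [∀ i, MeasurableSpace (E i)]
  {P : ∀ i, Measure (E i)} [∀ i, IsProbabilityMeasure (P i)]

lemma integrable_pi_eval {f : ∀ i, E i → ℝ} (i : ι) (hf : Integrable (f i) (P i)) :
    Integrable (fun x : ∀ i, E i => f i (x i)) (Measure.pi P) :=
  (measurePreserving_eval P i).integrable_comp_of_integrable hf

lemma integral_pi_eval {f : ∀ i, E i → ℝ} (i : ι) (hf : AEStronglyMeasurable (f i) (P i)) :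
    ∫ x, f i (x i) ∂(Measure.pi P) = ∫ y, f i y ∂(P i) := by
  have h := measurePreserving_eval P i
  rw [← h.map_eq, integral_map h.measurable.aemeasurable (by rwa [h.map_eq])]

lemma sq_integral_abs_le {Ω : Type*} [MeasurableSpace Ω] {μ : Measure Ω} [IsProbabilityMeasure μ]
    {Y : Ω → ℝ} (hY : MemLp Y 2 μ) : (∫ ω, |Y ω| ∂μ) ^ 2 ≤ ∫ ω, Y ω ^ 2 ∂μ := by
  have h := variance_nonneg (fun ω => |Y ω|) μ
  rw [variance_eq_sub (X := fun ω => |Y ω|) hY.abs] at h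
  simp only [Pi.pow_apply, sq_abs] at h
  linarith

/-- A sum of independent centred variables is small in `L¹` when the sum of their second moments
is. -/
lemma integral_abs_sum_pi_le {f : ∀ i, E i → ℝ} (hf : ∀ i, MemLp (f i) 2 (P i))
    (h0 : ∀ i, ∫ y, f i y ∂(P i) = 0) :
    ∫ x, |∑ i, f i (x i)| ∂(Measure.pi P) ≤ √(∑ i, ∫ y, f i y ^ 2 ∂(P i)) := by
  have hm : ∀ i, MemLp (fun x : ∀ i, E i => f i (x i)) 2 (Measure.pi P) := fun i =>
    (hf i).comp_measurePreserving (measurePreserving_eval P i)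
  have hsum : MemLp (fun x : ∀ i, E i => ∑ i, f i (x i)) 2 (Measure.pi P) :=
    memLp_finsetSum _ fun i _ => hm i
  refine Real.le_sqrt_of_sq_le ((sq_integral_abs_le hsum).trans_eq ?_)
  have h1 := variance_sum_pi hf
  have h2 : (∑ i, fun x : ∀ i, E i => f i (x i)) = fun x => ∑ i, f i (x i) := by
    ext x; simp
  have hmean : ∫ x, ∑ i, f i (x i) ∂(Measure.pi P) = 0 := by
    rw [integral_finsetSum _ fun i _ => integrable_pi_eval i ((hf i).integrable one_le_two)]
    exact Finset.sum_eq_zero fun i _ => by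
      rw [integral_pi_eval i (hf i).aestronglyMeasurable, h0 i]
  rw [h2, variance_eq_sub hsum, hmean] at h1
  simp only [Pi.pow_apply, ne_eq, OfNat.ofNat_ne_zero, not_false_eq_true, zero_pow, sub_zero] at h1
  rw [h1]
  refine Finset.sum_congr rfl fun i _ => ?_
  rw [variance_eq_sub (hf i), h0 i]
  simp

lemma integral_abs_sum_pi_le_sum {f : ∀ i, E i → ℝ} (hf : ∀ i, Integrable (f i) (P i)) :
    ∫ x, |∑ i, f i (x i)| ∂(Measure.pi P) ≤ ∑ i, ∫ y, |f i y| ∂(P i) := by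
  have hi : ∀ i, Integrable (fun x : ∀ i, E i => |f i (x i)|) (Measure.pi P) := fun i =>
    (integrable_pi_eval i (hf i)).abs
  calc _ ≤ ∫ x, ∑ i, |f i (x i)| ∂(Measure.pi P) :=
        integral_mono (integrable_finsetSum _ fun i _ => integrable_pi_eval i (hf i)).abs
          (integrable_finsetSum _ fun i _ => hi i) fun x => Finset.abs_sum_le_sum_abs _ _
    _ = _ := by
        rw [integral_finsetSum _ fun i _ => hi i]
        exact Finset.sum_congr rfl fun i _ =>
          integral_pi_eval (f := fun i y => |f i y|) i (hf i).abs.aestronglyMeasurable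

end Pi

/-! ### A central limit theorem for triangular arrays -/

/-- Replace the factors one at a time; all the others have norm at most one. -/
lemma norm_prod_sub_prod_le {ι : Type*} (s : Finset ι) (z w : ι → ℂ) (hz : ∀ i ∈ s, ‖z i‖ ≤ 1)
    (hw : ∀ i ∈ s, ‖w i‖ ≤ 1) : ‖∏ i ∈ s, z i - ∏ i ∈ s, w i‖ ≤ ∑ i ∈ s, ‖z i - w i‖ := by
  classical
  induction s using Finset.induction_on with
  | empty => simp
  | insert a s ha ih =>
    rw [Finset.prod_insert ha, Finset.prod_insert ha, Finset.sum_insert ha]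
    have h1 := ih (fun i hi => hz i (Finset.mem_insert_of_mem hi))
      (fun i hi => hw i (Finset.mem_insert_of_mem hi))
    have h2 : ‖∏ i ∈ s, z i‖ ≤ 1 := by
      rw [norm_prod]
      exact Finset.prod_le_one (fun i _ => norm_nonneg _)
        fun i hi => hz i (Finset.mem_insert_of_mem hi)
    have h3 := hw a (Finset.mem_insert_self _ _)
    calc ‖z a * ∏ i ∈ s, z i - w a * ∏ i ∈ s, w i‖
        = ‖(z a - w a) * ∏ i ∈ s, z i + w a * (∏ i ∈ s, z i - ∏ i ∈ s, w i)‖ := by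
          congr 1; ring
      _ ≤ ‖z a - w a‖ * ‖∏ i ∈ s, z i‖ + ‖w a‖ * ‖∏ i ∈ s, z i - ∏ i ∈ s, w i‖ := by
          refine (norm_add_le _ _).trans ?_
          rw [norm_mul, norm_mul]
      _ ≤ ‖z a - w a‖ * 1 + 1 * ∑ i ∈ s, ‖z i - w i‖ := by gcongr
      _ = _ := by ring

lemma norm_exp_mul_I_sub_taylor_le (y : ℝ) :
    ‖Complex.exp (y * Complex.I) - (1 + y * Complex.I - (y : ℂ) ^ 2 / 2)‖ ≤ 2 * |y| ^ 3 := by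
  have hc := abs_sub_taylor_two_le (f := Real.cos) (f₁ := fun t => -Real.sin t)
    (f₂ := fun t => -Real.cos t) (f₃ := fun t => Real.sin t) (δ := y) (B := 1)
    (fun t _ => Real.hasDerivAt_cos t) (fun t _ => (Real.hasDerivAt_sin t).neg)
    (fun t _ => (Real.hasDerivAt_cos t).neg.congr_deriv (neg_neg _)) (fun t _ => Real.abs_sin_le_one t)
  have hs := abs_sub_taylor_two_le (f := Real.sin) (f₁ := Real.cos)
    (f₂ := fun t => -Real.sin t) (f₃ := fun t => -Real.cos t) (δ := y) (B := 1)
    (fun t _ => Real.hasDerivAt_sin t) (fun t _ => Real.hasDerivAt_cos t)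
    (fun t _ => (Real.hasDerivAt_sin t).neg) (fun t _ => by
      rw [abs_neg]; exact Real.abs_cos_le_one t)
  simp only [Real.cos_zero, Real.sin_zero, neg_zero, zero_mul, sub_zero, one_mul, zero_div] at hc hs
  have e : Complex.exp (y * Complex.I) - (1 + y * Complex.I - (y : ℂ) ^ 2 / 2) =
      ((Real.cos y - 1 - -1 * y ^ 2 / 2 : ℝ) : ℂ) + ((Real.sin y - y : ℝ) : ℂ) * Complex.I := by
    rw [Complex.exp_mul_I]
    push_cast
    ring
  rw [e]
  refine (norm_add_le _ _).trans ?_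
  rw [norm_mul, Complex.norm_I, mul_one, Complex.norm_real, Complex.norm_real, Real.norm_eq_abs,
    Real.norm_eq_abs]
  linarith

/-- The cubic Taylor error is interpolated by `2 |y|³ ≤ η y² + y⁴ / η`, so no third moment appears.
Replacing `1 - σ/2` by `e^{-σ/2}` costs at most `σ²`, which Cauchy–Schwarz bounds by the fourth
moment. -/
lemma norm_integral_exp_sub_exp_le {Ω : Type*} [MeasurableSpace Ω] {μ : Measure Ω}
    [IsProbabilityMeasure μ] {Y : Ω → ℝ} (hY2 : MemLp Y 2 μ)
    (hY4 : Integrable (fun ω => Y ω ^ 4) μ) (h0 : ∫ ω, Y ω ∂μ = 0) {η : ℝ} (hη : 0 < η) :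
    ‖∫ ω, Complex.exp (Y ω * Complex.I) ∂μ - Complex.exp (-(∫ ω, Y ω ^ 2 ∂μ : ℝ) / 2)‖ ≤
      η * ∫ ω, Y ω ^ 2 ∂μ + (1 / η + 1) * ∫ ω, Y ω ^ 4 ∂μ := by
  have hY1 := hY2.integrable one_le_two
  have hYs := hY2.integrable_sq
  have hm := hY2.aestronglyMeasurable
  set σ := ∫ ω, Y ω ^ 2 ∂μ
  set κ := ∫ ω, Y ω ^ 4 ∂μ
  have hσ : 0 ≤ σ := integral_nonneg fun _ => sq_nonneg _
  have hσκ : σ ^ 2 ≤ κ := by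
    have h := sq_integral_abs_le (μ := μ) (Y := fun ω => Y ω ^ 2) ((memLp_two_iff_integrable_sq
      (hm.pow 2)).2 (by simpa [← pow_mul] using hY4))
    simpa [← pow_mul] using h
  have hexp : Integrable (fun ω => Complex.exp (Y ω * Complex.I)) μ := by
    refine Integrable.of_bound (C := 1) ?_ (ae_of_all _ fun ω => ?_)
    · have : Continuous fun y : ℝ => Complex.exp (y * Complex.I) := by fun_prop
      exact this.comp_aestronglyMeasurable hm
    · rw [Complex.norm_exp_ofReal_mul_I]
  have hpoly : Integrable (fun ω => 1 + (Y ω : ℂ) * Complex.I - (Y ω : ℂ) ^ 2 / 2) μ := by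
    refine ((integrable_const _).add (hY1.ofReal.mul_const _)).sub (Integrable.div_const ?_ _)
    have := hYs.ofReal (𝕜 := ℂ)
    simpa using this
  have hpolyI : ∫ ω, (1 + (Y ω : ℂ) * Complex.I - (Y ω : ℂ) ^ 2 / 2) ∂μ = 1 - (σ : ℂ) / 2 := by
    have i2 : Integrable (fun ω => (Y ω : ℂ) ^ 2 / 2) μ := by
      have := hYs.ofReal (𝕜 := ℂ)
      exact Integrable.div_const (by simpa using this) _
    have i1 : Integrable (fun ω => (Y ω : ℂ) * Complex.I) μ := hY1.ofReal.mul_const _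
    have i0 : Integrable (fun ω => 1 + (Y ω : ℂ) * Complex.I) μ := (integrable_const _).add i1
    rw [integral_sub i0 i2, integral_add (integrable_const _) i1, integral_mul_const, integral_div]
    have e1 : ∫ ω, (Y ω : ℂ) ∂μ = ((∫ ω, Y ω ∂μ : ℝ) : ℂ) := integral_ofReal
    have e2 : ∫ ω, (Y ω : ℂ) ^ 2 ∂μ = ((∫ ω, Y ω ^ 2 ∂μ : ℝ) : ℂ) := by
      have := integral_ofReal (𝕜 := ℂ) (f := fun ω => Y ω ^ 2) (μ := μ)
      simpa using this
    rw [e1, e2, h0]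
    simp [σ]
  have b1 : ‖∫ ω, Complex.exp (Y ω * Complex.I) ∂μ - (1 - (σ : ℂ) / 2)‖ ≤ η * σ + 1 / η * κ := by
    rw [← hpolyI, ← integral_sub hexp hpoly]
    refine (norm_integral_le_of_norm_le ((hYs.const_mul η).add (hY4.const_mul (1 / η)))
      (ae_of_all _ fun ω => (norm_exp_mul_I_sub_taylor_le (Y ω)).trans ?_)).trans_eq ?_
    · simp only [Pi.add_apply]
      have h1 : |Y ω| ^ 2 = Y ω ^ 2 := sq_abs _
      have h2 : |Y ω| ^ 4 = Y ω ^ 4 := by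
        rw [← abs_pow, abs_of_nonneg (Even.pow_nonneg (by decide) _)]
      rw [← h1, ← h2]
      set y := |Y ω|
      have h3 : η * y ^ 2 + 1 / η * y ^ 4 - 2 * y ^ 3 = y ^ 2 / η * (η - y) ^ 2 := by
        field_simp; ring
      have : 0 ≤ y ^ 2 / η * (η - y) ^ 2 := by positivity
      linarith
    · rw [integral_add' (hYs.const_mul η) (hY4.const_mul (1 / η)), integral_const_mul,
        integral_const_mul]
  have b2 : ‖(1 - (σ : ℂ) / 2) - Complex.exp (-(σ : ℝ) / 2)‖ ≤ κ := by
    have e : (1 - (σ : ℂ) / 2) - Complex.exp (-(σ : ℝ) / 2) =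
        ((1 - σ / 2 - Real.exp (-σ / 2) : ℝ) : ℂ) := by push_cast; rfl
    rw [e, Complex.norm_real, Real.norm_eq_abs]
    have h1 := Real.one_sub_le_exp_neg (σ / 2)
    have h2 : Real.exp (-(σ / 2)) ≤ 1 - σ / 2 + (σ / 2) ^ 2 := by
      have h3 := Real.add_one_le_exp (σ / 2)
      have h4 : Real.exp (-(σ / 2)) ≤ 1 / (1 + σ / 2) := by
        rw [Real.exp_neg, ← one_div]
        exact one_div_le_one_div_of_le (by positivity) (by linarith)
      refine h4.trans ?_
      rw [div_le_iff₀ (by positivity)]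
      nlinarith [pow_nonneg hσ 3]
    rw [← neg_div] at h1 h2
    rw [abs_le]
    constructor <;> nlinarith
  calc _ = ‖(∫ ω, Complex.exp (Y ω * Complex.I) ∂μ - (1 - (σ : ℂ) / 2))
        + ((1 - (σ : ℂ) / 2) - Complex.exp (-(σ : ℝ) / 2))‖ := by congr 1; ring
    _ ≤ _ := (norm_add_le _ _).trans (by linarith)

/-- A central limit theorem under a Lyapunov condition of order four, for a family of finite
products of probability spaces. -/
theorem tendsto_integral_sum_pi_gaussian {κ : Type*} {l : Filter κ} [l.IsCountablyGenerated]
    {n : κ → ℕ} {E : Type*} [MeasurableSpace E] {P : ∀ T, Fin (n T) → Measure E}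
    [∀ T i, IsProbabilityMeasure (P T i)] {f : ∀ T, Fin (n T) → E → ℝ}
    (hf : ∀ T i, Measurable (f T i))
    (h2 : ∀ᶠ T in l, ∀ i, MemLp (f T i) 2 (P T i))
    (h4 : ∀ᶠ T in l, ∀ i, Integrable (fun y => f T i y ^ 4) (P T i))
    (h0 : ∀ᶠ T in l, ∀ i, ∫ y, f T i y ∂(P T i) = 0)
    (hvar : Tendsto (fun T => ∑ i, ∫ y, f T i y ^ 2 ∂(P T i)) l (𝓝 1))
    (hlyap : Tendsto (fun T => ∑ i, ∫ y, f T i y ^ 4 ∂(P T i)) l (𝓝 0))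
    (g : BoundedContinuousFunction ℝ ℝ) :
    Tendsto (fun T => ∫ x, g (∑ i, f T i (x i)) ∂(Measure.pi (P T))) l
      (𝓝 (∫ y, g y ∂(gaussianReal 0 1))) := by
  have hmeas : ∀ T, Measurable fun x : Fin (n T) → E => ∑ i, f T i (x i) := fun T =>
    Finset.measurable_sum _ fun i _ => (hf T i).comp (measurable_pi_apply i)
  let Q : κ → ProbabilityMeasure ℝ := fun T =>
    ⟨(Measure.pi (P T)).map fun x => ∑ i, f T i (x i),
      Measure.isProbabilityMeasure_map (hmeas T).aemeasurable⟩
  have hchar : ∀ t : ℝ, Tendsto (fun T => charFun (Q T : Measure ℝ) t) l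
      (𝓝 (charFun (gaussianReal 0 1) t)) := by
    intro t
    rcases eq_or_ne t 0 with rfl | ht
    · simpa using tendsto_const_nhds
    have hQ : ∀ T, charFun (Q T : Measure ℝ) t =
        ∏ i, ∫ y, Complex.exp ((t * f T i y : ℝ) * Complex.I) ∂(P T i) := by
      intro T
      rw [charFun_apply_real]
      simp only [Q, ProbabilityMeasure.coe_mk]
      rw [integral_map (hmeas T).aemeasurable (by fun_prop),
        ← integral_fintype_prod_eq_prod (fun i y => Complex.exp ((t * f T i y : ℝ) * Complex.I))]
      congr 1 with x
      rw [← Complex.exp_sum, ← Finset.sum_mul]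
      push_cast
      rw [Finset.mul_sum]
    have hlim : Tendsto (fun T => ∏ i, Complex.exp
        (-((∫ y, (t * f T i y) ^ 2 ∂(P T i) : ℝ) : ℂ) / 2)) l
          (𝓝 (charFun (gaussianReal 0 1) t)) := by
      have e : ∀ T, ∏ i, Complex.exp (-((∫ y, (t * f T i y) ^ 2 ∂(P T i) : ℝ) : ℂ) / 2) =
          Complex.exp (-((t ^ 2 * ∑ i, ∫ y, f T i y ^ 2 ∂(P T i) : ℝ) : ℂ) / 2) := by
        intro T
        rw [← Complex.exp_sum, ← Finset.sum_div, Finset.sum_neg_distrib, Finset.mul_sum]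
        simp_rw [mul_pow, integral_const_mul]
        push_cast
        rfl
      simp_rw [e]
      have h1 : Tendsto (fun T => ((t ^ 2 * ∑ i, ∫ y, f T i y ^ 2 ∂(P T i) : ℝ) : ℂ)) l
          (𝓝 ((t ^ 2 * 1 : ℝ) : ℂ)) :=
        (Complex.continuous_ofReal.tendsto _).comp (hvar.const_mul (t ^ 2))
      have h2 := (Complex.continuous_exp.tendsto _).comp (h1.neg.div_const 2)
      have e3 : charFun (gaussianReal 0 1) t = Complex.exp (-((t ^ 2 * 1 : ℝ) : ℂ) / 2) := by
        rw [charFun_gaussianReal]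
        congr 1
        push_cast
        simp only [mul_zero, zero_mul]
        ring
      rw [e3]
      exact h2
    have hdiff : Tendsto (fun T => charFun (Q T : Measure ℝ) t - ∏ i, Complex.exp
        (-((∫ y, (t * f T i y) ^ 2 ∂(P T i) : ℝ) : ℂ) / 2)) l (𝓝 0) := by
      rw [tendsto_zero_iff_norm_tendsto_zero, Metric.tendsto_nhds]
      intro ε hε
      -- The variance contribution tends to `η t²` and is made smaller than `ε` first; the
      -- fourth-moment term then vanishes for this fixed `η`.
      obtain ⟨η, hη, hηε⟩ : ∃ η > 0, η * t ^ 2 < ε :=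
        ⟨ε / (t ^ 2 + 1), by positivity, by
          rw [div_mul_eq_mul_div, div_lt_iff₀ (by positivity)]; nlinarith⟩
      have hb : Tendsto (fun T => η * t ^ 2 * ∑ i, ∫ y, f T i y ^ 2 ∂(P T i)
          + (1 / η + 1) * t ^ 4 * ∑ i, ∫ y, f T i y ^ 4 ∂(P T i)) l (𝓝 (η * t ^ 2)) := by
        simpa using (hvar.const_mul (η * t ^ 2)).add (hlyap.const_mul ((1 / η + 1) * t ^ 4))
      filter_upwards [hb.eventually_lt_const hηε, h2, h4, h0] with T hT h2 h4 h0
      rw [dist_zero_right, norm_norm]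
      refine lt_of_le_of_lt ?_ hT
      rw [hQ]
      have hnn : ∀ i, 0 ≤ ∫ y, (t * f T i y) ^ 2 ∂(P T i) := fun i =>
        integral_nonneg fun _ => sq_nonneg _
      refine (norm_prod_sub_prod_le _ _ _ (fun i _ => ?_) fun i _ => ?_).trans ?_
      · refine (norm_integral_le_of_norm_le_const (C := 1) (ae_of_all _ fun y => ?_)).trans_eq ?_
        · rw [Complex.norm_exp_ofReal_mul_I]
        · simp
      · rw [Complex.norm_exp]
        refine Real.exp_le_one_iff.2 ?_
        have : (-((∫ y, (t * f T i y) ^ 2 ∂(P T i) : ℝ) : ℂ) / 2).re =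
            -(∫ y, (t * f T i y) ^ 2 ∂(P T i)) / 2 := by
          rw [← Complex.ofReal_neg, Complex.div_ofNat_re, Complex.ofReal_re]
        rw [this]
        linarith [hnn i]
      · rw [Finset.mul_sum, Finset.mul_sum, ← Finset.sum_add_distrib]
        refine Finset.sum_le_sum fun i _ => ?_
        have h := norm_integral_exp_sub_exp_le (μ := P T i) (Y := fun y => t * f T i y)
          ((h2 i).const_mul t) (by simp_rw [mul_pow]; exact (h4 i).const_mul _)
          (by rw [integral_const_mul, h0 i, mul_zero]) hη
        refine h.trans_eq ?_
        simp_rw [mul_pow, integral_const_mul]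
        ring
    simpa using hdiff.add hlim
  -- Lévy's continuity theorem is applied along sequences, which suffice since `l` is countably
  -- generated.
  refine tendsto_of_seq_tendsto fun u hu => ?_
  let γ : ProbabilityMeasure ℝ := ⟨gaussianReal 0 1, inferInstance⟩
  have hseq : Tendsto (fun j => Q (u j)) atTop (𝓝 γ) :=
    ProbabilityMeasure.tendsto_of_tendsto_charFun fun t => (hchar t).comp hu
  rw [ProbabilityMeasure.tendsto_iff_forall_integral_tendsto] at hseq
  refine (hseq g).congr fun j => ?_
  exact integral_map (hmeas (u j)).aemeasurable (by fun_prop)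

/-! ### Local asymptotic normality for arrays of compound Poisson increments -/

/-- The joint law of independent compound Poisson increments with means `x i`. -/
def incrementLaw {n : ℕ} (x : Fin n → ℝ) : Measure (Fin n → ℤ) :=
  Measure.pi fun i => compoundLaw (x i)

instance {n : ℕ} (x : Fin n → ℝ) : IsProbabilityMeasure (incrementLaw x) := by
  rw [incrementLaw]; infer_instance

lemma memLp_two_mul_logScore {x : ℝ} (hx : 0 < x) (c : ℝ) :
    MemLp (fun k : ℤ => c * logScore k.natAbs x) 2 (compoundLaw x) := by
  rw [memLp_two_iff_integrable_sq .of_discrete]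
  simp_rw [mul_pow]
  exact (integrable_logScore_pow hx 2).const_mul _

/-- The remainder in the quadratic expansion of the log-likelihood ratio. -/
def lanRemainder {n : ℕ} (x a δ : Fin n → ℝ) (h v : ℝ) (k : Fin n → ℤ) : ℝ :=
  ∑ i, (logWeight (k i).natAbs (x i * Real.exp (δ i)) - logWeight (k i).natAbs (x i))
    - h * ∑ i, a i * logScore (k i).natAbs (x i) + v ^ 2 / 2

section Remainder

variable {n : ℕ} {x a δ : Fin n → ℝ}

/-- The third-order Taylor remainder of one log-likelihood ratio. -/
def taylorRemainder (x δ : ℝ) (k : ℤ) : ℝ :=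
  logWeight k.natAbs (x * Real.exp δ) - logWeight k.natAbs x - logScore k.natAbs x * δ
      - logScoreDer k.natAbs x * δ ^ 2 / 2

lemma integrable_taylorRemainder {x δ : ℝ} (hx : 0 < x) (hδ : |δ| ≤ 1) :
    Integrable (taylorRemainder x δ) (compoundLaw x) :=
  (((integrable_scoreBound₂ hx).const_mul 720).mul_const (|δ| ^ 3)).mono' .of_discrete
    (ae_of_all _ fun _ => abs_logWeight_sub_taylor_le _ hx hδ)

lemma integral_abs_taylorRemainder_le {x δ : ℝ} (hx : 0 < x) (hδ : |δ| ≤ 1) :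
    ∫ k, |taylorRemainder x δ k| ∂(compoundLaw x) ≤
      720 * |δ| ^ 3 * ∫ k : ℤ, scoreBound₂ k.natAbs x ∂(compoundLaw x) := by
  rw [← integral_const_mul]
  refine integral_mono (integrable_taylorRemainder hx hδ).abs
    ((integrable_scoreBound₂ hx).const_mul _) fun k => ?_
  exact (abs_logWeight_sub_taylor_le _ hx hδ).trans_eq (by ring)

/-- Insert the second-order Taylor polynomial and centre its quadratic coefficient, whose mean is
minus the information. The first two sums have independent centred terms, and the last bracket is
deterministic. -/
lemma lanRemainder_eq (h v : ℝ) (k : Fin n → ℤ) : lanRemainder x a δ h v k =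
    ∑ i, (δ i - h * a i) * logScore (k i).natAbs (x i)
    + ∑ i, δ i ^ 2 / 2 * (logScoreDer (k i).natAbs (x i) + scoreInfo (x i))
    + ∑ i, taylorRemainder (x i) (δ i) (k i)
    + (v ^ 2 / 2 - (∑ i, scoreInfo (x i) * δ i ^ 2) / 2) := by
  rw [lanRemainder, Finset.mul_sum, Finset.sum_div, ← Finset.sum_sub_distrib,
    ← Finset.sum_add_distrib, ← Finset.sum_add_distrib, add_sub_left_comm, add_comm,
    ← Finset.sum_sub_distrib]
  congr 1
  refine Finset.sum_congr rfl fun i _ => ?_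
  rw [taylorRemainder]
  ring

lemma memLp_two_logScoreDer_add {x : ℝ} (hx : 0 < x) (c : ℝ) :
    MemLp (fun k : ℤ => c * (logScoreDer k.natAbs x + scoreInfo x)) 2 (compoundLaw x) := by
  have h1 : MemLp (fun k : ℤ => logScoreDer k.natAbs x) 2 (compoundLaw x) := by
    rw [memLp_two_iff_integrable_sq .of_discrete]
    exact integrable_logScoreDer_pow hx 2
  have h2 : MemLp (fun _ : ℤ => scoreInfo x) 2 (compoundLaw x) := memLp_const _
  have h3 : MemLp (fun k : ℤ => logScoreDer k.natAbs x + scoreInfo x) 2 (compoundLaw x) :=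
    h1.add h2
  exact h3.const_mul c

lemma integral_sq_logScoreDer_add_le {x : ℝ} (hx : 0 < x) :
    ∫ k : ℤ, (logScoreDer k.natAbs x + scoreInfo x) ^ 2 ∂(compoundLaw x) ≤
      ∫ k : ℤ, logScoreDer k.natAbs x ^ 2 ∂(compoundLaw x) := by
  have i1 := integrable_logScoreDer_pow hx 2
  have i2 := (integrable_logScoreDer hx).const_mul (2 * scoreInfo x)
  have e : ∀ k : ℤ, (logScoreDer k.natAbs x + scoreInfo x) ^ 2 = logScoreDer k.natAbs x ^ 2
      + 2 * scoreInfo x * logScoreDer k.natAbs x + scoreInfo x ^ 2 := fun k => by ring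
  have i3 : Integrable (fun k : ℤ => logScoreDer k.natAbs x ^ 2
      + 2 * scoreInfo x * logScoreDer k.natAbs x) (compoundLaw x) := i1.add i2
  simp_rw [e]
  rw [integral_add i3 (integrable_const _), integral_add i1 i2, integral_const_mul,
    integral_logScoreDer hx, integral_const, probReal_univ, one_smul]
  nlinarith [sq_nonneg (scoreInfo x)]

lemma integrable_lanRemainder (hx : ∀ i, 0 < x i) (hδ : ∀ i, |δ i| ≤ 1) (h v : ℝ) :
    Integrable (lanRemainder x a δ h v) (incrementLaw x) := by
  rw [show lanRemainder x a δ h v = _ from funext (lanRemainder_eq h v)]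
  have hsum : ∀ f : Fin n → ℤ → ℝ, (∀ i, Integrable (f i) (compoundLaw (x i))) →
      Integrable (fun k : Fin n → ℤ => ∑ i, f i (k i)) (incrementLaw x) := fun f hf =>
    integrable_finsetSum _ fun i _ => integrable_pi_eval i (hf i)
  have j₁ := hsum (fun i k => (δ i - h * a i) * logScore k.natAbs (x i)) fun i =>
    (memLp_two_mul_logScore (hx i) _).integrable one_le_two
  have j₂ := hsum (fun i k => δ i ^ 2 / 2 * (logScoreDer k.natAbs (x i) + scoreInfo (x i)))
    fun i => (memLp_two_logScoreDer_add (hx i) _).integrable one_le_two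
  have j₃ := hsum (fun i k => taylorRemainder (x i) (δ i) k) fun i =>
    integrable_taylorRemainder (hx i) (hδ i)
  exact ((j₁.add j₂).add j₃).add (integrable_const _)

/-- The two centred sums are estimated in `L²`, where variances add; the Taylor remainders are
simply summed in `L¹`. -/
lemma integral_abs_lanRemainder_le (hx : ∀ i, 0 < x i) (hδ : ∀ i, |δ i| ≤ 1) (h v : ℝ) :
    ∫ k, |lanRemainder x a δ h v k| ∂(incrementLaw x) ≤
      √(∑ i, (δ i - h * a i) ^ 2 * scoreInfo (x i))
      + √(∑ i, δ i ^ 4 * ∫ k : ℤ, logScoreDer k.natAbs (x i) ^ 2 ∂(compoundLaw (x i)))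
      + ∑ i, 720 * |δ i| ^ 3 * ∫ k : ℤ, scoreBound₂ k.natAbs (x i) ∂(compoundLaw (x i))
      + |v ^ 2 / 2 - (∑ i, scoreInfo (x i) * δ i ^ 2) / 2| := by
  set f₁ : Fin n → ℤ → ℝ := fun i k => (δ i - h * a i) * logScore k.natAbs (x i) with hf₁
  set f₂ : Fin n → ℤ → ℝ := fun i k => δ i ^ 2 / 2 *
    (logScoreDer k.natAbs (x i) + scoreInfo (x i)) with hf₂
  set f₃ : Fin n → ℤ → ℝ := fun i k => taylorRemainder (x i) (δ i) k with hf₃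
  set c : ℝ := v ^ 2 / 2 - (∑ i, scoreInfo (x i) * δ i ^ 2) / 2
  have m₁ : ∀ i, MemLp (f₁ i) 2 (compoundLaw (x i)) := fun i => memLp_two_mul_logScore (hx i) _
  have m₂ : ∀ i, MemLp (f₂ i) 2 (compoundLaw (x i)) := fun i => memLp_two_logScoreDer_add (hx i) _
  have m₃ : ∀ i, Integrable (f₃ i) (compoundLaw (x i)) := fun i =>
    integrable_taylorRemainder (hx i) (hδ i)
  have j₁ : Integrable (fun k : Fin n → ℤ => |∑ i, f₁ i (k i)|) (incrementLaw x) :=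
    (integrable_finsetSum _ fun i _ => integrable_pi_eval i ((m₁ i).integrable one_le_two)).abs
  have j₂ : Integrable (fun k : Fin n → ℤ => |∑ i, f₂ i (k i)|) (incrementLaw x) :=
    (integrable_finsetSum _ fun i _ => integrable_pi_eval i ((m₂ i).integrable one_le_two)).abs
  have j₃ : Integrable (fun k : Fin n → ℤ => |∑ i, f₃ i (k i)|) (incrementLaw x) :=
    (integrable_finsetSum _ fun i _ => integrable_pi_eval i (m₃ i)).abs
  have hpt : ∀ k, |lanRemainder x a δ h v k| ≤
      |∑ i, f₁ i (k i)| + |∑ i, f₂ i (k i)| + |∑ i, f₃ i (k i)| + |c| := by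
    intro k
    rw [lanRemainder_eq]
    exact (abs_add_le _ _).trans (add_le_add_left ((abs_add_le _ _).trans
      (add_le_add_left (abs_add_le _ _) _)) _)
  have j₁₂ : Integrable (fun k : Fin n → ℤ => |∑ i, f₁ i (k i)| + |∑ i, f₂ i (k i)|)
    (incrementLaw x) := j₁.add j₂
  have j₁₂₃ : Integrable (fun k : Fin n → ℤ => |∑ i, f₁ i (k i)| + |∑ i, f₂ i (k i)|
    + |∑ i, f₃ i (k i)|) (incrementLaw x) := j₁₂.add j₃
  refine (integral_mono (integrable_lanRemainder hx hδ h v).abs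
    (j₁₂₃.add (integrable_const |c|)) hpt).trans ?_
  rw [integral_add' j₁₂₃ (integrable_const _), integral_add j₁₂ j₃, integral_add j₁ j₂,
    integral_const, probReal_univ, one_smul]
  have b₁ : ∫ k, |∑ i, f₁ i (k i)| ∂(incrementLaw x) ≤
      √(∑ i, (δ i - h * a i) ^ 2 * scoreInfo (x i)) := by
    refine (integral_abs_sum_pi_le m₁ fun i => ?_).trans_eq ?_
    · simp only [hf₁]
      rw [integral_const_mul, integral_logScore (hx i), mul_zero]
    · simp only [hf₁, mul_pow, integral_const_mul]
      rfl
  have b₂ : ∫ k, |∑ i, f₂ i (k i)| ∂(incrementLaw x) ≤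
      √(∑ i, δ i ^ 4 * ∫ k : ℤ, logScoreDer k.natAbs (x i) ^ 2 ∂(compoundLaw (x i))) := by
    refine (integral_abs_sum_pi_le m₂ fun i => ?_).trans
      (Real.sqrt_le_sqrt (Finset.sum_le_sum fun i _ => ?_))
    · simp only [hf₂]
      rw [integral_const_mul, integral_add (integrable_logScoreDer (hx i)) (integrable_const _),
        integral_logScoreDer (hx i)]
      simp
    · simp only [hf₂, mul_pow, integral_const_mul]
      have h1 := integral_sq_logScoreDer_add_le (hx i)
      have h2 : 0 ≤ ∫ k : ℤ, logScoreDer k.natAbs (x i) ^ 2 ∂(compoundLaw (x i)) :=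
        integral_nonneg fun _ => sq_nonneg _
      have h3 : (δ i ^ 2 / 2) ^ 2 ≤ δ i ^ 4 := by
        have : 0 ≤ δ i ^ 4 := by positivity
        calc (δ i ^ 2 / 2) ^ 2 = δ i ^ 4 / 4 := by ring
          _ ≤ _ := by linarith
      exact mul_le_mul h3 h1 (integral_nonneg fun _ => sq_nonneg _) (by positivity)
  have b₃ : ∫ k, |∑ i, f₃ i (k i)| ∂(incrementLaw x) ≤
      ∑ i, 720 * |δ i| ^ 3 * ∫ k : ℤ, scoreBound₂ k.natAbs (x i) ∂(compoundLaw (x i)) :=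
    (integral_abs_sum_pi_le_sum m₃).trans (Finset.sum_le_sum fun i _ =>
      integral_abs_taylorRemainder_le (hx i) (hδ i))
  gcongr

end Remainder

section Array

variable {κ : Type*} {l : Filter κ} {n : κ → ℕ} {x a δ : ∀ T, Fin (n T) → ℝ} {J : κ → ℝ}
  {K C v : ℝ}

lemma tendsto_const_div_sqrt (hJ : Tendsto J l atTop) (v : ℝ) :
    Tendsto (fun T => v / √(J T)) l (𝓝 0) :=
  tendsto_const_nhds.div_atTop (Real.tendsto_sqrt_atTop.comp hJ)

/-- With `δ = O(J^{-1/2})` and `∑ min 1 x_i = O(J)`, the sum `∑ δ⁴ E[D²]` is `O(J^{-1})` and the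
cubic remainder is `O(J^{-1/2})`. The linear error is exactly `hdiff`, and the deterministic term
vanishes because `∑ G δ² → v²`. -/
theorem tendsto_integral_abs_lanRemainder (hK : 0 ≤ K) (hx : ∀ᶠ T in l, ∀ i, 0 < x T i)
    (hJ : Tendsto J l atTop) (hm : ∀ᶠ T in l, ∑ i, min 1 (x T i) ≤ C * J T)
    (hδ : ∀ᶠ T in l, ∀ i, |δ T i| ≤ K * |v / √(J T)|)
    (hinfo : Tendsto (fun T => (J T)⁻¹ * ∑ i, scoreInfo (x T i) * a T i ^ 2) l (𝓝 1))
    (hdiff : Tendsto (fun T => ∑ i, min 1 (x T i) * (δ T i - v / √(J T) * a T i) ^ 2) l (𝓝 0)) :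
    Tendsto (fun T => ∫ k, |lanRemainder (x T) (a T) (δ T) (v / √(J T)) v k|
      ∂(incrementLaw (x T))) l (𝓝 0) := by
  obtain ⟨B, hB, hmom⟩ := exists_score_moment_bound
  set h : κ → ℝ := fun T => v / √(J T) with hh
  have hh0 : Tendsto h l (𝓝 0) := tendsto_const_div_sqrt hJ v
  have hhJ : ∀ᶠ T in l, h T ^ 2 = v ^ 2 * (J T)⁻¹ := by
    filter_upwards [hJ.eventually_gt_atTop 0] with T hT
    simp only [hh]
    rw [div_pow, Real.sq_sqrt hT.le, div_eq_mul_inv]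
  have hδ1 : ∀ᶠ T in l, ∀ i, |δ T i| ≤ 1 := by
    have h1 : Tendsto (fun T => K * |h T|) l (𝓝 0) := by
      simpa using (hh0.abs.const_mul K)
    filter_upwards [hδ, h1.eventually_le_const (show (0 : ℝ) < 1 by norm_num)] with T h2 h3 i
    exact (h2 i).trans h3
  have hG : ∀ᶠ T in l, ∀ i, scoreInfo (x T i) ≤ B * min 1 (x T i) :=
    hx.mono fun T hT i => (hmom _ (hT i)).1
  -- the linear term
  have t1 : Tendsto (fun T => ∑ i, (δ T i - h T * a T i) ^ 2 * scoreInfo (x T i)) l (𝓝 0) := by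
    have hb := hdiff.const_mul B
    rw [mul_zero] at hb
    refine squeeze_zero' (Eventually.of_forall fun T => Finset.sum_nonneg fun i _ =>
      mul_nonneg (sq_nonneg _) (scoreInfo_nonneg _)) ?_ hb
    filter_upwards [hG] with T hT
    rw [Finset.mul_sum]
    refine Finset.sum_le_sum fun i _ => ?_
    calc _ ≤ (δ T i - h T * a T i) ^ 2 * (B * min 1 (x T i)) := by
          gcongr; exact hT i
      _ = _ := by ring
  -- the fluctuation of the quadratic term
  have t2 : Tendsto (fun T => ∑ i, δ T i ^ 4 *
      ∫ k : ℤ, logScoreDer k.natAbs (x T i) ^ 2 ∂(compoundLaw (x T i))) l (𝓝 0) := by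
    have hb : Tendsto (fun T => K ^ 4 * v ^ 2 * B * C * h T ^ 2) l (𝓝 0) := by
      simpa using (hh0.pow 2).const_mul (K ^ 4 * v ^ 2 * B * C)
    refine squeeze_zero' (Eventually.of_forall fun T => Finset.sum_nonneg fun i _ =>
      mul_nonneg (by positivity) (integral_nonneg fun _ => sq_nonneg _)) ?_ hb
    filter_upwards [hx, hm, hδ, hhJ, hJ.eventually_gt_atTop 0] with T hx hm hδ hhJ hJ0
    calc _ ≤ ∑ i, K ^ 4 * h T ^ 4 * (B * min 1 (x T i)) := by
          refine Finset.sum_le_sum fun i _ => ?_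
          have h1 : δ T i ^ 4 ≤ K ^ 4 * h T ^ 4 := by
            have e1 : δ T i ^ 4 = |δ T i| ^ 4 := by
              rw [← abs_pow, abs_of_nonneg (Even.pow_nonneg (by decide) _)]
            have e2 : h T ^ 4 = |h T| ^ 4 := by
              rw [← abs_pow, abs_of_nonneg (Even.pow_nonneg (by decide) _)]
            rw [e1, e2, ← mul_pow]
            exact pow_le_pow_left₀ (abs_nonneg _) (hδ i) 4
          exact mul_le_mul h1 (hmom _ (hx i)).2.2.1 (integral_nonneg fun _ => sq_nonneg _)
            (by positivity)
      _ = K ^ 4 * h T ^ 4 * B * ∑ i, min 1 (x T i) := by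
          rw [Finset.mul_sum]; exact Finset.sum_congr rfl fun i _ => by ring
      _ ≤ K ^ 4 * h T ^ 4 * B * (C * J T) := by gcongr
      _ = K ^ 4 * (h T ^ 2) * (h T ^ 2) * B * (C * J T) := by ring
      _ = _ := by nth_rewrite 1 [hhJ]; field_simp
  -- the Taylor remainder
  have t3 : Tendsto (fun T => ∑ i, 720 * |δ T i| ^ 3 *
      ∫ k : ℤ, scoreBound₂ k.natAbs (x T i) ∂(compoundLaw (x T i))) l (𝓝 0) := by
    have hb : Tendsto (fun T => 720 * K ^ 3 * v ^ 2 * B * C * |h T|) l (𝓝 0) := by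
      simpa using hh0.abs.const_mul (720 * K ^ 3 * v ^ 2 * B * C)
    have hnn : ∀ T, (∀ i, 0 < x T i) → ∀ i,
        0 ≤ ∫ k : ℤ, scoreBound₂ k.natAbs (x T i) ∂(compoundLaw (x T i)) := fun T hT i =>
      integral_nonneg fun k => scoreBound₂_nonneg _ (hT i)
    refine squeeze_zero' (hx.mono fun T hT => Finset.sum_nonneg fun i _ =>
      mul_nonneg (by positivity) (hnn T hT i)) ?_ hb
    filter_upwards [hx, hm, hδ, hhJ, hJ.eventually_gt_atTop 0] with T hx hm hδ hhJ hJ0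
    have hKh : 0 ≤ K * |h T| := by positivity
    calc _ ≤ ∑ i, 720 * (K * |h T|) ^ 3 * (B * min 1 (x T i)) := by
          refine Finset.sum_le_sum fun i _ => ?_
          have h1 : |δ T i| ^ 3 ≤ (K * |h T|) ^ 3 := pow_le_pow_left₀ (abs_nonneg _) (hδ i) 3
          exact mul_le_mul (by gcongr) (hmom _ (hx i)).2.2.2 (hnn T hx i) (by positivity)
      _ = 720 * (K * |h T|) ^ 3 * B * ∑ i, min 1 (x T i) := by
          rw [Finset.mul_sum]; exact Finset.sum_congr rfl fun i _ => by ring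
      _ ≤ 720 * (K * |h T|) ^ 3 * B * (C * J T) := by gcongr
      _ = 720 * K ^ 3 * |h T| ^ 2 * |h T| * B * (C * J T) := by ring
      _ = _ := by rw [sq_abs, hhJ]; field_simp
  -- the mean of the quadratic term
  have t4 : Tendsto (fun T => ∑ i, scoreInfo (x T i) * δ T i ^ 2) l (𝓝 (v ^ 2)) := by
    have e : ∀ T, ∑ i, scoreInfo (x T i) * δ T i ^ 2 =
        ∑ i, (δ T i - h T * a T i) ^ 2 * scoreInfo (x T i)
        + 2 * ∑ i, (scoreInfo (x T i) * (δ T i - h T * a T i)) * (h T * a T i)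
        + h T ^ 2 * ∑ i, scoreInfo (x T i) * a T i ^ 2 := by
      intro T
      rw [Finset.mul_sum, Finset.mul_sum, ← Finset.sum_add_distrib, ← Finset.sum_add_distrib]
      exact Finset.sum_congr rfl fun i _ => by ring
    have hA : Tendsto (fun T => h T ^ 2 * ∑ i, scoreInfo (x T i) * a T i ^ 2) l (𝓝 (v ^ 2)) := by
      have := hinfo.const_mul (v ^ 2)
      rw [mul_one] at this
      refine this.congr' ?_
      filter_upwards [hhJ] with T hT
      rw [hT, mul_assoc]
    have hB : Tendsto (fun T => ∑ i, (scoreInfo (x T i) * (δ T i - h T * a T i)) * (h T * a T i))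
        l (𝓝 0) := by
      -- Cauchy–Schwarz with weights `G(x_i)`: the cross term is controlled by the linear error,
      -- which vanishes, times the main term, which converges.
      have hsq : ∀ T, (∑ i, (scoreInfo (x T i) * (δ T i - h T * a T i)) * (h T * a T i)) ^ 2 ≤
          (∑ i, (δ T i - h T * a T i) ^ 2 * scoreInfo (x T i))
            * (h T ^ 2 * ∑ i, scoreInfo (x T i) * a T i ^ 2) := by
        intro T
        have hcs := Finset.sum_mul_sq_le_sq_mul_sq Finset.univ
          (fun i => √(scoreInfo (x T i)) * (δ T i - h T * a T i))
          (fun i => √(scoreInfo (x T i)) * (h T * a T i))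
        have hs : ∀ i, √(scoreInfo (x T i)) ^ 2 = scoreInfo (x T i) := fun i =>
          Real.sq_sqrt (scoreInfo_nonneg _)
        refine le_trans (le_of_eq ?_) (hcs.trans_eq ?_)
        · congr 1
          refine Finset.sum_congr rfl fun i _ => ?_
          nth_rewrite 1 [← hs i]
          ring
        · congr 1
          · refine Finset.sum_congr rfl fun i _ => ?_
            rw [mul_pow, hs i, mul_comm]
          · rw [Finset.mul_sum]
            refine Finset.sum_congr rfl fun i _ => ?_
            rw [mul_pow, hs i]
            ring
      have hz : Tendsto (fun T => (∑ i, (scoreInfo (x T i) * (δ T i - h T * a T i))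
          * (h T * a T i)) ^ 2) l (𝓝 0) := by
        refine squeeze_zero (fun T => sq_nonneg _) hsq ?_
        simpa using t1.mul hA
      have := hz.sqrt
      simp only [Real.sqrt_sq_eq_abs, Real.sqrt_zero] at this
      exact (tendsto_zero_iff_abs_tendsto_zero _).2 this
    simp_rw [e]
    simpa using (t1.add (hB.const_mul 2)).add hA
  have t5 : Tendsto (fun T => |v ^ 2 / 2 - (∑ i, scoreInfo (x T i) * δ T i ^ 2) / 2|) l (𝓝 0) := by
    have := ((tendsto_const_nhds (x := v ^ 2 / 2)).sub (t4.div_const 2)).abs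
    rwa [sub_self, abs_zero] at this
  have ht := ((t1.sqrt.add t2.sqrt).add t3).add t5
  simp only [Real.sqrt_zero, add_zero] at ht
  refine squeeze_zero' (Eventually.of_forall fun T => integral_nonneg fun _ => abs_nonneg _) ?_ ht
  filter_upwards [hx, hδ1] with T hx hδ1
  exact integral_abs_lanRemainder_le hx hδ1 _ _

/-- Markov's inequality; the bound `|δ| ≤ 1`, needed for integrability, holds eventually since `J →
∞`. -/
theorem tendsto_measure_lanRemainder (hK : 0 ≤ K) (hx : ∀ᶠ T in l, ∀ i, 0 < x T i)
    (hJ : Tendsto J l atTop) (hm : ∀ᶠ T in l, ∑ i, min 1 (x T i) ≤ C * J T)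
    (hδ : ∀ᶠ T in l, ∀ i, |δ T i| ≤ K * |v / √(J T)|)
    (hinfo : Tendsto (fun T => (J T)⁻¹ * ∑ i, scoreInfo (x T i) * a T i ^ 2) l (𝓝 1))
    (hdiff : Tendsto (fun T => ∑ i, min 1 (x T i) * (δ T i - v / √(J T) * a T i) ^ 2) l (𝓝 0))
    {η : ℝ} (hη : 0 < η) :
    Tendsto (fun T => incrementLaw (x T)
      {k | η ≤ |lanRemainder (x T) (a T) (δ T) (v / √(J T)) v k|}) l (𝓝 0) := by
  have h := tendsto_integral_abs_lanRemainder hK hx hJ hm hδ hinfo hdiff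
  have hδ1 : ∀ᶠ T in l, ∀ i, |δ T i| ≤ 1 := by
    have h1 : Tendsto (fun T => K * |v / √(J T)|) l (𝓝 0) := by
      simpa using ((tendsto_const_div_sqrt hJ v).abs.const_mul K)
    filter_upwards [hδ, h1.eventually_le_const (show (0 : ℝ) < 1 by norm_num)] with T h2 h3 i
    exact (h2 i).trans h3
  have h2 := ENNReal.tendsto_ofReal (h.div_const η)
  rw [zero_div, ENNReal.ofReal_zero] at h2
  refine tendsto_of_tendsto_of_tendsto_of_le_of_le' tendsto_const_nhds h2
    (Eventually.of_forall fun T => bot_le) ?_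
  filter_upwards [hx, hδ1] with T hx hδ1
  have h3 := mul_meas_ge_le_integral_of_nonneg (μ := incrementLaw (x T))
    (ae_of_all _ fun k => abs_nonneg (lanRemainder (x T) (a T) (δ T) (v / √(J T)) v k))
    (integrable_lanRemainder hx hδ1 _ _).abs η
  rw [← ENNReal.ofReal_toReal (measure_ne_top (incrementLaw (x T)) _)]
  refine ENNReal.ofReal_le_ofReal ?_
  rw [le_div_iff₀ hη, mul_comm]
  exact h3

/-- The central sequence is asymptotically standard normal. -/
theorem tendsto_integral_centralSequence [l.IsCountablyGenerated]
    (hx : ∀ᶠ T in l, ∀ i, 0 < x T i)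
    (hJ : Tendsto J l atTop) (hm : ∀ᶠ T in l, ∑ i, min 1 (x T i) ≤ C * J T)
    (ha : ∀ᶠ T in l, ∀ i, |a T i| ≤ K)
    (hinfo : Tendsto (fun T => (J T)⁻¹ * ∑ i, scoreInfo (x T i) * a T i ^ 2) l (𝓝 1))
    (g : BoundedContinuousFunction ℝ ℝ) :
    Tendsto (fun T => ∫ k, g ((√(J T))⁻¹ * ∑ i, a T i * logScore (k i).natAbs (x T i))
      ∂(incrementLaw (x T))) l (𝓝 (∫ y, g y ∂(gaussianReal 0 1))) := by
  obtain ⟨B, hB, hmom⟩ := exists_score_moment_bound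
  have hsq : ∀ᶠ T in l, ((√(J T))⁻¹) ^ 2 = (J T)⁻¹ := by
    filter_upwards [hJ.eventually_gt_atTop 0] with T hT
    rw [inv_pow, Real.sq_sqrt hT.le]
  have key := tendsto_integral_sum_pi_gaussian (l := l)
    (P := fun T i => compoundLaw (x T i))
    (f := fun T i (k : ℤ) => ((√(J T))⁻¹ * a T i) * logScore k.natAbs (x T i))
    (fun T i => .of_discrete)
    (hx.mono fun T hT i => memLp_two_mul_logScore (hT i) _)
    (hx.mono fun T hT i => by
      simp_rw [mul_pow]; exact (integrable_logScore_pow (hT i) 4).const_mul _)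
    (hx.mono fun T hT i => by
      rw [integral_const_mul, integral_logScore (hT i), mul_zero]) ?_ ?_ g
  · refine key.congr fun T => ?_
    simp_rw [Finset.mul_sum, mul_assoc]
    rfl
  · refine hinfo.congr' ?_
    filter_upwards [hsq] with T hT
    rw [Finset.mul_sum]
    refine Finset.sum_congr rfl fun i _ => ?_
    simp_rw [mul_pow, integral_const_mul, hT]
    rw [scoreInfo]
    ring
  -- Lyapunov condition: the fourth moments carry a factor `J^{-2}` and sum to `O(J)`.
  · have hb : Tendsto (fun T => K ^ 4 * B * C * (J T)⁻¹) l (𝓝 0) := by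
      simpa using (tendsto_inv_atTop_zero.comp hJ).const_mul (K ^ 4 * B * C)
    refine squeeze_zero' (Eventually.of_forall fun T => Finset.sum_nonneg fun i _ =>
      integral_nonneg fun _ => Even.pow_nonneg (by decide) _) ?_ hb
    filter_upwards [hx, hm, ha, hsq, hJ.eventually_gt_atTop 0] with T hx hm ha hsq hJ0
    calc _ ≤ ∑ i, (J T)⁻¹ ^ 2 * K ^ 4 * (B * min 1 (x T i)) := by
          refine Finset.sum_le_sum fun i _ => ?_
          simp_rw [mul_pow, integral_const_mul]
          have h1 : a T i ^ 4 ≤ K ^ 4 := by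
            have e1 : a T i ^ 4 = |a T i| ^ 4 := by
              rw [← abs_pow, abs_of_nonneg (Even.pow_nonneg (by decide) _)]
            rw [e1]
            exact pow_le_pow_left₀ (abs_nonneg _) (ha i) 4
          have h2 : (√(J T))⁻¹ ^ 4 = (J T)⁻¹ ^ 2 := by rw [← hsq]; ring
          rw [h2]
          exact mul_le_mul (by gcongr) (hmom _ (hx i)).2.1
            (integral_nonneg fun _ => Even.pow_nonneg (by decide) _) (by positivity)
      _ = (J T)⁻¹ ^ 2 * K ^ 4 * B * ∑ i, min 1 (x T i) := by
          rw [Finset.mul_sum]; exact Finset.sum_congr rfl fun i _ => by ring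
      _ ≤ (J T)⁻¹ ^ 2 * K ^ 4 * B * (C * J T) := by gcongr
      _ = _ := by field_simp

end Array

/-! ### The law of the increments of the observed process -/

/-- Fubini for a product of one-variable functions, expressed as independence of the coordinates and
then read as sums over a countable space. -/
lemma tsum_prod_fin {n : ℕ} (p : Fin n → Measure ℕ) [∀ i, IsProbabilityMeasure (p i)]
    (g : Fin n → ℕ → ℝ≥0∞) :
    ∑' m : Fin n → ℕ, (∏ i, g i (m i)) * ∏ i, p i {m i} = ∏ i, ∑' j, g i j * p i {j} := by
  have h1 : lintegral (Measure.pi p) (fun m : Fin n → ℕ => ∏ i, g i (m i)) =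
      ∏ i, lintegral (Measure.pi p) (fun m : Fin n → ℕ => g i (m i)) :=
    lintegral_prod_eq_prod_lintegral_of_indepFun Finset.univ (fun i (m : Fin n → ℕ) => g i (m i))
      (iIndepFun_pi (X := g) fun i => .of_discrete)
      fun i => (Measurable.of_discrete (f := g i)).comp (measurable_pi_apply i)
  rw [lintegral_countable'] at h1
  simp_rw [Measure.pi_singleton] at h1
  rw [h1]
  refine Finset.prod_congr rfl fun i _ => ?_
  rw [← lintegral_countable', ← (measurePreserving_eval p i).map_eq,
    lintegral_map .of_discrete (measurable_pi_apply i)]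

section Model

variable {Ω : Type*} [MeasurableSpace Ω] {μ : Measure Ω}

/-- Sums over consecutive blocks of independent signs are independent. -/
lemma map_blockSum {ε : ℕ → Ω → ℤ} (hm : ∀ i, Measurable (ε i))
    (hlaw : ∀ i, μ.map (ε i) = signLaw) (hind : iIndepFun ε μ) {n : ℕ} (m : Fin n → ℕ) :
    μ.map (fun ω i => ∑ j : Fin (m i), ε (finSigmaFinEquiv ⟨i, j⟩ : Fin (∑ i, m i)) ω) =
      Measure.pi fun i => signSumLaw (m i) := by
  have := hind.isProbabilityMeasure
  -- Numbering the pairs (block, position) consecutively uses each sign at most once, so the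
  -- reindexed family stays i.i.d.; currying its law then groups it into blocks.
  let g : ((i : Fin n) × Fin (m i)) → ℕ := fun p => (finSigmaFinEquiv p : Fin (∑ i, m i))
  have hg : Function.Injective g := Fin.val_injective.comp finSigmaFinEquiv.injective
  have h1 : μ.map (fun ω p => ε (g p) ω) =
      Measure.infinitePi fun _ : (i : Fin n) × Fin (m i) => signLaw := by
    rw [(iIndepFun_iff_map_fun_eq_infinitePi_map (fun p => hm (g p))).1 (hind.precomp hg)]
    simp_rw [hlaw]
  have h2 : μ.map (fun ω i j => ε (g ⟨i, j⟩) ω) =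
      Measure.pi fun i : Fin n => Measure.pi fun _ : Fin (m i) => signLaw := by
    have h3 := Measure.infinitePi_map_piCurry (X := fun (i : Fin n) (_ : Fin (m i)) => ℤ)
      (fun (i : Fin n) (_ : Fin (m i)) => signLaw)
    rw [← h1, Measure.map_map (by fun_prop) (measurable_pi_lambda _ fun p => hm (g p))] at h3
    simp_rw [Measure.infinitePi_eq_pi] at h3
    exact h3
  have h4 : (fun ω i => ∑ j : Fin (m i), ε (finSigmaFinEquiv ⟨i, j⟩ : Fin (∑ i, m i)) ω) =
      (fun (y : (i : Fin n) → Fin (m i) → ℤ) i => ∑ j, y i j) ∘ fun ω i j => ε (g ⟨i, j⟩) ω := rfl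
  rw [h4, ← Measure.map_map (by fun_prop) (by fun_prop), h2]
  exact Measure.pi_map_pi fun i => Measurable.aemeasurable (by fun_prop)

/-- A sum with a random number of terms: joint measurability holds because the number of terms lives
in a countable space. -/
lemma measurable_sum_range {N : Ω → ℕ} {ε : ℕ → Ω → ℤ} (hN : Measurable N)
    (hε : ∀ i, Measurable (ε i)) : Measurable fun ω => ∑ i ∈ Finset.range (N ω), ε i ω := by
  have h : Measurable fun p : ℕ × Ω => ∑ i ∈ Finset.range p.1, ε i p.2 :=
    measurable_from_prod_countable_right fun m =>
      Finset.measurable_sum (Finset.range m) fun i _ => hε i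
  exact h.comp (hN.prodMk measurable_id)

variable {T Δ : ℝ} {Λ : ℝ → ℝ} {N : ℝ → Ω → ℕ} {ε : ℕ → Ω → ℤ}

lemma grid_mem_Icc (hT : 0 < T) (hΔ : 0 < Δ) {i : ℕ} (hi : i ≤ ⌊T / Δ⌋₊) :
    (i : ℝ) * Δ ∈ Set.Icc 0 T := by
  refine ⟨by positivity, ?_⟩
  have h1 : (i : ℝ) ≤ T / Δ := (Nat.le_floor_iff (by positivity)).1 hi
  rwa [le_div_iff₀ hΔ] at h1

/-- The successive differences of a finite sequence, the first one being the first term. -/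
def increments {n : ℕ} (x : Fin n → ℤ) (i : Fin n) : ℤ :=
  x i - if h : (i : ℕ) = 0 then 0 else x ⟨i - 1, by omega⟩

/-- The terms are recovered successively from the differences. Hence an observation and its vector
of increments have the same mass, which transfers likelihood ratios. -/
lemma increments_injective (n : ℕ) : Function.Injective (increments (n := n)) := by
  intro x y hxy
  have key : ∀ k : ℕ, ∀ hk : k < n, x ⟨k, hk⟩ = y ⟨k, hk⟩ := by
    intro k
    induction k with
    | zero =>
      intro hk
      have := congrFun hxy ⟨0, hk⟩
      simpa [increments] using this
    | succ k ih =>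
      intro hk
      have := congrFun hxy ⟨k + 1, hk⟩
      simp only [increments, Nat.add_eq_zero_iff, one_ne_zero, and_false, dite_false,
        Nat.add_sub_cancel] at this
      have h2 := ih (by omega)
      omega
  funext i
  exact key i i.2

/-- The mean number of jumps in the successive sampling intervals. -/
def gridMeans (Λ : ℝ → ℝ) (Δ : ℝ) (n : ℕ) (i : Fin n) : ℝ :=
  Λ (((i : ℕ) + 1 : ℝ) * Δ) - Λ ((i : ℕ) * Δ)

namespace IsCompoundPoissonModel

lemma measurable_observation (h : IsCompoundPoissonModel μ T Λ N ε) (hT : 0 < T) (hΔ : 0 < Δ) :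
    Measurable fun ω (i : Fin ⌊T / Δ⌋₊) => compoundProcess N ε (((i : ℕ) + 1 : ℝ) * Δ) ω := by
  refine measurable_pi_lambda _ fun i => measurable_sum_range (h.poisson.measurable _ ?_)
    h.sign_measurable
  have := grid_mem_Icc hT hΔ (i := i + 1) (by omega)
  push_cast at this
  exact this

lemma map_numJumps (h : IsCompoundPoissonModel μ T Λ N ε) (hT : 0 < T) (hΔ : 0 < Δ) :
    μ.map (fun ω (i : Fin ⌊T / Δ⌋₊) => N (((i : ℕ) + 1 : ℝ) * Δ) ω - N ((i : ℕ) * Δ) ω) =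
      Measure.pi fun i => poissonMeasure (gridMeans Λ Δ ⌊T / Δ⌋₊ i).toNNReal := by
  have hmem1 : ∀ i : Fin ⌊T / Δ⌋₊, ((i : ℕ) + 1 : ℝ) * Δ ∈ Set.Icc 0 T := fun i => by
    have := grid_mem_Icc hT hΔ (i := i + 1) (by omega)
    push_cast at this
    exact this
  have hmem0 : ∀ i : Fin ⌊T / Δ⌋₊, ((i : ℕ) : ℝ) * Δ ∈ Set.Icc 0 T := fun i =>
    grid_mem_Icc hT hΔ (by omega)
  have hind := h.poisson.indep ⌊T / Δ⌋₊ (fun i => ⟨(i : ℕ) * Δ, grid_mem_Icc hT hΔ (by omega)⟩)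
    (fun i j hij => by
      refine Subtype.mk_le_mk.2 ?_
      have : ((i : ℕ) : ℝ) ≤ (j : ℕ) := by exact_mod_cast hij
      gcongr)
  simp only [Fin.val_succ, Fin.val_castSucc, Nat.cast_add, Nat.cast_one] at hind
  have hms : ∀ i : Fin ⌊T / Δ⌋₊, Measurable fun ω => N (((i : ℕ) + 1 : ℝ) * Δ) ω - N ((i : ℕ) * Δ) ω :=
    fun i => (h.poisson.measurable _ (hmem1 i)).sub (h.poisson.measurable _ (hmem0 i))
  rw [hind.map_fun_eq_pi_map fun i => (hms i).aemeasurable]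
  congr 1
  funext i
  refine h.poisson.law _ (hmem0 i) _ (hmem1 i) ?_
  gcongr
  linarith

/-- Telescoping; subtraction is truncated in the natural numbers, so monotonicity of the paths is
needed. -/
lemma N_grid_eq (h : IsCompoundPoissonModel μ T Λ N ε) (hT : 0 < T) (hΔ : 0 < Δ) (ω : Ω) {i : ℕ}
    (hi : i ≤ ⌊T / Δ⌋₊) : N (i * Δ) ω = ∑ l : Fin i, (N (((l : ℕ) + 1 : ℝ) * Δ) ω - N ((l : ℕ) * Δ) ω) := by
  induction i with
  | zero => simpa using h.poisson.zero ω
  | succ i ih =>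
    rw [Fin.sum_univ_castSucc]
    simp only [Fin.val_castSucc, Fin.val_last]
    rw [← ih (by omega)]
    have h1 := grid_mem_Icc hT hΔ hi
    have h0 := grid_mem_Icc hT hΔ (show i ≤ ⌊T / Δ⌋₊ by omega)
    have hle : N (i * Δ) ω ≤ N ((i + 1 : ℕ) * Δ) ω := by
      refine h.poisson.monotone ω h0 h1 ?_
      push_cast
      gcongr
      linarith
    push_cast at hle ⊢
    omega

/-- Once the jump counts `m` are fixed, the i-th increment sums the `m i` signs that follow the
first `m 0 + ⋯ + m (i - 1)` ones, which is precisely the consecutive numbering by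
`finSigmaFinEquiv`. -/
lemma increments_observation (h : IsCompoundPoissonModel μ T Λ N ε) (hT : 0 < T) (hΔ : 0 < Δ)
    {m : Fin ⌊T / Δ⌋₊ → ℕ} {ω : Ω}
    (hm : (fun i : Fin ⌊T / Δ⌋₊ => N (((i : ℕ) + 1 : ℝ) * Δ) ω - N ((i : ℕ) * Δ) ω) = m)
    (i : Fin ⌊T / Δ⌋₊) :
    increments (fun i : Fin ⌊T / Δ⌋₊ => compoundProcess N ε (((i : ℕ) + 1 : ℝ) * Δ) ω) i =
      ∑ j : Fin (m i), ε (finSigmaFinEquiv ⟨i, j⟩ : Fin (∑ i, m i)) ω := by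
  have hstep : increments (fun i : Fin ⌊T / Δ⌋₊ => compoundProcess N ε (((i : ℕ) + 1 : ℝ) * Δ) ω) i =
      compoundProcess N ε (((i : ℕ) + 1 : ℝ) * Δ) ω - compoundProcess N ε ((i : ℕ) * Δ) ω := by
    rw [increments]
    congr 1
    split_ifs with h0
    · simp [h0, compoundProcess, h.poisson.zero ω]
    · simp only
      rw [Nat.cast_sub (by omega)]
      congr 2
      push_cast
      ring
  have e0 : N ((i : ℕ) * Δ) ω = ∑ l : Fin (i : ℕ), m (Fin.castLE i.2.le l) := by
    rw [h.N_grid_eq hT hΔ ω i.2.le, ← hm]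
    rfl
  have e1 : N (((i : ℕ) + 1 : ℝ) * Δ) ω = N ((i : ℕ) * Δ) ω + m i := by
    have h1 := h.N_grid_eq hT hΔ ω (i := i + 1) (by omega)
    rw [Fin.sum_univ_castSucc] at h1
    simp only [Fin.val_castSucc, Fin.val_last] at h1
    rw [← h.N_grid_eq hT hΔ ω i.2.le, Nat.cast_add, Nat.cast_one] at h1
    rw [h1, ← hm]
  rw [hstep, compoundProcess, compoundProcess, e1, Finset.sum_range_add, add_sub_cancel_left,
    ← Fin.sum_univ_eq_sum_range (fun x => ε (N ((i : ℕ) * Δ) ω + x) ω)]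
  refine Finset.sum_congr rfl fun j _ => ?_
  rw [finSigmaFinEquiv_apply, e0]

/-- The increments of the observation are independent and compound Poisson. -/
theorem map_increments_observationLaw (h : IsCompoundPoissonModel μ T Λ N ε) (hT : 0 < T)
    (hΔ : 0 < Δ) :
    (observationLaw μ N ε T Δ).map increments = incrementLaw (gridMeans Λ Δ ⌊T / Δ⌋₊) := by
  have := h.isProbabilityMeasure
  set n := ⌊T / Δ⌋₊
  have hobs := h.measurable_observation hT hΔ
  let M : Ω → Fin n → ℕ := fun ω i => N (((i : ℕ) + 1 : ℝ) * Δ) ω - N ((i : ℕ) * Δ) ω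
  let S : (Fin n → ℕ) → Ω → Fin n → ℤ := fun m ω i =>
    ∑ j : Fin (m i), ε (finSigmaFinEquiv ⟨i, j⟩ : Fin (∑ i, m i)) ω
  have hSm : ∀ m, Measurable (S m) := fun m => measurable_pi_lambda _ fun i =>
    Finset.measurable_sum _ fun j _ => h.sign_measurable _
  have hmem1 : ∀ i : Fin n, ((i : ℕ) + 1 : ℝ) * Δ ∈ Set.Icc 0 T := fun i => by
    have := grid_mem_Icc hT hΔ (i := i + 1) (by omega)
    push_cast at this
    exact this
  have hmem0 : ∀ i : Fin n, ((i : ℕ) : ℝ) * Δ ∈ Set.Icc 0 T := fun i =>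
    grid_mem_Icc hT hΔ (by omega)
  have hMm : Measurable M := measurable_pi_lambda _ fun i =>
    (h.poisson.measurable _ (hmem1 i)).sub (h.poisson.measurable _ (hmem0 i))
  have hMlaw : μ.map M = Measure.pi fun i => poissonMeasure (gridMeans Λ Δ n i).toNNReal :=
    h.map_numJumps hT hΔ
  have hind : ∀ m, IndepFun (S m) M μ := fun m => by
    have h1 := h.indep.comp
      (φ := fun (e : ℕ → ℤ) (i : Fin n) =>
        ∑ j : Fin (m i), e (finSigmaFinEquiv ⟨i, j⟩ : Fin (∑ i, m i)))
      (ψ := fun (y : Set.Icc (0 : ℝ) T → ℕ) (i : Fin n) =>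
        y ⟨_, hmem1 i⟩ - y ⟨_, hmem0 i⟩) (by fun_prop)
      (measurable_pi_lambda _ fun i => (measurable_pi_apply _).sub (measurable_pi_apply _))
    exact h1
  refine Measure.ext_of_singleton fun k => ?_
  rw [incrementLaw, Measure.pi_singleton, observationLaw, Measure.map_map .of_discrete hobs,
    Measure.map_apply (Measurable.of_discrete.comp hobs) (measurableSet_singleton k)]
  -- Partition by the vector `m` of jump counts. On each piece the increments equal `S m`, which is
  -- independent of the counts, and the sum over `m` factorises over the cells.
  have hpart : (increments ∘ fun ω (i : Fin n) => compoundProcess N ε (((i : ℕ) + 1 : ℝ) * Δ) ω) ⁻¹' {k}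
      = ⋃ m, (S m ⁻¹' {k} ∩ M ⁻¹' {m}) := by
    ext ω
    simp only [Set.mem_preimage, Set.mem_singleton_iff, Set.mem_iUnion, Set.mem_inter_iff,
      Function.comp_apply]
    have hω : increments (fun i : Fin n => compoundProcess N ε (((i : ℕ) + 1 : ℝ) * Δ) ω) =
      S (M ω) ω := funext fun i => h.increments_observation hT hΔ rfl i
    rw [hω]
    constructor
    · intro hk
      exact ⟨M ω, hk, rfl⟩
    · rintro ⟨m, hk, rfl⟩
      exact hk
  rw [hpart, measure_iUnion]
  · have hterm : ∀ m, μ (S m ⁻¹' {k} ∩ M ⁻¹' {m}) = (∏ i, signSumLaw (m i) {k i}) *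
        ∏ i, poissonMeasure (gridMeans Λ Δ n i).toNNReal {m i} := by
      intro m
      rw [(hind m).measure_inter_preimage_eq_mul _ _ (measurableSet_singleton k)
        (measurableSet_singleton m), ← Measure.map_apply (hSm m) (measurableSet_singleton k),
        ← Measure.map_apply hMm (measurableSet_singleton m), hMlaw, Measure.pi_singleton,
        map_blockSum h.sign_measurable h.sign_law h.sign_indep m, Measure.pi_singleton]
    rw [tsum_congr hterm, tsum_prod_fin _ fun i j => signSumLaw j {k i}]
    refine Finset.prod_congr rfl fun i _ => ?_
    rw [compoundLaw_eq, Measure.bind_apply (measurableSet_singleton _)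
      (Measurable.aemeasurable .of_discrete), lintegral_countable']
  · intro m m' hmm
    refine Set.disjoint_left.2 fun ω h1 h2 => hmm ?_
    rw [← h1.2, ← h2.2]
  · exact fun m => (hSm m (measurableSet_singleton k)).inter (hMm (measurableSet_singleton m))

end IsCompoundPoissonModel

end Model

/-! ### Block averages -/

/-- Average of `f` over the `i`-th block `[i b, (i + 1) b]` of length `b`. -/
def blockAvg (f : ℝ → ℝ) (b : ℝ) (i : ℕ) : ℝ :=
  b⁻¹ * ∫ u in (i * b : ℝ)..((i + 1 : ℝ) * b), f u

/-- Restriction of Lebesgue measure to the unit interval. -/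
abbrev unitVolume : Measure ℝ := volume.restrict (Set.Icc (0 : ℝ) 1)

lemma mul_floor_div_le {b s : ℝ} (hb : 0 < b) (hs : 0 ≤ s) : (⌊s / b⌋₊ : ℝ) * b ≤ s := by
  have := Nat.floor_le (div_nonneg hs hb.le)
  rwa [le_div_iff₀ hb] at this

lemma lt_mul_floor_div_add_one {b s : ℝ} (hb : 0 < b) : s < ((⌊s / b⌋₊ : ℝ) + 1) * b := by
  have := Nat.lt_floor_add_one (s / b)
  rwa [div_lt_iff₀ hb] at this

lemma floor_div_eq {b s : ℝ} (hb : 0 < b) {i : ℕ} (h1 : i * b ≤ s) (h2 : s < (i + 1 : ℝ) * b) :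
    ⌊s / b⌋₊ = i := by
  rw [Nat.floor_eq_iff (div_nonneg (le_trans (by positivity) h1) hb.le), le_div_iff₀ hb,
    div_lt_iff₀ hb]
  exact ⟨h1, h2⟩

lemma floor_div_lt {b s : ℝ} (hb : 0 < b) (hs : 0 ≤ s) {n : ℕ} (h : s < n * b) : ⌊s / b⌋₊ < n := by
  rw [Nat.floor_lt (div_nonneg hs hb.le), div_lt_iff₀ hb]
  exact h

lemma block_subset {b : ℝ} (hb : 0 < b) {n i : ℕ} (hn : n * b ≤ 1) (hi : i < n) :
    Set.Icc (i * b : ℝ) ((i + 1 : ℝ) * b) ⊆ Set.Icc 0 1 := by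
  refine Set.Icc_subset_Icc (by positivity) (le_trans ?_ hn)
  have : (i + 1 : ℝ) ≤ n := by exact_mod_cast hi
  gcongr

lemma block_le {b : ℝ} (hb : 0 < b) (i : ℕ) : (i * b : ℝ) ≤ (i + 1 : ℝ) * b := by
  gcongr
  linarith

lemma intervalIntegrable_block {f : ℝ → ℝ} (hf : Integrable f unitVolume) {b : ℝ} (hb : 0 < b)
    {n i : ℕ} (hn : n * b ≤ 1) (hi : i < n) :
    IntervalIntegrable f volume (i * b : ℝ) ((i + 1 : ℝ) * b) := by
  rw [intervalIntegrable_iff_integrableOn_Icc_of_le (block_le hb i)]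
  exact IntegrableOn.mono_set hf (block_subset hb hn hi)

lemma ae_block {p : ℝ → Prop} (h : ∀ᵐ s ∂unitVolume, p s) {b : ℝ} (hb : 0 < b)
    {n i : ℕ} (hn : n * b ≤ 1) (hi : i < n) :
    ∀ᵐ s ∂(volume.restrict (Set.Icc (i * b : ℝ) ((i + 1 : ℝ) * b))), p s :=
  ae_restrict_of_ae_restrict_of_subset (block_subset hb hn hi) h

lemma blockAvg_mono {f g : ℝ → ℝ} (hf : Integrable f unitVolume) (hg : Integrable g unitVolume)
    (h : ∀ᵐ s ∂unitVolume, f s ≤ g s) {b : ℝ} (hb : 0 < b) {n i : ℕ} (hn : n * b ≤ 1)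
    (hi : i < n) : blockAvg f b i ≤ blockAvg g b i := by
  unfold blockAvg
  gcongr
  exact intervalIntegral.integral_mono_ae_restrict (block_le hb i)
    (intervalIntegrable_block hf hb hn hi) (intervalIntegrable_block hg hb hn hi)
    (ae_block h hb hn hi)

lemma blockAvg_congr {f g : ℝ → ℝ} (h : ∀ᵐ s ∂unitVolume, f s = g s) {b : ℝ} (hb : 0 < b)
    {n i : ℕ} (hn : n * b ≤ 1) (hi : i < n) : blockAvg f b i = blockAvg g b i := by
  unfold blockAvg
  congr 1
  refine intervalIntegral.integral_congr_ae_restrict ?_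
  rw [Set.uIoc_of_le (block_le hb i)]
  exact ae_restrict_of_ae_restrict_of_subset Set.Ioc_subset_Icc_self (ae_block h hb hn hi)

lemma blockAvg_add {f g : ℝ → ℝ} (hf : Integrable f unitVolume) (hg : Integrable g unitVolume)
    {b : ℝ} (hb : 0 < b) {n i : ℕ} (hn : n * b ≤ 1)
    (hi : i < n) : blockAvg (fun s => f s + g s) b i = blockAvg f b i + blockAvg g b i := by
  unfold blockAvg
  rw [intervalIntegral.integral_add (intervalIntegrable_block hf hb hn hi)
    (intervalIntegrable_block hg hb hn hi), mul_add]

lemma blockAvg_const_mul (f : ℝ → ℝ) (c b : ℝ) (i : ℕ) :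
    blockAvg (fun s => c * f s) b i = c * blockAvg f b i := by
  unfold blockAvg
  rw [intervalIntegral.integral_const_mul]
  ring

lemma abs_blockAvg_le (f : ℝ → ℝ) {b : ℝ} (hb : 0 < b) (i : ℕ) :
    |blockAvg f b i| ≤ blockAvg (fun s => |f s|) b i := by
  unfold blockAvg
  rw [abs_mul, abs_of_pos (inv_pos.2 hb)]
  gcongr
  exact intervalIntegral.abs_integral_le_integral_abs (block_le hb i)

lemma blockAvg_const {b : ℝ} (hb : 0 < b) (c : ℝ) (i : ℕ) : blockAvg (fun _ => c) b i = c := by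
  unfold blockAvg
  rw [intervalIntegral.integral_const, smul_eq_mul]
  field_simp
  ring

lemma blockAvg_pos {f : ℝ → ℝ} (hf : Integrable f unitVolume)
    (h : ∀ s ∈ Set.Icc (0 : ℝ) 1, 0 < f s) {b : ℝ} (hb : 0 < b) {n i : ℕ} (hn : n * b ≤ 1)
    (hi : i < n) : 0 < blockAvg f b i := by
  unfold blockAvg
  refine mul_pos (inv_pos.2 hb) ?_
  refine intervalIntegral.intervalIntegral_pos_of_pos_on (intervalIntegrable_block hf hb hn hi)
    (fun s hs => h s (block_subset hb hn hi (Set.Ioo_subset_Icc_self hs))) ?_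
  nlinarith

/-- The integral over the blocks of a function constant on each block. -/
lemma integral_floor (F : ℕ → ℝ) {b : ℝ} (hb : 0 < b) (n : ℕ) :
    ∫ s in (0 : ℝ)..(n * b : ℝ), F ⌊s / b⌋₊ = ∑ i : Fin n, b * F i := by
  -- The right endpoint of a block is assigned by the floor to the next block, so the equality holds
  -- only almost everywhere.
  have hae : ∀ i : ℕ, ∀ᵐ s, s ∈ Set.uIoc (i * b : ℝ) ((i + 1 : ℕ) * b) → F ⌊s / b⌋₊ = F i := by
    intro i
    have : ∀ᵐ s : ℝ, s ≠ ((i + 1 : ℕ) * b : ℝ) := by simp [ae_iff]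
    filter_upwards [this] with s hs hmem
    rw [Set.uIoc_of_le (by push_cast; exact block_le hb i)] at hmem
    push_cast at hmem hs
    rw [floor_div_eq hb hmem.1.le (lt_of_le_of_ne hmem.2 hs)]
  have h := intervalIntegral.sum_integral_adjacent_intervals (μ := volume)
    (f := fun s => F ⌊s / b⌋₊) (a := fun i : ℕ => (i * b : ℝ)) (n := n) fun k _ => by
      refine (intervalIntegrable_const (c := F k)).congr_ae ?_
      rw [Filter.EventuallyEq, ae_restrict_iff' measurableSet_uIoc]
      filter_upwards [hae k] with s hs hmem
      exact (hs hmem).symm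
  rw [Nat.cast_zero, zero_mul] at h
  rw [← h, Fin.sum_univ_eq_sum_range (fun i => b * F i) n]
  refine Finset.sum_congr rfl fun i _ => ?_
  rw [intervalIntegral.integral_congr_ae (hae i), intervalIntegral.integral_const, smul_eq_mul]
  push_cast
  ring

/-! ### Limits of averages and sums over shrinking blocks. -/

section Limits

variable {κ : Type*} {l : Filter κ} {b : κ → ℝ} {n : κ → ℕ}

/-- Lebesgue differentiation along block averages. -/
lemma ae_tendsto_blockAvg {f : ℝ → ℝ} (hf : Integrable f unitVolume)
    (hb : Tendsto b l (𝓝[>] 0)) :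
    ∀ᵐ s ∂unitVolume, Tendsto (fun T => blockAvg f (b T) ⌊s / b T⌋₊) l (𝓝 (f s)) := by
  have hb0 : ∀ᶠ T in l, 0 < b T := hb.eventually self_mem_nhdsWithin
  have hbl : Tendsto b l (𝓝 0) := hb.mono_right nhdsWithin_le_nhds
  let F : ℝ → ℝ := (Set.Icc (0 : ℝ) 1).indicator f
  have hF : Integrable F := (integrable_indicator_iff measurableSet_Icc).2 hf
  have h1 := IsUnifLocDoublingMeasure.ae_tendsto_average volume hF.locallyIntegrable 1
  -- A block containing `s < 1` eventually lies inside `[0, 1]`; at `s = 1` it may stick out.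
  have h2 : ∀ᵐ s : ℝ, s ≠ 1 := by simp [ae_iff]
  filter_upwards [ae_restrict_of_ae h1, ae_restrict_of_ae h2,
    ae_restrict_mem measurableSet_Icc] with s hs hs1 hmem
  have hs1' : s < 1 := lt_of_le_of_ne hmem.2 hs1
  have hδ : Tendsto (fun T => b T / 2) l (𝓝[>] 0) := by
    refine tendsto_nhdsWithin_iff.2 ⟨by simpa using hbl.div_const 2, ?_⟩
    filter_upwards [hb0] with T hT
    exact half_pos hT
  -- A block is the closed ball around its midpoint with radius half its length. It contains `s` but
  -- is not centred there, hence the differentiation theorem for off-centre balls with dilation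
  -- constant `1`.
  have h3 := hs (l := l) (fun T => ((⌊s / b T⌋₊ : ℝ) + 1 / 2) * b T) (fun T => b T / 2) hδ (by
    filter_upwards [hb0] with T hT
    have := mul_floor_div_le hT hmem.1
    have := lt_mul_floor_div_add_one (s := s) hT
    rw [Real.closedBall_eq_Icc]
    constructor <;> nlinarith)
  have hFs : F s = f s := Set.indicator_of_mem hmem f
  rw [hFs] at h3
  refine h3.congr' ?_
  filter_upwards [hb0, hbl.eventually_lt_const (show 0 < 1 - s by linarith)] with T hT hT1
  have e1 : Metric.closedBall (((⌊s / b T⌋₊ : ℝ) + 1 / 2) * b T) (b T / 2) =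
      Set.Icc (⌊s / b T⌋₊ * b T) ((⌊s / b T⌋₊ + 1 : ℝ) * b T) := by
    rw [Real.closedBall_eq_Icc]
    congr 1 <;> ring
  have hle := mul_floor_div_le hT hmem.1
  have hsub : Set.Icc (⌊s / b T⌋₊ * b T) ((⌊s / b T⌋₊ + 1 : ℝ) * b T) ⊆ Set.Icc 0 1 := by
    refine Set.Icc_subset_Icc (by positivity) ?_
    linarith
  rw [e1, setAverage_eq, blockAvg, intervalIntegral.integral_of_le (block_le hT _),
    ← integral_Icc_eq_integral_Ioc, smul_eq_mul]
  congr 1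
  · simp only [measureReal_def, Real.volume_Icc]
    rw [ENNReal.toReal_ofReal (by linarith)]
    congr 1
    ring
  · exact setIntegral_congr_fun measurableSet_Icc fun u hu => Set.indicator_of_mem (hsub hu) f

/-- Dominated convergence for sums over blocks. -/
lemma tendsto_sum_blocks [l.IsCountablyGenerated] [l.NeBot] (hb : Tendsto b l (𝓝[>] 0))
    (hn : ∀ᶠ T in l, n T * b T ≤ 1) (hn' : Tendsto (fun T => n T * b T) l (𝓝 1))
    {F : κ → ℕ → ℝ} {G : ℝ → ℝ} {C : ℝ} (hF : ∀ᶠ T in l, ∀ i < n T, |F T i| ≤ C)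
    (hlim : ∀ᵐ s ∂unitVolume, Tendsto (fun T => F T ⌊s / b T⌋₊) l (𝓝 (G s))) :
    Integrable G unitVolume ∧
      Tendsto (fun T => ∑ i : Fin (n T), b T * F T i) l (𝓝 (∫ s in (0 : ℝ)..1, G s)) := by
  have hb0 : ∀ᶠ T in l, 0 < b T := hb.eventually self_mem_nhdsWithin
  -- The step function equal to `F T i` on the i-th block and to zero on the uncovered remainder.
  -- Every `s < 1` is eventually covered because `n b → 1`.
  let Φ : κ → ℝ → ℝ := fun T => (Set.Ico (0 : ℝ) (n T * b T)).indicator fun s => F T ⌊s / b T⌋₊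
  have hΦm : ∀ T, Measurable (Φ T) := fun T =>
    ((Measurable.of_discrete (f := F T)).comp
      (Nat.measurable_floor.comp (measurable_id.div_const (b T)))).indicator measurableSet_Ico
  have hΦl : ∀ᵐ s ∂unitVolume, Tendsto (fun T => Φ T s) l (𝓝 (G s)) := by
    have h2 : ∀ᵐ s : ℝ, s ≠ 1 := by simp [ae_iff]
    filter_upwards [hlim, ae_restrict_of_ae h2, ae_restrict_mem measurableSet_Icc]
      with s hs hs1 hmem
    refine hs.congr' ?_
    filter_upwards [hn'.eventually_const_lt (lt_of_le_of_ne hmem.2 hs1)] with T hT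
    have hmem' : s ∈ Set.Ico (0 : ℝ) (n T * b T) := ⟨hmem.1, hT⟩
    simp only [Φ, Set.indicator_of_mem hmem']
  have hΦb : ∀ᶠ T in l, ∀ s, |Φ T s| ≤ |C| := by
    filter_upwards [hF, hb0] with T hT hbT s
    by_cases hs : s ∈ Set.Ico 0 (n T * b T : ℝ)
    · simp only [Φ, Set.indicator_of_mem hs]
      exact (hT _ (floor_div_lt hbT hs.1 hs.2)).trans (le_abs_self C)
    · simp [Φ, Set.indicator_of_notMem hs]
  have hGb : ∀ᵐ s ∂unitVolume, |G s| ≤ |C| := by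
    filter_upwards [hΦl] with s hs
    refine le_of_tendsto hs.abs ?_
    filter_upwards [hΦb] with T hT
    exact hT s
  have hGm : AEStronglyMeasurable G unitVolume :=
    aestronglyMeasurable_of_tendsto_ae l (fun T => (hΦm T).aestronglyMeasurable) hΦl
  refine ⟨(integrable_const |C|).mono' hGm hGb, ?_⟩
  have h := tendsto_integral_filter_of_dominated_convergence (μ := unitVolume) (l := l) (F := Φ)
    (f := G) (fun _ => |C|) (.of_forall fun T => (hΦm T).aestronglyMeasurable)
    (hΦb.mono fun T hT => .of_forall hT) (integrable_const _) hΦl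
  rw [intervalIntegral.integral_of_le zero_le_one, ← integral_Icc_eq_integral_Ioc]
  refine h.congr' ?_
  filter_upwards [hn, hb0] with T hT hbT
  rw [← integral_floor (F T) hbT, intervalIntegral.integral_of_le (by positivity),
    ← integral_Ico_eq_integral_Ioc, ← integral_indicator measurableSet_Ico,
    ← integral_indicator measurableSet_Icc]
  congr 1
  funext s
  by_cases hs : s ∈ Set.Ico 0 (n T * b T : ℝ)
  · have : s ∈ Set.Icc (0 : ℝ) 1 := ⟨hs.1, hs.2.le.trans hT⟩
    simp [Φ, Set.indicator_of_mem hs, Set.indicator_of_mem this]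
  · by_cases h1 : s ∈ Set.Icc (0 : ℝ) 1
    · simp only [Set.indicator_of_mem h1, Φ]
    · simp [Set.indicator_of_notMem h1, Set.indicator_of_notMem hs]

end Limits

/-! ### Information and likelihood ratios along blocks -/

/-- The weighted average of `σ` over the `i`-th block, with weight `f`. -/
def blockScore (f σ : ℝ → ℝ) (b : ℝ) (i : ℕ) : ℝ :=
  blockAvg (fun s => f s * σ s) b i / blockAvg f b i

lemma integrable_mul_of_ae_bound {f g : ℝ → ℝ} (hf : Integrable f unitVolume)
    (hg : AEStronglyMeasurable g unitVolume) {C : ℝ} (hC : ∀ᵐ s ∂unitVolume, |g s| ≤ C) :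
    Integrable (fun s => f s * g s) unitVolume := by
  have := hf.bdd_mul hg hC
  simpa only [mul_comm] using this

lemma blockAvg_mul_abs_le {f g : ℝ → ℝ} (hf : Integrable f unitVolume)
    (hpos : ∀ s ∈ Set.Icc (0 : ℝ) 1, 0 < f s) (hg : AEStronglyMeasurable g unitVolume) {C : ℝ}
    (hC : ∀ᵐ s ∂unitVolume, |g s| ≤ C) {b : ℝ} (hb : 0 < b) {n i : ℕ} (hn : n * b ≤ 1)
    (hi : i < n) : blockAvg (fun s => f s * |g s|) b i ≤ C * blockAvg f b i := by
  rw [← blockAvg_const_mul]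
  refine blockAvg_mono (integrable_mul_of_ae_bound hf hg.norm (by simpa using hC))
    (hf.const_mul C) ?_ hb hn hi
  filter_upwards [hC, ae_restrict_mem measurableSet_Icc] with s hs hmem
  rw [mul_comm C]
  exact mul_le_mul_of_nonneg_left hs (hpos s hmem).le

lemma abs_blockAvg_mul_le {f g : ℝ → ℝ} (hpos : ∀ s ∈ Set.Icc (0 : ℝ) 1, 0 < f s)
    {b : ℝ} (hb : 0 < b) {n i : ℕ} (hn : n * b ≤ 1) (hi : i < n) :
    |blockAvg (fun s => f s * g s) b i| ≤ blockAvg (fun s => f s * |g s|) b i := by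
  refine (abs_blockAvg_le _ hb i).trans (blockAvg_congr ?_ hb hn hi).le
  filter_upwards [ae_restrict_mem measurableSet_Icc] with s hmem
  rw [abs_mul, abs_of_pos (hpos s hmem)]

lemma abs_blockScore_le {f σ : ℝ → ℝ} (hf : Integrable f unitVolume)
    (hpos : ∀ s ∈ Set.Icc (0 : ℝ) 1, 0 < f s) (hσ : AEStronglyMeasurable σ unitVolume) {K : ℝ}
    (hK : ∀ᵐ s ∂unitVolume, |σ s| ≤ K) {b : ℝ} (hb : 0 < b) {n i : ℕ} (hn : n * b ≤ 1)
    (hi : i < n) : |blockScore f σ b i| ≤ K := by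
  have hL := blockAvg_pos hf hpos hb hn hi
  rw [blockScore, abs_div, abs_of_pos hL, div_le_iff₀ hL]
  exact (abs_blockAvg_mul_le hpos hb hn hi).trans (blockAvg_mul_abs_le hf hpos hσ hK hb hn hi)

lemma blockAvg_le_of_le {f : ℝ → ℝ} (hf : Integrable f unitVolume) {M : ℝ}
    (hM : ∀ s ∈ Set.Icc (0 : ℝ) 1, f s ≤ M) {b : ℝ} (hb : 0 < b) {n i : ℕ} (hn : n * b ≤ 1)
    (hi : i < n) : blockAvg f b i ≤ M := by
  rw [← blockAvg_const hb M i]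
  refine blockAvg_mono hf (integrable_const M) ?_ hb hn hi
  filter_upwards [ae_restrict_mem measurableSet_Icc] with s hs using hM s hs

/-- A uniform bound for the logarithm of a ratio passes to block averages. -/
lemma abs_log_blockAvg_div_le {f g : ℝ → ℝ} (hf : Integrable f unitVolume)
    (hg : Integrable g unitVolume) (hfpos : ∀ s ∈ Set.Icc (0 : ℝ) 1, 0 < f s)
    (hgpos : ∀ s ∈ Set.Icc (0 : ℝ) 1, 0 < g s) {c : ℝ}
    (hc : ∀ᵐ s ∂unitVolume, |Real.log (g s) - Real.log (f s)| ≤ c) {b : ℝ} (hb : 0 < b) {n i : ℕ}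
    (hn : n * b ≤ 1) (hi : i < n) : |Real.log (blockAvg g b i / blockAvg f b i)| ≤ c := by
  have hF := blockAvg_pos hf hfpos hb hn hi
  have hG := blockAvg_pos hg hgpos hb hn hi
  have key : ∀ {f g : ℝ → ℝ}, Integrable f unitVolume → Integrable g unitVolume →
      (∀ s ∈ Set.Icc (0 : ℝ) 1, 0 < f s) → (∀ s ∈ Set.Icc (0 : ℝ) 1, 0 < g s) →
      (∀ᵐ s ∂unitVolume, Real.log (g s) - Real.log (f s) ≤ c) →
      blockAvg g b i ≤ Real.exp c * blockAvg f b i := by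
    intro f g hf hg hfpos hgpos h
    rw [← blockAvg_const_mul]
    refine blockAvg_mono hg (hf.const_mul _) ?_ hb hn hi
    filter_upwards [h, ae_restrict_mem measurableSet_Icc] with s hs hmem
    rw [← Real.log_le_log_iff (hgpos s hmem) (mul_pos (Real.exp_pos c) (hfpos s hmem)),
      Real.log_mul (Real.exp_pos c).ne' (hfpos s hmem).ne', Real.log_exp]
    linarith
  have h1 := key hf hg hfpos hgpos (hc.mono fun s hs => (abs_le.1 hs).2)
  have h2 := key hg hf hgpos hfpos (hc.mono fun s hs => by linarith [(abs_le.1 hs).1])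
  rw [← Real.log_le_log_iff (by positivity) (by positivity),
    Real.log_mul (Real.exp_pos c).ne' (by positivity), Real.log_exp] at h1 h2
  rw [Real.log_div hG.ne' hF.ne', abs_le]
  constructor <;> linarith

lemma abs_log_one_add_sub_le {r : ℝ} (hr : |r| ≤ 1 / 2) : |Real.log (1 + r) - r| ≤ 2 * r ^ 2 := by
  obtain ⟨h1, h2⟩ := abs_le.1 hr
  have hp : 0 < 1 + r := by linarith
  have hu := Real.log_le_sub_one_of_pos hp
  have hl := Real.one_sub_inv_le_log_of_pos hp
  have h3 : r - 2 * r ^ 2 ≤ 1 - (1 + r)⁻¹ := by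
    have h4 : (1 + r)⁻¹ ≤ 1 - r + 2 * r ^ 2 := by
      rw [inv_le_iff_one_le_mul₀ hp]
      nlinarith [sq_nonneg r]
    linarith
  rw [abs_le]
  constructor <;> nlinarith [sq_nonneg r]

section Limits

variable {κ : Type*} {l : Filter κ} [l.IsCountablyGenerated] [l.NeBot] {b : κ → ℝ} {n : κ → ℕ}
  {f σ : ℝ → ℝ} {K M C : ℝ}

/-- Convergence of the normalised information of the increments. -/
lemma tendsto_sum_scoreInfo (hb : Tendsto b l (𝓝[>] 0))
    (hn : ∀ᶠ T in l, n T * b T ≤ 1) (hn' : Tendsto (fun T => n T * b T) l (𝓝 1))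
    (hf : Integrable f unitVolume) (hfpos : ∀ s ∈ Set.Icc (0 : ℝ) 1, 0 < f s)
    (hfM : ∀ s ∈ Set.Icc (0 : ℝ) 1, f s ≤ M) (hσ : AEStronglyMeasurable σ unitVolume)
    (hσK : ∀ᵐ s ∂unitVolume, |σ s| ≤ K) {D c : κ → ℝ} {φ : ℝ → ℝ} (hD : ∀ᶠ T in l, 0 < D T)
    (hc : ∀ᶠ T in l, 0 < c T)
    (hmin : ∀ᶠ T in l, ∀ y, 0 < y → y ≤ M → min 1 (D T * y) ≤ C * c T)
    (hφ : ∀ y > 0, ∀ Y : κ → ℝ, Tendsto Y l (𝓝 y) →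
      Tendsto (fun T => scoreInfo (D T * Y T) / c T) l (𝓝 (φ y))) :
    Integrable (fun s => φ (f s) * σ s ^ 2) unitVolume ∧
      Tendsto (fun T => ∑ i : Fin (n T), b T * (scoreInfo (D T * blockAvg f (b T) i) / c T *
        blockScore f σ (b T) i ^ 2)) l (𝓝 (∫ s in (0 : ℝ)..1, φ (f s) * σ s ^ 2)) := by
  have hb0 : ∀ᶠ T in l, 0 < b T := hb.eventually self_mem_nhdsWithin
  obtain ⟨B, hB, hmom⟩ := exists_score_moment_bound
  refine tendsto_sum_blocks (C := B * C * K ^ 2) hb hn hn'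
    (F := fun T i => scoreInfo (D T * blockAvg f (b T) i) / c T * blockScore f σ (b T) i ^ 2)
    ?_ ?_
  · filter_upwards [hb0, hn, hD, hc, hmin] with T hbT hnT hDT hcT hminT i hi
    have hL := blockAvg_pos hf hfpos hbT hnT hi
    have hLM := blockAvg_le_of_le hf hfM hbT hnT hi
    have ha := abs_blockScore_le hf hfpos hσ hσK hbT hnT hi
    have h1 : scoreInfo (D T * blockAvg f (b T) i) / c T ≤ B * C := by
      rw [div_le_iff₀ hcT]
      refine (hmom _ (mul_pos hDT hL)).1.trans ?_
      rw [mul_assoc]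
      exact mul_le_mul_of_nonneg_left (hminT _ hL hLM) hB.le
    have h0 : 0 ≤ scoreInfo (D T * blockAvg f (b T) i) / c T :=
      div_nonneg (scoreInfo_nonneg _) hcT.le
    rw [abs_mul, abs_of_nonneg h0, abs_pow]
    gcongr
    exact h0.trans h1
  · filter_upwards [ae_tendsto_blockAvg hf hb,
      ae_tendsto_blockAvg (integrable_mul_of_ae_bound hf hσ hσK) hb,
      ae_restrict_mem measurableSet_Icc] with s h1 h2 hs
    have hp := hfpos s hs
    -- The weighted block average of `σ` tends almost everywhere to `f σ / f = σ`.
    have h3 := h2.div h1 hp.ne'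
    rw [mul_div_cancel_left₀ _ hp.ne'] at h3
    exact (hφ _ hp _ h1).mul (h3.pow 2)

/-- First-order expansion of the logarithms of the ratios of block averages. -/
lemma exists_sum_sq_log_ratio_le (hb : Tendsto b l (𝓝[>] 0))
    (hn : ∀ᶠ T in l, n T * b T ≤ 1) (hn' : Tendsto (fun T => n T * b T) l (𝓝 1))
    (hf : Integrable f unitVolume) (hfpos : ∀ s ∈ Set.Icc (0 : ℝ) 1, 0 < f s)
    (hσ : AEStronglyMeasurable σ unitVolume) (hK : 0 ≤ K)
    (hσK : ∀ᵐ s ∂unitVolume, |σ s| ≤ K) {g : κ → ℝ → ℝ} {h : κ → ℝ} (hh : Tendsto h l (𝓝 0))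
    (hg : ∀ᶠ T in l, Integrable (g T) unitVolume)
    (hgpos : ∀ᶠ T in l, ∀ s ∈ Set.Icc (0 : ℝ) 1, 0 < g T s)
    (hlip : ∀ᶠ T in l, ∀ᵐ s ∂unitVolume, |Real.log (g T s) - Real.log (f s)| ≤ K * |h T|)
    (hzero : ∀ᶠ T in l, h T = 0 → g T = f)
    (hder : ∀ᵐ s ∂unitVolume, Tendsto (fun T => (g T s / f s - 1 - h T * σ s) / h T) l (𝓝 0)) :
    ∃ A : κ → ℝ, Tendsto A l (𝓝 0) ∧ ∀ᶠ T in l, ∑ i : Fin (n T), b T *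
      (Real.log (blockAvg (g T) (b T) i / blockAvg f (b T) i) -
        h T * blockScore f σ (b T) i) ^ 2 ≤ h T ^ 2 * A T := by
  have hb0 : ∀ᶠ T in l, 0 < b T := hb.eventually self_mem_nhdsWithin
  have hbl : Tendsto b l (𝓝 0) := hb.mono_right nhdsWithin_le_nhds
  have hha : Tendsto (fun T => |h T|) l (𝓝 0) := by simpa using hh.abs
  -- The relative linearisation error per unit of `h`; where `h T = 0` the quotient takes the value
  -- `0`, and `hzero` keeps the expansion of `g` valid.
  let e : κ → ℝ → ℝ := fun T s => (g T s / f s - 1 - h T * σ s) / h T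
  have hKh : ∀ᶠ T in l, K * |h T| ≤ 1 / 8 := by
    have : Tendsto (fun T => K * |h T|) l (𝓝 0) := by simpa using hha.const_mul K
    exact this.eventually_le_const (by norm_num)
  have hem : ∀ᶠ T in l, AEStronglyMeasurable (e T) unitVolume := by
    filter_upwards [hg] with T hgT
    have h1 := hgT.aestronglyMeasurable.aemeasurable.div hf.aestronglyMeasurable.aemeasurable
    exact (((h1.sub_const 1).sub (hσ.aemeasurable.const_mul (h T))).div_const
      (h T)).aestronglyMeasurable
  have heb : ∀ᶠ T in l, ∀ᵐ s ∂unitVolume, |e T s| ≤ 3 * K := by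
    filter_upwards [hlip, hgpos, hKh] with T hl hp hk
    filter_upwards [hl, hσK, ae_restrict_mem measurableSet_Icc] with s hls hσs hs
    by_cases h0 : h T = 0
    · simp only [e, h0, div_zero, abs_zero]
      positivity
    · have h1 : g T s / f s = Real.exp (Real.log (g T s) - Real.log (f s)) := by
        rw [Real.exp_sub, Real.exp_log (hp s hs), Real.exp_log (hfpos s hs)]
      have h2 := Real.abs_exp_sub_one_le (x := Real.log (g T s) - Real.log (f s))
        (hls.trans (hk.trans (by norm_num)))
      rw [← h1] at h2
      simp only [e]
      rw [abs_div, div_le_iff₀ (abs_pos.2 h0)]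
      calc |g T s / f s - 1 - h T * σ s| ≤ |g T s / f s - 1| + |h T * σ s| := abs_sub _ _
        _ ≤ 2 * (K * |h T|) + |h T| * K := by
          rw [abs_mul]
          gcongr
          exact h2.trans (by gcongr)
        _ = 3 * K * |h T| := by ring
  have heq : ∀ᶠ T in l, ∀ᵐ s ∂unitVolume,
      g T s = f s + (h T * (f s * σ s) + h T * (f s * e T s)) := by
    filter_upwards [hzero] with T hz
    filter_upwards [ae_restrict_mem measurableSet_Icc] with s hs
    have hfs := (hfpos s hs).ne'
    by_cases h0 : h T = 0
    · simp [h0, hz h0]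
    · simp only [e]
      field_simp
      ring
  -- The weighted `L¹` size of the error. It tends to zero by dominated convergence, the Lipschitz
  -- bound giving `|e| ≤ 3K`.
  let β : κ → ℝ := fun T => ∫ s in (0 : ℝ)..1, f s * |e T s|
  have hβint : ∀ᶠ T in l, Integrable (fun s => f s * |e T s|) unitVolume := by
    filter_upwards [hem, heb] with T h1 h2
    exact integrable_mul_of_ae_bound hf h1.norm (by simpa using h2)
  have hβ0 : ∀ T, 0 ≤ β T := fun T => intervalIntegral.integral_nonneg zero_le_one fun s hs =>
    mul_nonneg (hfpos s hs).le (abs_nonneg _)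
  have hβ : Tendsto β l (𝓝 0) := by
    have h1 := tendsto_integral_filter_of_dominated_convergence (μ := unitVolume) (l := l)
      (F := fun T s => f s * |e T s|) (f := fun _ => (0 : ℝ)) (fun s => f s * (3 * K))
      (hβint.mono fun T hT => hT.aestronglyMeasurable) ?_ (hf.mul_const _) ?_
    · rw [integral_zero] at h1
      refine h1.congr fun T => ?_
      simp only [β]
      rw [intervalIntegral.integral_of_le zero_le_one, ← integral_Icc_eq_integral_Ioc]
    · filter_upwards [heb] with T hT
      filter_upwards [hT, ae_restrict_mem measurableSet_Icc] with s h1 hs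
      rw [Real.norm_eq_abs, abs_mul, abs_of_pos (hfpos s hs), abs_abs]
      exact mul_le_mul_of_nonneg_left h1 (hfpos s hs).le
    · filter_upwards [hder] with s hs
      have := (continuous_abs.continuousAt.tendsto.comp hs).const_mul (f s)
      simpa using this
  -- As `f` need not be bounded away from zero, blocks are separated at a vanishing threshold. Above
  -- it, dividing the total error by `η` leaves at most `√β`. Below it, the total block length
  -- vanishes because averages tend to `f > 0`. The summand `b` keeps `η` positive.
  let η : κ → ℝ := fun T => √(β T) + b T
  have hη : Tendsto η l (𝓝 0) := by
    have := (Real.continuous_sqrt.tendsto 0).comp hβ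
    simpa [η] using this.add hbl
  let ind : κ → ℕ → ℝ := fun T i => if blockAvg f (b T) i < η T then 1 else 0
  have hind : Tendsto (fun T => ∑ i : Fin (n T), b T * ind T i) l (𝓝 0) := by
    have h1 := (tendsto_sum_blocks (C := 1) (G := fun _ => 0) hb hn hn' (F := ind) (.of_forall
      fun T i _ => by simp only [ind]; split_ifs <;> simp) ?_).2
    · simpa using h1
    · filter_upwards [ae_tendsto_blockAvg hf hb, ae_restrict_mem measurableSet_Icc] with s hs hmem
      refine tendsto_const_nhds.congr' ?_
      filter_upwards [hη.eventually_lt hs (hfpos s hmem)] with T hT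
      simp [ind, hT.le.not_gt]
  -- The constants come from `(p + r)² ≤ 2p² + 2r²`: `2 · 32² = 2048` from the quadratic error of
  -- the logarithm, and `2 · 3K` from `A² ≤ 3K A`.
  refine ⟨fun T => 2048 * K ^ 4 * h T ^ 2 +
    6 * K * (√(β T) + 3 * K * ∑ i : Fin (n T), b T * ind T i), ?_, ?_⟩
  · have h1 := (Real.continuous_sqrt.tendsto 0).comp hβ
    have h2 := ((hh.pow 2).const_mul (2048 * K ^ 4)).add
      ((h1.add (hind.const_mul (3 * K))).const_mul (6 * K))
    simpa using h2
  filter_upwards [hb0, hn, hg, hgpos, hKh, hem, heb, heq, hβint] with T hbT hnT hgT hgposT hKhT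
    hemT hebT heqT hβT
  have hfσ := integrable_mul_of_ae_bound hf hσ hσK
  have hfe := integrable_mul_of_ae_bound hf hemT hebT
  let A : ℕ → ℝ := fun i => blockAvg (fun s => f s * |e T s|) (b T) i / blockAvg f (b T) i
  have hηpos : 0 < η T := add_pos_of_nonneg_of_pos (Real.sqrt_nonneg _) hbT
  have hA : ∀ i < n T, 0 ≤ A i ∧ A i ≤ 3 * K ∧
      A i ≤ blockAvg (fun s => f s * |e T s|) (b T) i / η T + 3 * K * ind T i := by
    intro i hi
    have hL := blockAvg_pos hf hfpos hbT hnT hi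
    have hB0 : 0 ≤ blockAvg (fun s => f s * |e T s|) (b T) i :=
      (abs_nonneg _).trans (abs_blockAvg_mul_le (g := e T) hfpos hbT hnT hi)
    have h1 : A i ≤ 3 * K := by
      simp only [A]
      rw [div_le_iff₀ hL]
      exact blockAvg_mul_abs_le hf hfpos hemT hebT hbT hnT hi
    refine ⟨div_nonneg hB0 hL.le, h1, ?_⟩
    by_cases hlt : blockAvg f (b T) i < η T
    · simp only [ind, if_pos hlt, mul_one]
      linarith [div_nonneg hB0 hηpos.le]
    · simp only [ind, if_neg hlt, mul_zero, add_zero, A]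
      exact div_le_div_of_nonneg_left hB0 hηpos (not_lt.1 hlt)
  have hterm : ∀ i < n T, (Real.log (blockAvg (g T) (b T) i / blockAvg f (b T) i) -
      h T * blockScore f σ (b T) i) ^ 2 ≤ h T ^ 2 * (2048 * K ^ 4 * h T ^ 2 + 6 * K * A i) := by
    intro i hi
    have hL := blockAvg_pos hf hfpos hbT hnT hi
    obtain ⟨hA0, hAK, -⟩ := hA i hi
    have ha := abs_blockScore_le hf hfpos hσ hσK hbT hnT hi
    set a := blockScore f σ (b T) i with ha_def
    set d := blockAvg (fun s => f s * e T s) (b T) i / blockAvg f (b T) i with hd_def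
    have hd : |d| ≤ A i := by
      rw [hd_def, abs_div, abs_of_pos hL]
      exact div_le_div_of_nonneg_right (abs_blockAvg_mul_le hfpos hbT hnT hi) hL.le
    have hratio : blockAvg (g T) (b T) i / blockAvg f (b T) i = 1 + h T * (a + d) := by
      rw [blockAvg_congr heqT hbT hnT hi,
        blockAvg_add (g := fun s => h T * (f s * σ s) + h T * (f s * e T s)) hf
          ((hfσ.const_mul _).add (hfe.const_mul _)) hbT hnT hi,
        blockAvg_add (hfσ.const_mul _) (hfe.const_mul _) hbT hnT hi, blockAvg_const_mul,
        blockAvg_const_mul, ha_def, hd_def, blockScore]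
      field_simp
    -- The bounds `|a| ≤ K` and `|d| ≤ 3K` add up; together with `K |h| ≤ 1/8` this keeps the
    -- argument within the range `1/2` of the logarithm estimate.
    have hr : |h T * (a + d)| ≤ 4 * K * |h T| := by
      rw [abs_mul]
      have := abs_add_le a d
      have : |a + d| ≤ 4 * K := by linarith
      nlinarith [abs_nonneg (h T)]
    have hlog := abs_log_one_add_sub_le (r := h T * (a + d)) (by linarith)
    rw [hratio]
    have h1 : |Real.log (1 + h T * (a + d)) - h T * a| ≤ 32 * K ^ 2 * h T ^ 2 + |h T| * A i := by
      have h2 : Real.log (1 + h T * (a + d)) - h T * a =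
        (Real.log (1 + h T * (a + d)) - h T * (a + d)) + h T * d := by ring
      rw [h2]
      refine (abs_add_le _ _).trans (add_le_add (hlog.trans ?_) ?_)
      · rw [← sq_abs]
        refine (mul_le_mul_of_nonneg_left (pow_le_pow_left₀ (abs_nonneg _) hr 2)
          zero_le_two).trans (le_of_eq ?_)
        rw [mul_pow, mul_pow, sq_abs]
        ring
      · rw [abs_mul]
        gcongr
    rw [← sq_abs]
    refine (pow_le_pow_left₀ (abs_nonneg _) h1 2).trans ?_
    have h3 : (32 * K ^ 2 * h T ^ 2 + |h T| * A i) ^ 2 ≤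
        2 * (32 * K ^ 2 * h T ^ 2) ^ 2 + 2 * (|h T| * A i) ^ 2 := by
      nlinarith [sq_nonneg (32 * K ^ 2 * h T ^ 2 - |h T| * A i)]
    refine h3.trans ?_
    rw [mul_pow, mul_pow |h T|, sq_abs]
    have h4 : A i ^ 2 ≤ 3 * K * A i := by nlinarith
    nlinarith [mul_le_mul_of_nonneg_left h4 (sq_nonneg (h T))]
  have hsumA : ∑ i : Fin (n T), b T * A i ≤ √(β T) + 3 * K * ∑ i : Fin (n T), b T * ind T i := by
    have h1 : ∑ i : Fin (n T), b T * blockAvg (fun s => f s * |e T s|) (b T) i ≤ β T := by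
      have h2 := intervalIntegral.sum_integral_adjacent_intervals (μ := volume)
        (f := fun s => f s * |e T s|) (a := fun i : ℕ => (i * b T : ℝ)) (n := n T) fun i hi => by
          have := intervalIntegrable_block hβT hbT hnT hi
          push_cast
          exact this
      have h3 : ∑ i : Fin (n T), b T * blockAvg (fun s => f s * |e T s|) (b T) i =
          ∫ s in (0 : ℝ)..(n T * b T), f s * |e T s| := by
        rw [Nat.cast_zero, zero_mul] at h2
        rw [← h2, Fin.sum_univ_eq_sum_range
          (fun i => b T * blockAvg (fun s => f s * |e T s|) (b T) i) (n T)]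
        refine Finset.sum_congr rfl fun i _ => ?_
        rw [blockAvg, ← mul_assoc, mul_inv_cancel₀ hbT.ne', one_mul]
        push_cast
        rfl
      rw [h3]
      refine intervalIntegral.integral_mono_interval le_rfl (by positivity) hnT ?_ ?_
      · filter_upwards [ae_restrict_mem measurableSet_Ioc] with s hs
        exact mul_nonneg (hfpos s (Set.Ioc_subset_Icc_self hs)).le (abs_nonneg _)
      · rw [intervalIntegrable_iff_integrableOn_Icc_of_le zero_le_one]
        exact hβT
    have h2 : β T / η T ≤ √(β T) := by
      rw [div_le_iff₀ hηpos]
      have := Real.mul_self_sqrt (hβ0 T)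
      have h5 := mul_nonneg (Real.sqrt_nonneg (β T)) hbT.le
      simp only [η]
      nlinarith
    calc ∑ i : Fin (n T), b T * A i
        ≤ ∑ i : Fin (n T), ((η T)⁻¹ * (b T * blockAvg (fun s => f s * |e T s|) (b T) i) +
            3 * K * (b T * ind T i)) := by
          refine Finset.sum_le_sum fun i _ => ?_
          have := mul_le_mul_of_nonneg_left (hA i i.2).2.2 hbT.le
          refine this.trans (le_of_eq ?_)
          rw [div_eq_mul_inv]
          ring
      _ = (η T)⁻¹ * ∑ i : Fin (n T), b T * blockAvg (fun s => f s * |e T s|) (b T) i +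
            3 * K * ∑ i : Fin (n T), b T * ind T i := by
          rw [Finset.sum_add_distrib, Finset.mul_sum, Finset.mul_sum]
      _ ≤ _ := by
          gcongr
          refine le_trans ?_ h2
          rw [div_eq_inv_mul]
          gcongr
  calc ∑ i : Fin (n T), b T * (Real.log (blockAvg (g T) (b T) i / blockAvg f (b T) i) -
        h T * blockScore f σ (b T) i) ^ 2
      ≤ ∑ i : Fin (n T), (h T ^ 2 * (2048 * K ^ 4 * h T ^ 2) * b T +
          h T ^ 2 * (6 * K) * (b T * A i)) := by
        refine Finset.sum_le_sum fun i _ => ?_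
        refine (mul_le_mul_of_nonneg_left (hterm i i.2) hbT.le).trans (le_of_eq ?_)
        ring
    _ = h T ^ 2 * (2048 * K ^ 4 * h T ^ 2) * (n T * b T) +
          h T ^ 2 * (6 * K) * ∑ i : Fin (n T), b T * A i := by
        rw [Finset.sum_add_distrib, Finset.sum_const, Finset.card_univ,
          Fintype.card_fin, nsmul_eq_mul, ← Finset.mul_sum]
        ring
    _ ≤ h T ^ 2 * (2048 * K ^ 4 * h T ^ 2) * 1 + h T ^ 2 * (6 * K) *
          (√(β T) + 3 * K * ∑ i : Fin (n T), b T * ind T i) := by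
        gcongr
    _ = _ := by ring

end Limits

/-! ### From arrays of independent increments to local asymptotic normality -/

lemma skellam_eq_exp {x : ℝ} (hx : 0 < x) (k : ℤ) :
    skellam x k = Real.exp (logWeight k.natAbs x) := by
  rw [skellam, logWeight, Real.exp_sub, Real.exp_log (besselI_pos _ hx), Real.exp_neg,
    div_eq_mul_inv, mul_comm]

lemma measure_singleton_of_map_increments {n : ℕ} {P : Measure (Fin n → ℤ)} {x : Fin n → ℝ}
    (hP : P.map increments = incrementLaw x) (hx : ∀ i, 0 < x i) (y : Fin n → ℤ) :
    P {y} = ENNReal.ofReal (Real.exp (∑ i, logWeight (increments y i).natAbs (x i))) := by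
  have h1 : P.map increments {increments y} = P {y} := by
    rw [Measure.map_apply .of_discrete (measurableSet_singleton _)]
    congr 1
    ext z
    simp [(increments_injective n).eq_iff]
  rw [← h1, hP, incrementLaw, Measure.pi_singleton, Real.exp_sum,
    ENNReal.ofReal_prod_of_nonneg fun i _ => (Real.exp_pos _).le]
  refine Finset.prod_congr rfl fun i _ => ?_
  rw [compoundLaw_singleton (hx i).le, skellam_eq_exp (hx i)]

lemma isProbabilityMeasure_of_map_increments {n : ℕ} {P : Measure (Fin n → ℤ)} {x : Fin n → ℝ}
    (hP : P.map increments = incrementLaw x) : IsProbabilityMeasure P := by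
  constructor
  rw [← Set.preimage_univ (f := increments (n := n)),
    ← Measure.map_apply .of_discrete MeasurableSet.univ, hP, incrementLaw, measure_univ]

/-- The likelihood ratio of two laws with independent compound Poisson increments. -/
lemma eq_withDensity_of_map_increments {n : ℕ} {P Q : Measure (Fin n → ℤ)} {x z : Fin n → ℝ}
    (hP : P.map increments = incrementLaw x) (hx : ∀ i, 0 < x i)
    (hQ : Q.map increments = incrementLaw z) (hz : ∀ i, 0 < z i) :
    Q = P.withDensity fun y => ENNReal.ofReal (Real.exp (∑ i,
      (logWeight (increments y i).natAbs (z i) - logWeight (increments y i).natAbs (x i)))) := by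
  refine Measure.ext_of_singleton fun y => ?_
  rw [withDensity_apply _ (measurableSet_singleton y), lintegral_singleton,
    measure_singleton_of_map_increments hP hx, measure_singleton_of_map_increments hQ hz,
    ← ENNReal.ofReal_mul (Real.exp_pos _).le, ← Real.exp_add, Finset.sum_sub_distrib,
    sub_add_cancel]

/-- Densities, central sequence and remainder depend on the observation only through its increments,
so both limit statements transfer from the product law. -/
theorem isLAN_of_increments {Θ : Set ℝ} {n : ℝ → ℕ} {P : ∀ T : ℝ, ℝ → Measure (Fin (n T) → ℤ)}
    {x : ∀ T : ℝ, ℝ → Fin (n T) → ℝ} {J : ℝ → ℝ} {ϑ : ℝ} (hϑ : ϑ ∈ Θ)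
    {a : ∀ T, Fin (n T) → ℝ}
    (hP : ∀ T > 0, ∀ θ ∈ Θ, (P T θ).map increments = incrementLaw (x T θ))
    (hx : ∀ T > 0, ∀ θ ∈ Θ, ∀ i, 0 < x T θ i) (hJ : ∀ᶠ T in atTop, 0 < J T)
    (hclt : ∀ g : BoundedContinuousFunction ℝ ℝ, Tendsto (fun T => ∫ k,
      g ((√(J T))⁻¹ * ∑ i, a T i * logScore (k i).natAbs (x T ϑ i)) ∂incrementLaw (x T ϑ))
      atTop (𝓝 (∫ y, g y ∂gaussianReal 0 1)))
    (hrem : ∀ v : ℝ, ∀ η > 0, Tendsto (fun T => incrementLaw (x T ϑ) {k | η ≤ |lanRemainder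
      (x T ϑ) (a T) (fun i => Real.log (x T (ϑ + v / √(J T)) i / x T ϑ i)) (v / √(J T)) v k|})
      (atTop ⊓ 𝓟 {T | ϑ + v / √(J T) ∈ Θ}) (𝓝 0)) :
    IsLAN Θ P J ϑ := by
  let ξ : ∀ T, (Fin (n T) → ℤ) → ℝ := fun T y =>
    (√(J T))⁻¹ * ∑ i, a T i * logScore (increments y i).natAbs (x T ϑ i)
  refine ⟨hJ, ξ, fun T => .of_discrete, fun g => ?_, fun v => ?_⟩
  · refine (hclt g).congr' ?_
    filter_upwards [eventually_gt_atTop 0] with T hT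
    rw [← hP T hT ϑ hϑ, integral_map Measurable.of_discrete.aemeasurable
      (Measurable.of_discrete).aestronglyMeasurable]
  -- Defined from the density itself, so the LAN exponent identity only needs positivity of the
  -- density; the work is to identify `r` almost everywhere with the explicit remainder.
  let r : ∀ T, (Fin (n T) → ℤ) → ℝ := fun T y =>
    Real.log ((P T (ϑ + v / √(J T))).rnDeriv (P T ϑ) y).toReal - v * ξ T y + v ^ 2 / 2
  have hden : ∀ T > 0, ϑ + v / √(J T) ∈ Θ → ∀ᵐ y ∂(P T ϑ),
      ((P T (ϑ + v / √(J T))).rnDeriv (P T ϑ) y).toReal = Real.exp (∑ i,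
        (logWeight (increments y i).natAbs (x T (ϑ + v / √(J T)) i) -
          logWeight (increments y i).natAbs (x T ϑ i))) := by
    intro T hT hθ
    have := isProbabilityMeasure_of_map_increments (hP T hT ϑ hϑ)
    have h1 := eq_withDensity_of_map_increments (hP T hT ϑ hϑ) (hx T hT ϑ hϑ) (hP T hT _ hθ)
      (hx T hT _ hθ)
    have h2 := Measure.rnDeriv_withDensity (P T ϑ) (f := fun y => ENNReal.ofReal (Real.exp (∑ i,
        (logWeight (increments y i).natAbs (x T (ϑ + v / √(J T)) i) -
          logWeight (increments y i).natAbs (x T ϑ i))))) .of_discrete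
    rw [← h1] at h2
    filter_upwards [h2] with y hy
    rw [hy, ENNReal.toReal_ofReal (Real.exp_pos _).le]
  refine ⟨r, fun T => .of_discrete, fun T hT hθ => ⟨?_, ?_⟩, fun δ hδ => ?_⟩
  · rw [eq_withDensity_of_map_increments (hP T hT ϑ hϑ) (hx T hT ϑ hϑ) (hP T hT _ hθ)
      (hx T hT _ hθ)]
    exact withDensity_absolutelyContinuous _ _
  · filter_upwards [hden T hT hθ] with y hy
    have : v * ξ T y - v ^ 2 / 2 + r T y =
      Real.log ((P T (ϑ + v / √(J T))).rnDeriv (P T ϑ) y).toReal := by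
      simp only [r]
      ring
    rw [this, Real.exp_log]
    rw [hy]
    exact Real.exp_pos _
  · refine (hrem v δ hδ).congr' ?_
    have hT0 : ∀ᶠ T in atTop ⊓ 𝓟 {T | ϑ + v / √(J T) ∈ Θ}, 0 < T :=
      (eventually_gt_atTop 0).filter_mono inf_le_left
    have hΘ : ∀ᶠ T in atTop ⊓ 𝓟 {T | ϑ + v / √(J T) ∈ Θ}, ϑ + v / √(J T) ∈ Θ :=
      (eventually_principal.2 fun _ h => h).filter_mono inf_le_right
    filter_upwards [hT0, hΘ] with T hT hθ
    rw [← hP T hT ϑ hϑ, Measure.map_apply .of_discrete .of_discrete]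
    refine measure_congr ?_
    filter_upwards [hden T hT hθ] with y hy
    have hr : r T y = lanRemainder (x T ϑ) (a T)
        (fun i => Real.log (x T (ϑ + v / √(J T)) i / x T ϑ i)) (v / √(J T)) v (increments y) := by
      simp only [r, hy, Real.log_exp, lanRemainder, ξ]
      have h1 : ∀ i, x T ϑ i * Real.exp (Real.log (x T (ϑ + v / √(J T)) i / x T ϑ i)) =
          x T (ϑ + v / √(J T)) i := fun i => by
        rw [Real.exp_log (div_pos (hx T hT _ hθ i) (hx T hT ϑ hϑ i)),
          mul_div_cancel₀ _ (hx T hT ϑ hϑ i).ne']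
      simp_rw [h1]
      ring
    exact congrArg (fun z => δ ≤ |z|) hr.symm

/-! ### The score of the intensity -/

section Score

variable {Θ : Set ℝ} {lam : ℝ → ℝ → ℝ} {ϑ : ℝ}

lemma ae_hasDerivWithinAt_log (hpos : ∀ θ ∈ Θ, ∀ s ∈ Set.Icc (0 : ℝ) 1, 0 < lam θ s)
    (hC1 : ∀ᵐ s ∂unitVolume, ContDiffOn ℝ 1 (fun θ => lam θ s) Θ) (hϑ : ϑ ∈ Θ) :
    ∀ᵐ s ∂unitVolume,
      HasDerivWithinAt (fun θ => Real.log (lam θ s)) (score Θ lam ϑ s) Θ ϑ := by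
  filter_upwards [hC1, ae_restrict_mem measurableSet_Icc] with s hs hmem
  exact ((hs.differentiableOn one_ne_zero ϑ hϑ).log (hpos ϑ hϑ s hmem).ne').hasDerivWithinAt

/-- Differentiate `exp (log λ(θ) - log λ(ϑ))` at `θ = ϑ`, where its value is one and its derivative
is the score. -/
lemma ae_tendsto_ratio (hpos : ∀ θ ∈ Θ, ∀ s ∈ Set.Icc (0 : ℝ) 1, 0 < lam θ s)
    (hC1 : ∀ᵐ s ∂unitVolume, ContDiffOn ℝ 1 (fun θ => lam θ s) Θ) (hϑ : ϑ ∈ Θ) :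
    ∀ᵐ s ∂unitVolume, Tendsto
      (fun θ => (lam θ s / lam ϑ s - 1 - (θ - ϑ) * score Θ lam ϑ s) / (θ - ϑ))
      (𝓝[Θ] ϑ) (𝓝 0) := by
  filter_upwards [ae_hasDerivWithinAt_log hpos hC1 hϑ, ae_restrict_mem measurableSet_Icc]
    with s hs hmem
  have h1 := (hs.sub_const (Real.log (lam ϑ s))).exp
  rw [hasDerivWithinAt_iff_isLittleO] at h1
  refine h1.tendsto_div_nhds_zero.congr' ?_
  filter_upwards [self_mem_nhdsWithin] with θ hθ
  rw [sub_self, Real.exp_zero, one_mul, smul_eq_mul, Real.exp_sub,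
    Real.exp_log (hpos θ hθ s hmem), Real.exp_log (hpos ϑ hϑ s hmem)]

/-- The score is an almost everywhere limit of difference quotients along one sequence in `Θ \ {ϑ}`.
Measurability passes to the limit, and so does the Lipschitz bound, whose countably many null sets
can be united. -/
lemma score_bound (hpos : ∀ θ ∈ Θ, ∀ s ∈ Set.Icc (0 : ℝ) 1, 0 < lam θ s)
    (hint : ∀ θ ∈ Θ, Integrable (lam θ) unitVolume)
    (hC1 : ∀ᵐ s ∂unitVolume, ContDiffOn ℝ 1 (fun θ => lam θ s) Θ) (hϑ : ϑ ∈ Θ) {K : ℝ}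
    (hK : 0 ≤ K) (hLip : ∀ᶠ θ in 𝓝[Θ] ϑ, ∀ᵐ s ∂unitVolume,
      |Real.log (lam θ s) - Real.log (lam ϑ s)| ≤ K * |θ - ϑ|) :
    AEStronglyMeasurable (score Θ lam ϑ) unitVolume ∧
      ∀ᵐ s ∂unitVolume, |score Θ lam ϑ s| ≤ K := by
  by_cases hacc : AccPt ϑ (𝓟 Θ)
  · have hne : (𝓝[Θ \ {ϑ}] ϑ).NeBot := by
      rw [accPt_principal_iff_nhdsWithin] at hacc
      exact hacc
    obtain ⟨u, hu⟩ := exists_seq_tendsto (𝓝[Θ \ {ϑ}] ϑ)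
    have huΘ : ∀ᶠ m in atTop, u m ∈ Θ \ {ϑ} := hu.eventually self_mem_nhdsWithin
    have huL : ∀ᶠ m in atTop, ∀ᵐ s ∂unitVolume,
        |Real.log (lam (u m) s) - Real.log (lam ϑ s)| ≤ K * |u m - ϑ| :=
      (hu.mono_right (nhdsWithin_mono _ Set.sdiff_subset)).eventually hLip
    obtain ⟨m₀, hm₀⟩ := (huΘ.and huL).exists_forall_of_atTop
    let w : ℕ → ℝ := fun m => u (m + m₀)
    have hw : Tendsto w atTop (𝓝[Θ \ {ϑ}] ϑ) := hu.comp (tendsto_add_atTop_nat m₀)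
    have hwm : ∀ m, w m ∈ Θ \ {ϑ} := fun m => (hm₀ (m + m₀) (by omega)).1
    have hwL : ∀ᵐ s ∂unitVolume, ∀ m,
        |Real.log (lam (w m) s) - Real.log (lam ϑ s)| ≤ K * |w m - ϑ| :=
      ae_all_iff.2 fun m => (hm₀ (m + m₀) (by omega)).2
    have hlim : ∀ᵐ s ∂unitVolume, Tendsto
        (fun m => (w m - ϑ)⁻¹ * (Real.log (lam (w m) s) - Real.log (lam ϑ s))) atTop
        (𝓝 (score Θ lam ϑ s)) := by
      filter_upwards [ae_hasDerivWithinAt_log hpos hC1 hϑ] with s hs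
      have := (hasDerivWithinAt_iff_tendsto_slope.1 hs).comp hw
      simpa [Function.comp_def, slope_def_module] using this
    refine ⟨aestronglyMeasurable_of_tendsto_ae atTop (fun m => ?_) hlim, ?_⟩
    · have h1 := (hint _ (hwm m).1).aestronglyMeasurable.aemeasurable
      have h2 := (hint _ hϑ).aestronglyMeasurable.aemeasurable
      exact ((h1.log.sub h2.log).const_mul _).aestronglyMeasurable
    · filter_upwards [hlim, hwL] with s h1 h2
      refine le_of_tendsto (continuous_abs.continuousAt.tendsto.comp h1) (.of_forall fun m => ?_)
      have hne : 0 < |w m - ϑ| := abs_pos.2 (sub_ne_zero.2 (hwm m).2)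
      simp only [Function.comp_apply]
      rw [abs_mul, abs_inv, inv_mul_le_iff₀ hne, mul_comm]
      exact h2 m
  -- At a point that is not an accumulation point of `Θ`, `derivWithin` is zero by convention.
  · have h0 : score Θ lam ϑ = fun _ => 0 := funext fun s => derivWithin_zero_of_not_accPt hacc
    rw [h0]
    exact ⟨aestronglyMeasurable_const, .of_forall fun s => by simpa using hK⟩

end Score

/-- The change of variables `s ↦ s / T` turns sampling cells into blocks of length `Δ / T` of the
unit interval. -/
lemma gridMeans_cumIntensity {lam : ℝ → ℝ → ℝ} {θ T Δ : ℝ} (hint : Integrable (lam θ) unitVolume)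
    (hT : 0 < T) (hΔ : 0 < Δ) {n : ℕ} (hn : n * (Δ / T) ≤ 1) (i : Fin n) :
    gridMeans (cumIntensity lam T θ) Δ n i = Δ * blockAvg (lam θ) (Δ / T) i := by
  have hb : 0 < Δ / T := div_pos hΔ hT
  have hI : ∀ j : ℕ, j ≤ n → IntervalIntegrable (fun s => lam θ (s / T)) volume 0 (j * Δ) := by
    intro j hj
    have h1 : IntervalIntegrable (lam θ) volume 0 (j * (Δ / T)) := by
      rw [intervalIntegrable_iff_integrableOn_Icc_of_le (by positivity)]
      refine IntegrableOn.mono_set hint (Set.Icc_subset_Icc le_rfl (le_trans ?_ hn))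
      gcongr
    have h2 := IntervalIntegrable.comp_mul_right h1 (c := T⁻¹)
    have h3 : (j : ℝ) * (Δ / T) / T⁻¹ = j * Δ := by field_simp
    rw [zero_div, h3] at h2
    simpa only [div_eq_mul_inv] using h2
  have h1 := hI (i + 1) (by omega)
  push_cast at h1
  rw [gridMeans, cumIntensity, cumIntensity,
    intervalIntegral.integral_interval_sub_left h1 (hI i i.2.le),
    intervalIntegral.integral_comp_div (fun s => lam θ s) hT.ne', blockAvg, smul_eq_mul]
  have e : ∀ c : ℝ, c * Δ / T = c * (Δ / T) := fun c => by ring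
  rw [e, e]
  field_simp

/-! ### Regularity of the experiments -/

section Regularity

variable {Θ : Set ℝ} {lam : ℝ → ℝ → ℝ} {ϑ M C : ℝ} {Δ : ℝ → ℝ}

lemma floor_mul_le {T Δ : ℝ} (hT : 0 < T) (hΔ : 0 < Δ) : (⌊T / Δ⌋₊ : ℝ) * (Δ / T) ≤ 1 := by
  have h1 := Nat.floor_le (div_pos hT hΔ).le
  calc (⌊T / Δ⌋₊ : ℝ) * (Δ / T) ≤ (T / Δ) * (Δ / T) := by gcongr
    _ = 1 := by field_simp

lemma tendsto_floor_mul (hΔ : ∀ T > 0, 0 < Δ T ∧ Δ T ≤ T)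
    (hb : Tendsto (fun T => Δ T / T) atTop (𝓝[>] 0)) :
    Tendsto (fun T => (⌊T / Δ T⌋₊ : ℝ) * (Δ T / T)) atTop (𝓝 1) := by
  have h1 : Tendsto (fun T => 1 - Δ T / T) atTop (𝓝 1) := by
    simpa using (hb.mono_right nhdsWithin_le_nhds).const_sub 1
  refine tendsto_of_tendsto_of_tendsto_of_le_of_le' h1 tendsto_const_nhds ?_ ?_
  · filter_upwards [eventually_gt_atTop 0] with T hT
    have hΔT := (hΔ T hT).1
    have h2 := Nat.lt_floor_add_one (T / Δ T)
    have h3 : (T / Δ T) * (Δ T / T) = 1 := by field_simp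
    have h4 : 0 < Δ T / T := div_pos hΔT hT
    nlinarith
  · filter_upwards [eventually_gt_atTop 0] with T hT
    exact floor_mul_le hT (hΔ T hT).1

/-- Positivity of the asymptotic information. -/
lemma integral_score_pos {f σ φ : ℝ → ℝ} (hfpos : ∀ s ∈ Set.Icc (0 : ℝ) 1, 0 < f s)
    (hφ : ∀ y > 0, 0 < φ y) (hint : Integrable (fun s => φ (f s) * σ s ^ 2) unitVolume)
    (hne : ¬ ∀ᵐ s ∂unitVolume, σ s = 0) : 0 < ∫ s in (0 : ℝ)..1, φ (f s) * σ s ^ 2 := by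
  rw [intervalIntegral.integral_of_le zero_le_one, ← integral_Icc_eq_integral_Ioc]
  have h0 : 0 ≤ᵐ[unitVolume] fun s => φ (f s) * σ s ^ 2 := by
    filter_upwards [ae_restrict_mem measurableSet_Icc] with s hs
    exact mul_nonneg (hφ _ (hfpos s hs)).le (sq_nonneg _)
  refine lt_of_le_of_ne (integral_nonneg_of_ae h0) fun h => hne ?_
  filter_upwards [(integral_eq_zero_iff_of_nonneg_ae h0 hint).1 h.symm,
    ae_restrict_mem measurableSet_Icc] with s h1 hs
  have := (hφ _ (hfpos s hs)).ne'
  simpa [this] using h1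

/-- The scale `c` is the order of the information in one increment, so `ρ = c / (Δ/T)` is that of
the total information. The hypothesis `hmin` supplies the domination and bounds `∑ min 1 x_i` by a
multiple of `ρ`; `hφ` identifies the limit integrand. -/
theorem isRegularWithInformation_of_regime
    (hpos : ∀ θ ∈ Θ, ∀ s ∈ Set.Icc (0 : ℝ) 1, 0 < lam θ s)
    (hint : ∀ θ ∈ Θ, Integrable (lam θ) unitVolume)
    (hC1 : ∀ᵐ s ∂unitVolume, ContDiffOn ℝ 1 (fun θ => lam θ s) Θ)
    (hM : ∀ θ ∈ Θ, ∀ s ∈ Set.Icc (0 : ℝ) 1, lam θ s ≤ M)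
    (hΔ : ∀ T > 0, 0 < Δ T ∧ Δ T ≤ T)
    {P : ∀ T : ℝ, ℝ → Measure (Fin ⌊T / Δ T⌋₊ → ℤ)}
    (hP : ∀ T > 0, ∀ θ ∈ Θ, (P T θ).map increments =
      incrementLaw (gridMeans (cumIntensity lam T θ) (Δ T) ⌊T / Δ T⌋₊))
    (hϑ : ϑ ∈ Θ)
    (hLip : ∃ K : ℝ, ∀ᶠ θ in 𝓝[Θ] ϑ, ∀ᵐ s ∂unitVolume,
      |Real.log (lam θ s) - Real.log (lam ϑ s)| ≤ K * |θ - ϑ|)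
    (hne : ¬ ∀ᵐ s ∂unitVolume, score Θ lam ϑ s = 0)
    {c : ℝ → ℝ} {φ : ℝ → ℝ} (hb : Tendsto (fun T => Δ T / T) atTop (𝓝[>] 0))
    (hc : ∀ᶠ T in atTop, 0 < c T) (hρ : Tendsto (fun T => c T / (Δ T / T)) atTop atTop)
    (hmin : ∀ᶠ T in atTop, ∀ y, 0 < y → y ≤ M → min 1 (Δ T * y) ≤ C * c T)
    (hφ : ∀ y > 0, ∀ Y : ℝ → ℝ, Tendsto Y atTop (𝓝 y) →
      Tendsto (fun T => scoreInfo (Δ T * Y T) / c T) atTop (𝓝 (φ y)))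
    (hφpos : ∀ y > 0, 0 < φ y) {I : ℝ → ℝ}
    (hI : ∀ᶠ T in atTop, I T = c T / (Δ T / T) *
      ∫ s in (0 : ℝ)..1, φ (lam ϑ s) * score Θ lam ϑ s ^ 2) :
    IsRegularWithInformation Θ P I ϑ := by
  obtain ⟨K₀, hK₀⟩ := hLip
  set K := |K₀|
  have hK : 0 ≤ K := abs_nonneg _
  have hLip : ∀ᶠ θ in 𝓝[Θ] ϑ, ∀ᵐ s ∂unitVolume,
      |Real.log (lam θ s) - Real.log (lam ϑ s)| ≤ K * |θ - ϑ| := by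
    filter_upwards [hK₀] with θ hθ
    filter_upwards [hθ] with s hs
    exact hs.trans (mul_le_mul_of_nonneg_right (le_abs_self _) (abs_nonneg _))
  obtain ⟨hσ, hσK⟩ := score_bound hpos hint hC1 hϑ hK hLip
  set σ := score Θ lam ϑ
  set f := lam ϑ
  have hf := hint ϑ hϑ
  have hfpos := hpos ϑ hϑ
  have hfM := hM ϑ hϑ
  let b : ℝ → ℝ := fun T => Δ T / T
  let n : ℝ → ℕ := fun T => ⌊T / Δ T⌋₊
  have hn0 : ∀ T > 0, n T * b T ≤ 1 := fun T hT => floor_mul_le hT (hΔ T hT).1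
  have hn : ∀ᶠ T in atTop, n T * b T ≤ 1 := (eventually_gt_atTop 0).mono hn0
  have hn' : Tendsto (fun T => n T * b T) atTop (𝓝 1) := tendsto_floor_mul hΔ hb
  have hb0 : ∀ T > 0, 0 < b T := fun T hT => div_pos (hΔ T hT).1 hT
  have hD : ∀ᶠ T in atTop, 0 < Δ T := (eventually_gt_atTop 0).mono fun T hT => (hΔ T hT).1
  obtain ⟨hGint, hG⟩ := tendsto_sum_scoreInfo (D := Δ) hb hn hn' hf hfpos hfM hσ hσK hD hc hmin hφ
  have hpos_c := integral_score_pos hfpos hφpos hGint hne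
  set c₀ := ∫ s in (0 : ℝ)..1, φ (f s) * σ s ^ 2
  let ρ : ℝ → ℝ := fun T => c T / b T
  have hx : ∀ T > 0, ∀ θ ∈ Θ, ∀ i, gridMeans (cumIntensity lam T θ) (Δ T) (n T) i =
      Δ T * blockAvg (lam θ) (b T) i := fun T hT θ hθ i =>
    gridMeans_cumIntensity (hint θ hθ) hT (hΔ T hT).1 (hn0 T hT) i
  have hL : ∀ T > 0, ∀ θ ∈ Θ, ∀ i < n T, 0 < blockAvg (lam θ) (b T) i := fun T hT θ hθ i hi =>
    blockAvg_pos (hint θ hθ) (hpos θ hθ) (hb0 T hT) (hn0 T hT) hi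
  have hxpos : ∀ T > 0, ∀ θ ∈ Θ, ∀ i,
      0 < gridMeans (cumIntensity lam T θ) (Δ T) (n T) i := fun T hT θ hθ i => by
    rw [hx T hT θ hθ]
    exact mul_pos (hΔ T hT).1 (hL T hT θ hθ i i.2)
  intro J hJI
  have hρpos : ∀ᶠ T in atTop, 0 < ρ T := hρ.eventually_gt_atTop 0
  -- The only use of the equivalence of `J` with `I`: afterwards only `J / ρ → c₀ > 0` matters.
  have hratio : Tendsto (fun T => J T / ρ T) atTop (𝓝 c₀) := by
    have hIne : ∀ᶠ T in atTop, I T ≠ 0 := by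
      filter_upwards [hI, hρpos] with T h1 h2
      rw [h1]
      exact (mul_pos h2 hpos_c).ne'
    have h1 := ((isEquivalent_iff_tendsto_one hIne).1 hJI).mul_const c₀
    rw [one_mul] at h1
    refine h1.congr' ?_
    filter_upwards [hI, hρpos] with T h2 h3
    have h3' : c T / (Δ T / T) = ρ T := rfl
    rw [Pi.div_apply, h2, h3']
    field_simp
  have hJρ : ∀ᶠ T in atTop, c₀ / 2 * ρ T ≤ J T := by
    filter_upwards [hratio.eventually_const_le (half_lt_self hpos_c), hρpos] with T h1 h2
    rwa [le_div_iff₀ h2] at h1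
  have hJ : Tendsto J atTop atTop :=
    tendsto_atTop_mono' _ hJρ (hρ.const_mul_atTop (half_pos hpos_c))
  have hJpos : ∀ᶠ T in atTop, 0 < J T := hJ.eventually_gt_atTop 0
  have hratio' : Tendsto (fun T => ρ T / J T) atTop (𝓝 c₀⁻¹) := by
    simpa using hratio.inv₀ hpos_c.ne'
  have hm1 : ∀ᶠ T in atTop, ∀ i : Fin (n T),
      min 1 (gridMeans (cumIntensity lam T ϑ) (Δ T) (n T) i) ≤ C * c T := by
    filter_upwards [hmin, eventually_gt_atTop 0] with T h1 hT i
    rw [hx T hT ϑ hϑ]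
    exact h1 _ (hL T hT ϑ hϑ i i.2) (blockAvg_le_of_le hf hfM (hb0 T hT) (hn0 T hT) i.2)
  have hm : ∀ᶠ T in atTop, ∑ i : Fin (n T),
      min 1 (gridMeans (cumIntensity lam T ϑ) (Δ T) (n T) i) ≤ |C| * (2 / c₀) * J T := by
    filter_upwards [hm1, hJρ, hc, eventually_gt_atTop 0] with T h1 h2 h3 hT
    have hbT := hb0 T hT
    calc ∑ i : Fin (n T), min 1 (gridMeans (cumIntensity lam T ϑ) (Δ T) (n T) i)
        ≤ ∑ _i : Fin (n T), |C| * c T := by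
          refine Finset.sum_le_sum fun i _ => (h1 i).trans ?_
          gcongr
          exact le_abs_self C
      _ = |C| * ρ T * (n T * b T) := by
          rw [Finset.sum_const, Finset.card_univ, Fintype.card_fin, nsmul_eq_mul]
          simp only [ρ]
          field_simp
      _ ≤ |C| * ρ T * 1 := by
          have := hn0 T hT
          have h4 : 0 ≤ ρ T := (div_pos h3 hbT).le
          gcongr
      _ = |C| * (2 / c₀) * (c₀ / 2 * ρ T) := by field_simp
      _ ≤ _ := by gcongr
  have hinfo : Tendsto (fun T => (J T)⁻¹ * ∑ i : Fin (n T),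
      scoreInfo (gridMeans (cumIntensity lam T ϑ) (Δ T) (n T) i) *
        blockScore f σ (b T) i ^ 2) atTop (𝓝 1) := by
    have h1 := hratio'.mul hG
    rw [inv_mul_cancel₀ hpos_c.ne'] at h1
    refine h1.congr' ?_
    filter_upwards [hc, eventually_gt_atTop 0] with T h3 hT
    rw [Finset.mul_sum, Finset.mul_sum]
    refine Finset.sum_congr rfl fun i _ => ?_
    have hbT : b T ≠ 0 := (hb0 T hT).ne'
    have e1 : Δ T / T = b T := rfl
    rw [hx T hT ϑ hϑ, e1]
    simp only [ρ]
    field_simp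
    rfl
  have hh : ∀ v : ℝ, Tendsto (fun T => v / √(J T)) atTop (𝓝 0) := fun v =>
    tendsto_const_nhds.div_atTop (Real.tendsto_sqrt_atTop.comp hJ)
  refine isLAN_of_increments (a := fun T i => blockScore f σ (b T) i) hϑ hP hxpos hJpos ?_ ?_
  · intro g
    refine tendsto_integral_centralSequence (K := K) ?_ hJ hm ?_ hinfo g
    · exact (eventually_gt_atTop 0).mono fun T hT => hxpos T hT ϑ hϑ
    · filter_upwards [eventually_gt_atTop 0] with T hT i
      exact abs_blockScore_le hf hfpos hσ hσK (hb0 T hT) (hn0 T hT) i.2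
  · intro v η hη
    set l := atTop ⊓ 𝓟 {T | ϑ + v / √(J T) ∈ Θ} with hl
    rcases l.eq_or_neBot with hbot | hne
    -- If the perturbed parameter eventually leaves `Θ`, the restricted filter is trivial and the
    -- claim is vacuous; otherwise it is nontrivial, as limits of block sums require.
    · rw [hbot]; exact tendsto_bot
    have hle : l ≤ atTop := inf_le_left
    have hΘ : ∀ᶠ T in l, ϑ + v / √(J T) ∈ Θ :=
      (eventually_principal.2 fun _ h => h).filter_mono inf_le_right
    have hθ : Tendsto (fun T => ϑ + v / √(J T)) l (𝓝[Θ] ϑ) :=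
      tendsto_nhdsWithin_iff.2 ⟨by simpa using ((hh v).mono_left hle).const_add ϑ, hΘ⟩
    have hT0 : ∀ᶠ T in l, 0 < T := (eventually_gt_atTop 0).filter_mono hle
    have hlip' : ∀ᶠ T in l, ∀ᵐ s ∂unitVolume,
        |Real.log (lam (ϑ + v / √(J T)) s) - Real.log (f s)| ≤ K * |v / √(J T)| := by
      filter_upwards [hθ.eventually hLip] with T hT
      simpa using hT
    obtain ⟨A, hA, hAle⟩ := exists_sum_sq_log_ratio_le (l := l) (b := b) (n := n)
      (g := fun T => lam (ϑ + v / √(J T))) (h := fun T => v / √(J T)) (hb.mono_left hle)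
      (hn.filter_mono hle) (hn'.mono_left hle) hf hfpos hσ hK hσK ((hh v).mono_left hle)
      (hΘ.mono fun T hT => hint _ hT) (hΘ.mono fun T hT => hpos _ hT) hlip'
      (.of_forall fun T h0 => by simp [h0]) (by
        filter_upwards [ae_tendsto_ratio hpos hC1 hϑ] with s hs
        simpa [Function.comp_def] using hs.comp hθ)
    have hratios : ∀ᶠ T in l, ∀ i : Fin (n T),
        gridMeans (cumIntensity lam T (ϑ + v / √(J T))) (Δ T) (n T) i /
          gridMeans (cumIntensity lam T ϑ) (Δ T) (n T) i =
        blockAvg (lam (ϑ + v / √(J T))) (b T) i / blockAvg f (b T) i := by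
      filter_upwards [hT0, hΘ] with T hT hTΘ i
      rw [hx T hT _ hTΘ, hx T hT ϑ hϑ, mul_div_mul_left _ _ (hΔ T hT).1.ne']
    refine tendsto_measure_lanRemainder (K := K) hK ?_ (hJ.mono_left hle) (hm.filter_mono hle)
      ?_ (hinfo.mono_left hle) ?_ hη
    · exact hT0.mono fun T hT => hxpos T hT ϑ hϑ
    · filter_upwards [hT0, hΘ, hlip', hratios] with T hT hTΘ hl hr i
      rw [hr]
      exact abs_log_blockAvg_div_le hf (hint _ hTΘ) hfpos (hpos _ hTΘ) hl (hb0 T hT) (hn0 T hT) i.2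
    -- Bounding `min 1 x_i` by `|C| ρ b` produces the weighted block sum of squared linearisation
    -- errors; its factor `h² = v² / J` compensates `ρ`.
    · have hlim : Tendsto (fun T => |C| * v ^ 2 * (ρ T / J T) * A T) l (𝓝 0) := by
        simpa using ((hratio'.mono_left hle).const_mul (|C| * v ^ 2)).mul hA
      refine tendsto_of_tendsto_of_tendsto_of_le_of_le' tendsto_const_nhds hlim ?_ ?_
      · filter_upwards [hT0] with T hT
        exact Finset.sum_nonneg fun i _ =>
          mul_nonneg (le_min zero_le_one (hxpos T hT ϑ hϑ i).le) (sq_nonneg _)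
      · filter_upwards [hT0, hAle, hratios, hm1.filter_mono hle, hc.filter_mono hle,
          hJpos.filter_mono hle] with T hT h1 hr h2 h3 h4
        have hbT := hb0 T hT
        have hρT : 0 ≤ ρ T := (div_pos h3 hbT).le
        calc _ ≤ ∑ i : Fin (n T), |C| * ρ T * (b T *
              (Real.log (blockAvg (lam (ϑ + v / √(J T))) (b T) i / blockAvg f (b T) i) -
                v / √(J T) * blockScore f σ (b T) i) ^ 2) := by
              refine Finset.sum_le_sum fun i _ => ?_
              rw [hr]
              have h5 : |C| * c T = |C| * ρ T * b T := by
                simp only [ρ]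
                field_simp
              rw [← mul_assoc, ← h5]
              refine mul_le_mul_of_nonneg_right ((h2 i).trans ?_) (sq_nonneg _)
              gcongr
              exact le_abs_self C
          _ ≤ |C| * ρ T * ((v / √(J T)) ^ 2 * A T) := by
              rw [← Finset.mul_sum]
              gcongr
          _ = |C| * v ^ 2 * (ρ T / J T) * A T := by
              rw [div_pow, Real.sq_sqrt h4.le]
              ring

end Regularity

/-! ### The three regimes -/

lemma scoreInfo_div_eq {D y : ℝ} (hD : 0 < D) (hy : 0 < y) :
    D * (y ^ 2 * besselInfo (y * D)) = scoreInfo (y * D) / D := by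
  rw [scoreInfo_eq (mul_pos hy hD)]
  field_simp

lemma infoInter_eq {Θ : Set ℝ} {lam : ℝ → ℝ → ℝ} {ϑ D : ℝ}
    (hpos : ∀ s ∈ Set.Icc (0 : ℝ) 1, 0 < lam ϑ s) (hD : 0 < D) (T : ℝ) :
    infoInter Θ lam D T ϑ =
      T * ∫ s in (0 : ℝ)..1, scoreInfo (lam ϑ s * D) / D * score Θ lam ϑ s ^ 2 := by
  rw [infoInter, mul_assoc, ← intervalIntegral.integral_const_mul]
  congr 1
  refine intervalIntegral.integral_congr fun s hs => ?_
  rw [Set.uIcc_of_le zero_le_one] at hs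
  rw [← scoreInfo_div_eq hD (hpos s hs)]
  ring

/-- Dominated convergence: `G(λ D) / D → λ` pointwise, and `G(x) ≤ x + x²` bounds the integrand for
`D ≤ 1`. -/
lemma tendsto_infoInter {Θ : Set ℝ} {lam : ℝ → ℝ → ℝ} {ϑ K M : ℝ}
    (hf : Integrable (lam ϑ) unitVolume) (hpos : ∀ s ∈ Set.Icc (0 : ℝ) 1, 0 < lam ϑ s)
    (hM : ∀ s ∈ Set.Icc (0 : ℝ) 1, lam ϑ s ≤ M)
    (hσ : AEStronglyMeasurable (score Θ lam ϑ) unitVolume)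
    (hσK : ∀ᵐ s ∂unitVolume, |score Θ lam ϑ s| ≤ K) (T : ℝ) :
    Tendsto (fun D => infoInter Θ lam D T ϑ) (𝓝[>] 0) (𝓝 (infoMicro Θ lam T ϑ)) := by
  have hD0 : ∀ᶠ D : ℝ in 𝓝[>] 0, 0 < D := self_mem_nhdsWithin
  have hD1 : ∀ᶠ D : ℝ in 𝓝[>] 0, D ≤ 1 :=
    (tendsto_id.mono_left nhdsWithin_le_nhds).eventually_le_const one_pos
  -- Continuity of the information is available only on `(0, ∞)`; extending by zero gives a function
  -- measurable on the whole line.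
  have hS : Measurable ((Set.Ioi (0 : ℝ)).piecewise scoreInfo fun _ => 0) :=
    continuousOn_scoreInfo.measurable_piecewise continuousOn_const measurableSet_Ioi
  have h1 : Tendsto (fun D => ∫ s, scoreInfo (lam ϑ s * D) / D * score Θ lam ϑ s ^ 2 ∂unitVolume)
      (𝓝[>] 0) (𝓝 (∫ s, lam ϑ s * score Θ lam ϑ s ^ 2 ∂unitVolume)) := by
    refine tendsto_integral_filter_of_dominated_convergence (fun _ => (M + M ^ 2) * K ^ 2) ?_ ?_
      (integrable_const _) ?_
    · filter_upwards [hD0] with D hD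
      have h2 : AEMeasurable (fun s => (Set.Ioi (0 : ℝ)).piecewise scoreInfo (fun _ => 0)
          (lam ϑ s * D)) unitVolume :=
        hS.comp_aemeasurable (hf.aestronglyMeasurable.aemeasurable.mul_const D)
      have h3 : AEMeasurable (fun s => scoreInfo (lam ϑ s * D)) unitVolume := by
        refine h2.congr ?_
        filter_upwards [ae_restrict_mem measurableSet_Icc] with s hs
        exact Set.piecewise_eq_of_mem _ _ _ (mul_pos (hpos s hs) hD)
      exact ((h3.div_const D).mul (hσ.aemeasurable.pow_const 2)).aestronglyMeasurable
    · filter_upwards [hD0, hD1] with D hD hD'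
      filter_upwards [hσK, ae_restrict_mem measurableSet_Icc] with s hs hmem
      have hp := hpos s hmem
      have hle := hM s hmem
      have h2 : scoreInfo (lam ϑ s * D) / D ≤ M + M ^ 2 := by
        rw [div_le_iff₀ hD]
        refine (scoreInfo_le (mul_pos hp hD)).trans ?_
        have h4 : lam ϑ s ^ 2 ≤ M ^ 2 := by gcongr
        have h5 : (lam ϑ s * D) ^ 2 ≤ M ^ 2 * D := by
          rw [mul_pow]
          have : D ^ 2 ≤ D := by nlinarith
          gcongr
        nlinarith
      have h0 : 0 ≤ scoreInfo (lam ϑ s * D) / D := div_nonneg (scoreInfo_nonneg _) hD.le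
      rw [Real.norm_eq_abs, abs_mul, abs_of_nonneg h0, abs_pow]
      gcongr
      exact h0.trans h2
    · filter_upwards [ae_restrict_mem measurableSet_Icc] with s hs
      have hp := hpos s hs
      refine Tendsto.mul_const _ ?_
      have h2 : Tendsto (fun D => lam ϑ s * D) (𝓝[>] 0) (𝓝[>] 0) := by
        refine tendsto_nhdsWithin_iff.2 ⟨?_, hD0.mono fun D hD => mul_pos hp hD⟩
        have : Tendsto (fun D : ℝ => lam ϑ s * D) (𝓝 0) (𝓝 (lam ϑ s * 0)) :=
          tendsto_id.const_mul _
        rw [mul_zero] at this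
        exact this.mono_left nhdsWithin_le_nhds
      have h3 := (tendsto_scoreInfo_div.comp h2).const_mul (lam ϑ s)
      rw [mul_one] at h3
      refine h3.congr' ?_
      filter_upwards [hD0] with D hD
      simp only [Function.comp_apply]
      field_simp
  have h2 := h1.const_mul T
  have e : infoMicro Θ lam T ϑ = T * ∫ s, lam ϑ s * score Θ lam ϑ s ^ 2 ∂unitVolume := by
    rw [infoMicro, intervalIntegral.integral_of_le zero_le_one, ← integral_Icc_eq_integral_Ioc]
    simp_rw [mul_comm]
  rw [e]
  refine h2.congr' ?_
  filter_upwards [hD0] with D hD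
  rw [infoInter_eq hpos hD, intervalIntegral.integral_of_le zero_le_one,
    ← integral_Icc_eq_integral_Ioc]

end TimeScales

end

/-! ### The three sampling regimes: choice of scale and profile. -/

theorem theorem7
    (Θ : Set ℝ) (hΘ : Θ ⊆ Set.Ioi 0) (hΘint : (interior Θ).Nonempty)
    (lam : ℝ → ℝ → ℝ)
    (hpos : ∀ θ ∈ Θ, ∀ s ∈ Set.Icc (0 : ℝ) 1, 0 < lam θ s)
    (hint : ∀ θ ∈ Θ, IntegrableOn (lam θ) (Set.Icc (0 : ℝ) 1))
    (hC1 : ∀ᵐ s ∂(volume.restrict (Set.Icc (0 : ℝ) 1)), ContDiffOn ℝ 1 (fun θ => lam θ s) Θ)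
    (hbdd : ∃ M : ℝ, ∀ θ ∈ Θ, ∀ s ∈ Set.Icc (0 : ℝ) 1, lam θ s ≤ M)
    (Δ : ℝ → ℝ) (hΔ : ∀ T > 0, 0 < Δ T ∧ Δ T ≤ T)
    {Ω : ℝ → ℝ → Type*} [∀ T θ, MeasurableSpace (Ω T θ)]
    (μ : ∀ T θ, Measure (Ω T θ)) (N : ∀ T θ, ℝ → Ω T θ → ℕ) (ε : ∀ T θ, ℕ → Ω T θ → ℤ)
    (hX : ∀ T > 0, ∀ θ ∈ Θ, TimeScales.IsCompoundPoissonModel (μ T θ) T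
      (TimeScales.cumIntensity lam T θ) (N T θ) (ε T θ))
    (ϑ : ℝ) (hϑ : ϑ ∈ Θ)
    (hLip : ∃ K : ℝ, ∀ᶠ θ in 𝓝[Θ] ϑ, ∀ᵐ s ∂(volume.restrict (Set.Icc (0 : ℝ) 1)),
      |Real.log (lam θ s) - Real.log (lam ϑ s)| ≤ K * |θ - ϑ|)
    (hne : ¬ ∀ᵐ s ∂(volume.restrict (Set.Icc (0 : ℝ) 1)), TimeScales.score Θ lam ϑ s = 0) :
    -- the microscopic regime
    (Tendsto Δ atTop (𝓝 0) →
      TimeScales.IsRegularWithInformation Θ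
        (fun T θ => TimeScales.observationLaw (μ T θ) (N T θ) (ε T θ) T (Δ T))
        (fun T => TimeScales.infoMicro Θ lam T ϑ) ϑ) ∧
    (∀ T > 0, Tendsto (fun D => TimeScales.infoInter Θ lam D T ϑ) (𝓝[>] 0)
        (𝓝 (TimeScales.infoMicro Θ lam T ϑ))) ∧
    -- the intermediate regime
    (∀ Δinf > 0, Tendsto Δ atTop (𝓝 Δinf) →
      TimeScales.IsRegularWithInformation Θ
        (fun T θ => TimeScales.observationLaw (μ T θ) (N T θ) (ε T θ) T (Δ T))
        (fun T => TimeScales.infoInter Θ lam Δinf T ϑ) ϑ) ∧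
    -- the macroscopic regime
    (Tendsto Δ atTop atTop → Tendsto (fun T => T / Δ T) atTop atTop →
      (fun T => T / Δ T ^ (1 + 1 / 4 : ℝ)) =o[atTop]
        (fun T => Real.log (T / Δ T) ^ (-(1 / 4) : ℝ)) →
      TimeScales.IsRegularWithInformation Θ
        (fun T θ => TimeScales.observationLaw (μ T θ) (N T θ) (ε T θ) T (Δ T))
        (fun T => TimeScales.infoMacro Θ lam (Δ T) T ϑ) ϑ) := by
  obtain ⟨M, hM⟩ := hbdd
  have hP : ∀ T > 0, ∀ θ ∈ Θ, (TimeScales.observationLaw (μ T θ) (N T θ) (ε T θ) T (Δ T)).map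
      TimeScales.increments = TimeScales.incrementLaw (TimeScales.gridMeans
        (TimeScales.cumIntensity lam T θ) (Δ T) ⌊T / Δ T⌋₊) := fun T hT θ hθ =>
    (hX T hT θ hθ).map_increments_observationLaw hT (hΔ T hT).1
  have hf := hpos ϑ hϑ
  have hDpos : ∀ᶠ T in atTop, 0 < Δ T := (eventually_gt_atTop 0).mono fun T hT => (hΔ T hT).1
  have hbpos : ∀ᶠ T in atTop, 0 < Δ T / T :=
    (eventually_gt_atTop 0).mono fun T hT => div_pos (hΔ T hT).1 hT
  refine ⟨fun hD => ?_, fun T hT => ?_, fun Δinf hinf hD => ?_, fun hD hTD _ => ?_⟩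
  -- For small cells the information of an increment is asymptotic to its mean, so `c = Δ`, `φ(y) =
  -- y` and `ρ = T`.
  · refine TimeScales.isRegularWithInformation_of_regime (c := Δ) (φ := id) (C := M) hpos hint hC1
      hM hΔ hP hϑ hLip hne ?_ hDpos ?_ ?_ ?_ ?_ ?_
    · exact tendsto_nhdsWithin_iff.2 ⟨hD.div_atTop tendsto_id, hbpos⟩
    · refine tendsto_id.congr' ?_
      filter_upwards [eventually_gt_atTop 0, hDpos] with T hT h
      simp only [id]
      field_simp
    · filter_upwards [hDpos] with T h y _ hyM
      refine (min_le_right _ _).trans ?_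
      rw [mul_comm M]
      gcongr
    · intro y hy Y hY
      have hYpos : ∀ᶠ T in atTop, 0 < Y T := hY.eventually_const_lt hy
      have h1 : Tendsto (fun T => Δ T * Y T) atTop (𝓝[>] 0) := by
        refine tendsto_nhdsWithin_iff.2 ⟨by simpa using hD.mul hY, ?_⟩
        filter_upwards [hDpos, hYpos] with T h2 h3 using mul_pos h2 h3
      have h2 := (TimeScales.tendsto_scoreInfo_div.comp h1).mul hY
      rw [one_mul] at h2
      refine h2.congr' ?_
      filter_upwards [hDpos, hYpos] with T h3 h4
      simp only [Function.comp_apply]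
      field_simp
    · exact fun y hy => hy
    · filter_upwards [eventually_gt_atTop 0, hDpos] with T hT h
      have e : Δ T / (Δ T / T) = T := by field_simp
      rw [e, TimeScales.infoMicro]
      simp only [id, mul_comm]
  · obtain ⟨K, hK⟩ := hLip
    have hK' : ∀ᶠ θ in 𝓝[Θ] ϑ, ∀ᵐ s ∂(volume.restrict (Set.Icc (0 : ℝ) 1)),
        |Real.log (lam θ s) - Real.log (lam ϑ s)| ≤ |K| * |θ - ϑ| := by
      filter_upwards [hK] with θ hθ
      filter_upwards [hθ] with s hs
      exact hs.trans (mul_le_mul_of_nonneg_right (le_abs_self _) (abs_nonneg _))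
    obtain ⟨hσ, hσK⟩ := TimeScales.score_bound hpos hint hC1 hϑ (abs_nonneg K) hK'
    exact TimeScales.tendsto_infoInter (hint ϑ hϑ) hf (hM ϑ hϑ) hσ hσK T
  · have hc1 : Tendsto (fun T => Δ T / Δinf) atTop (𝓝 1) := by
      have := hD.div_const Δinf
      rwa [div_self hinf.ne'] at this
    -- The scale tends to one, but this form makes `ρ` exactly `T / Δinf`, so the limiting
    -- information appears without an error term.
    refine TimeScales.isRegularWithInformation_of_regime (c := fun T => Δ T / Δinf)
      (φ := fun y => TimeScales.scoreInfo (y * Δinf)) (C := 2) hpos hint hC1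
      hM hΔ hP hϑ hLip hne ?_ ?_ ?_ ?_ ?_ ?_ ?_
    · exact tendsto_nhdsWithin_iff.2 ⟨hD.div_atTop tendsto_id, hbpos⟩
    · filter_upwards [hDpos] with T h using div_pos h hinf
    · refine (tendsto_id.atTop_div_const hinf).congr' ?_
      filter_upwards [eventually_gt_atTop 0, hDpos] with T hT h
      simp only [id]
      field_simp
    · filter_upwards [hc1.eventually_const_le (show (1 / 2 : ℝ) < 1 by norm_num)] with T h y _ _
      refine (min_le_left _ _).trans ?_
      linarith
    · intro y hy Y hY
      have h1 : Tendsto (fun T => Δ T * Y T) atTop (𝓝 (y * Δinf)) := by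
        rw [mul_comm]
        exact hD.mul hY
      have hcont := (TimeScales.continuousOn_scoreInfo.continuousAt
        (Ioi_mem_nhds (mul_pos hy hinf))).tendsto
      have h2 := (hcont.comp h1).div hc1 one_ne_zero
      rw [div_one] at h2
      exact h2
    · exact fun y hy => TimeScales.scoreInfo_pos (mul_pos hy hinf)
    · filter_upwards [eventually_gt_atTop 0, hDpos] with T hT h
      have e : Δ T / Δinf / (Δ T / T) = T / Δinf := by field_simp
      rw [e, TimeScales.infoInter_eq hf hinf, div_mul_eq_mul_div, mul_div_assoc,
        ← intervalIntegral.integral_div]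
      congr 2
      funext s
      ring
  -- For long cells each increment carries information `1/2` in the limit, whatever the intensity,
  -- and `ρ = T / Δ` is asymptotically the number of cells.
  · refine TimeScales.isRegularWithInformation_of_regime (c := fun _ => 1)
      (φ := fun _ => 1 / 2) (C := 1) hpos hint hC1 hM hΔ hP hϑ hLip hne ?_ ?_ ?_ ?_ ?_ ?_ ?_
    · refine tendsto_nhdsWithin_iff.2 ⟨?_, hbpos⟩
      refine hTD.inv_tendsto_atTop.congr fun T => ?_
      rw [Pi.inv_apply, inv_div]
    · exact .of_forall fun _ => one_pos
    · refine hTD.congr fun T => ?_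
      rw [one_div, inv_div]
    · exact .of_forall fun T y _ _ => by
        rw [mul_one]
        exact min_le_left _ _
    · intro y hy Y hY
      simp only [div_one]
      exact TimeScales.tendsto_scoreInfo_atTop.comp (hD.atTop_mul_pos hy hY)
    · intro y _
      norm_num
    · refine .of_forall fun T => ?_
      rw [TimeScales.infoMacro, intervalIntegral.integral_const_mul, one_div (Δ T / T), inv_div]
      ring
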